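/- **Setting.** Graphs are finite and simple (no loops, no parallel edges), and either all undirected or all directed; a directed graph may contain both arcs $(u,v)$ and $(v,u)$. Write $|G|=|V(G)|+|E(G)|$. A set $S\subseteq\mathbb N$ is *finitely recognizable* if $S=\alpha^{-1}(F)$ for some homomorphism $\alpha$ from $(\mathbb N,+)$ to a finite monoid $M$ and some $F\subseteq M$ (equivalently, $S$ is ultimately periodic). *Counting Modal Logic* (CML). Formulas over vertex sets $X_1,\dots,X_p$ and edge sets $Y_1,\dots,Y_q$ of $G$ are built from the atoms $X_i$, $Y_j$ (and, for directed graphs, $\downarrow,\uparrow$) by the connectives $\neg,\wedge,\vee,\Rightarrow,\Leftrightarrow$ and the quantifiers $\Diamond^S,\Box^S$ with $S$ finitely recognizable; $Y_j,\downarrow,\uparrow$ may occur only under a quantifier. A formula is evaluated in a vertex $v$, which after the first quantifier has been accessed through an edge $e$: $X_i$ means $v\in X_i$; $Y_j$ means $e\in Y_j$; $\downarrow$ (resp. $\uparrow$) means that the arc $e$ is directed towards $v$ (resp. away from $v$); $\Diamond^S\psi$ means that the number of edges $vw$ (in a directed graph: arcs $vw$ or $wv$) such that $\psi$ is true in $w$,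 accessed through this edge, belongs to $S$; $\Box^S\psi$ means $\neg\Diamond^S\neg\psi$. An *instance* $I=(G,\overline{FX},\overline{FY},\overline k)$ consists of a graph $G$, a vector of fixed vertex sets, a vector of fixed edge sets and a vector of integer parameters. A class $\mathcal K$ of instances with fixed lengths of these vectors (all undirected, or all directed) is *expressible in ECML* if there is a formula $$\varphi=\exists_{\overline X}\,\exists_{\overline Y}\,\bigl[\phi\wedge\forall_v\; G,\overline{FX},\overline{FY},\overline X,\overline Y,v\models\psi\bigr]$$ such that $I\in\mathcal K$ iff $I$ satisfies $\varphi$. Here $\overline X$, $\overline Y$ are vectors of subsets of $V(G)$ and of $E(G)$; $\phi$ is a quantifier-free arithmetic formula (a Boolean combination of comparisons $=,\le,<$ of terms built with $+,-,\cdot$ and integer constants) over the parameters, $|V(G)|$, $|E(G)|$ and the cardinalities of all fixed and quantified sets; and $\psi$ is a CML formula over all fixed and quantified sets. **Theorem.** Let $\mathcal K$ be a class of instances expressible in ECML. Then there are constants $C,c,d$, depending only on $\mathcal K$, and an algorithm that, given an instance $I=(G,\overline{FX},\overline{FY},\overline k)$ along with a tree decomposition $\mathbb T$ of $G$ of width $t$,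 decides whether $I\in\mathcal K$ in time at most $$C\cdot c^{\,t}\cdot\bigl(|G|+|\mathbb T|+\|\overline k\|\bigr)^{d},$$ where $|\mathbb T|$ is the number of nodes of $\mathbb T$ and $\|\overline k\|$ is the total length of the binary representations of the parameters (so the time is $c^t|G|^{O(1)}$ whenever $|\mathbb T|$ and $\|\overline k\|$ are polynomial in $|G|$). Moreover, for every ECML formula $\varphi$ defining $\mathcal K$, there is an algorithm with a running time of the same form (with constants depending only on $\varphi$) that computes, in binary, the number of pairs of vectors $(\overline X,\overline Y)$ for which the part of $\varphi$ in square brackets holds. If all bags are empty, then $t$ is read as $0$. (Time is the number of steps of while programs over cons cells with unit-cost constructor, projections and test for nil, a model polynomially equivalent to Turing machines.) -/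

import Mathlib

/-! ### Machine model: while programs on binary trees

Values are immutable binary trees (`nil`-terminated cons cells). A program transforms one value; all
data, including integers, have to be built from cons cells, so there is no arithmetic at unit cost
and no equality test on whole trees. Each primitive handles a constant number of pointers to cons
cells and is charged one step, hence the number of steps is polynomially related to the running
time on Turing machines and on random access machines. -/

/-- Binary trees, the values of the machine model. -/
inductive TreeVal : Type
  | nil : TreeVal
  | cons (x y : TreeVal) : TreeVal

namespace TreeVal

/-- The left component; the head of `nil` is `nil`. -/
def hd : TreeVal → TreeVal
  | nil => nil
  | cons x _ => x

/-- The right component; the tail of `nil` is `nil`. -/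
def tl : TreeVal → TreeVal
  | nil => nil
  | cons _ y => y

/-- A list of values as a `nil`-terminated chain of cons cells. -/
def ofList : List TreeVal → TreeVal
  | [] => nil
  | x :: l => cons x (ofList l)

/-- Truth values: `nil` is false, `cons nil nil` is true. -/
def ofBool : Bool → TreeVal
  | false => nil
  | true => cons nil nil

/-- Natural numbers in binary, least significant bit first. -/
def ofNat (k : ℕ) : TreeVal := ofList (k.bits.map ofBool)

/-- Integers in binary: sign and absolute value. -/
def ofInt (z : ℤ) : TreeVal := cons (ofBool (decide (z < 0))) (ofNat z.natAbs)

/-- Elements of `Fin n`, as binary numbers. -/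
def ofFin {n : ℕ} (i : Fin n) : TreeVal := ofNat i

/-- Pairs of elements of `Fin n`. -/
def ofFinPair {n : ℕ} (e : Fin n × Fin n) : TreeVal := cons (ofFin e.1) (ofFin e.2)

/-- Subsets of `Fin n`, as the increasing list of their elements. -/
def ofFinset {n : ℕ} (s : Finset (Fin n)) : TreeVal := ofList ((s.sort (· ≤ ·)).map ofFin)

/-- Vectors of values. -/
def ofVec {n : ℕ} (f : Fin n → TreeVal) : TreeVal := ofList (List.ofFn f)

end TreeVal

/-- Programs: `seq f g` runs `f` and then `g` on the result, `ite c f g` runs `f` if `c` yields a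
non-`nil` value and `g` otherwise, `loop c f` runs `f` as long as `c` yields a non-`nil` value. -/
inductive TreeProg : Type
  | id : TreeProg
  | nil : TreeProg
  | hd : TreeProg
  | tl : TreeProg
  | cons (f g : TreeProg) : TreeProg
  | seq (f g : TreeProg) : TreeProg
  | ite (c f g : TreeProg) : TreeProg
  | loop (c f : TreeProg) : TreeProg

namespace TreeProg

/-- `Run P x y s`: on input `x` the program `P` halts with output `y` after exactly `s` steps. -/
inductive Run : TreeProg → TreeVal → TreeVal → ℕ → Prop
  | id (x : TreeVal) : Run .id x x 1
  | nil (x : TreeVal) : Run .nil x .nil 1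
  | hd (x : TreeVal) : Run .hd x x.hd 1
  | tl (x : TreeVal) : Run .tl x x.tl 1
  | cons {f g : TreeProg} {x y z : TreeVal} {s t : ℕ} :
      Run f x y s → Run g x z t → Run (.cons f g) x (.cons y z) (s + t + 1)
  | seq {f g : TreeProg} {x y z : TreeVal} {s t : ℕ} :
      Run f x y s → Run g y z t → Run (.seq f g) x z (s + t + 1)
  | ite_true {c f g : TreeProg} {x u v y : TreeVal} {s t : ℕ} :
      Run c x (.cons u v) s → Run f x y t → Run (.ite c f g) x y (s + t + 1)
  | ite_false {c f g : TreeProg} {x y : TreeVal} {s t : ℕ} :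
      Run c x .nil s → Run g x y t → Run (.ite c f g) x y (s + t + 1)
  | loop_stop {c f : TreeProg} {x : TreeVal} {s : ℕ} :
      Run c x .nil s → Run (.loop c f) x x (s + 1)
  | loop_step {c f : TreeProg} {x u v y z : TreeVal} {s t w : ℕ} :
      Run c x (.cons u v) s → Run f x y t → Run (.loop c f) y z w →
        Run (.loop c f) x z (s + t + w + 1)

/-- On input `x` the program `P` halts with output `y` after at most `T` steps. -/
def RunsWithin (P : TreeProg) (x y : TreeVal) (T : ℕ) : Prop := ∃ s ≤ T, P.Run x y s

/-- Programs are deterministic: output and number of steps are determined by the input. -/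
theorem Run.unique {P : TreeProg} {x y : TreeVal} {s : ℕ} (h : P.Run x y s) :
    ∀ {y' : TreeVal} {s' : ℕ}, P.Run x y' s' → y = y' ∧ s = s' := by
  induction h with
  | id | nil | hd | tl => intro y' s' h'; cases h'; exact ⟨rfl, rfl⟩
  | cons _ _ ih1 ih2 =>
    intro y' s' h'
    cases h' with
    | cons h1 h2 =>
      obtain ⟨rfl, rfl⟩ := ih1 h1
      obtain ⟨rfl, rfl⟩ := ih2 h2
      exact ⟨rfl, rfl⟩
  | seq _ _ ih1 ih2 =>
    intro y' s' h'
    cases h' with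
    | seq h1 h2 =>
      obtain ⟨rfl, rfl⟩ := ih1 h1
      obtain ⟨rfl, rfl⟩ := ih2 h2
      exact ⟨rfl, rfl⟩
  | ite_true _ _ ih1 ih2 =>
    intro y' s' h'
    cases h' with
    | ite_true h1 h2 =>
      obtain ⟨_, rfl⟩ := ih1 h1
      obtain ⟨rfl, rfl⟩ := ih2 h2
      exact ⟨rfl, rfl⟩
    | ite_false h1 h2 => exact absurd (ih1 h1).1 (by simp)
  | ite_false _ _ ih1 ih2 =>
    intro y' s' h'
    cases h' with
    | ite_true h1 h2 => exact absurd (ih1 h1).1 (by simp)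
    | ite_false h1 h2 =>
      obtain ⟨_, rfl⟩ := ih1 h1
      obtain ⟨rfl, rfl⟩ := ih2 h2
      exact ⟨rfl, rfl⟩
  | loop_stop _ ih1 =>
    intro y' s' h'
    cases h' with
    | loop_stop h1 =>
      obtain ⟨_, rfl⟩ := ih1 h1
      exact ⟨rfl, rfl⟩
    | loop_step h1 h2 h3 => exact absurd (ih1 h1).1 (by simp)
  | loop_step _ _ _ ih1 ih2 ih3 =>
    intro y' s' h'
    cases h' with
    | loop_stop h1 => exact absurd (ih1 h1).1 (by simp)
    | loop_step h1 h2 h3 =>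
      obtain ⟨_, rfl⟩ := ih1 h1
      obtain ⟨rfl, rfl⟩ := ih2 h2
      obtain ⟨rfl, rfl⟩ := ih3 h3
      exact ⟨rfl, rfl⟩

end TreeProg

/-! ### Graphs and instances -/

/-- A finite simple graph, directed if `dir = true` and undirected if `dir = false`, with vertices
`0, …, n - 1` and edges (arcs) `0, …, m - 1`. The edge `e` joins the two components of `ends e`; in
the directed case it leads from the first to the second one, in the undirected case their order has
no meaning. There are no loops and no parallel edges; a directed graph may contain both `(u, v)`
and `(v, u)`. -/
structure FinGraph (dir : Bool) where
  n : ℕ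
  m : ℕ
  ends : Fin m → Fin n × Fin n
  loopless : ∀ e, (ends e).1 ≠ (ends e).2
  simple : ∀ e f, (ends e = ends f ∨ (dir = false ∧ ends e = (ends f).swap)) → e = f

namespace FinGraph

variable {dir : Bool} (G : FinGraph dir)

/-- The edge `e` is incident with the vertex `v`. -/
def Inc (e : Fin G.m) (v : Fin G.n) : Prop := (G.ends e).1 = v ∨ (G.ends e).2 = v

/-- The endpoint of `e` other than `v`, for an edge `e` incident with `v`. -/
def other (e : Fin G.m) (v : Fin G.n) : Fin G.n :=
  if (G.ends e).1 = v then (G.ends e).2 else (G.ends e).1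

/-- `|G| = |V(G)| + |E(G)|`. -/
def size : ℕ := G.n + G.m

end FinGraph

/-- An instance: a graph, `a` fixed vertex sets, `b` fixed edge sets and `r` integer parameters. -/
structure ECMLInstance (dir : Bool) (a b r : ℕ) where
  G : FinGraph dir
  FX : Fin a → Finset (Fin G.n)
  FY : Fin b → Finset (Fin G.m)
  k : Fin r → ℤ

/-- A tree decomposition of `G` with nodes `0, …, N - 1`. -/
structure FinGraph.TreeDecomposition {dir : Bool} (G : FinGraph dir) where
  N : ℕ
  tree : SimpleGraph (Fin N)
  isTree : tree.IsTree
  bag : Fin N → Finset (Fin G.n)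
  cover : ∀ v, ∃ x, v ∈ bag x
  edge : ∀ e, ∃ x, (G.ends e).1 ∈ bag x ∧ (G.ends e).2 ∈ bag x
  path : ∀ (v : Fin G.n) (x y z : Fin N) (w : tree.Walk x y), w.IsPath → z ∈ w.support →
    v ∈ bag x → v ∈ bag y → v ∈ bag z

/-- The width: the size of a largest bag minus one (and `0` if all bags are empty). -/
def FinGraph.TreeDecomposition.width {dir : Bool} {G : FinGraph dir}
    (D : G.TreeDecomposition) : ℕ :=
  (Finset.univ.sup fun x => (D.bag x).card) - 1

/-! ### Counting modal logic -/

/-- `S` is the preimage of a subset of a finite monoid under a homomorphism from `(ℕ, +)`. -/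
def FinitelyRecognizable (S : Set ℕ) : Prop :=
  ∃ (M : Type) (_ : AddMonoid M) (_ : Finite M) (α : ℕ →+ M) (F : Set M), S = α ⁻¹' F

/-- Formulas of counting modal logic over vertex sets indexed by `ι` and edge sets indexed by `κ`.
`arcIn` and `arcOut` are the operators `↓` and `↑`. -/
inductive CMLFormula (ι κ : Type) : Type
  | neg (ψ : CMLFormula ι κ) : CMLFormula ι κ
  | and (ψ χ : CMLFormula ι κ) : CMLFormula ι κ
  | or (ψ χ : CMLFormula ι κ) : CMLFormula ι κ
  | imp (ψ χ : CMLFormula ι κ) : CMLFormula ι κ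
  | iff (ψ χ : CMLFormula ι κ) : CMLFormula ι κ
  | inX (i : ι) : CMLFormula ι κ
  | inY (j : κ) : CMLFormula ι κ
  | arcIn : CMLFormula ι κ
  | arcOut : CMLFormula ι κ
  | dia (S : Set ℕ) (hS : FinitelyRecognizable S) (ψ : CMLFormula ι κ) : CMLFormula ι κ
  | box (S : Set ℕ) (hS : FinitelyRecognizable S) (ψ : CMLFormula ι κ) : CMLFormula ι κ

namespace CMLFormula

variable {ι κ : Type}

/-- Well-formedness. The flag `acc` says whether the formula stands under a modal quantifier: edge
operators are admitted only there, and arrows only if moreover the graphs are directed. -/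
def WF (dir : Bool) : (acc : Bool) → CMLFormula ι κ → Prop
  | acc, neg ψ => ψ.WF dir acc
  | acc, and ψ χ => ψ.WF dir acc ∧ χ.WF dir acc
  | acc, or ψ χ => ψ.WF dir acc ∧ χ.WF dir acc
  | acc, imp ψ χ => ψ.WF dir acc ∧ χ.WF dir acc
  | acc, iff ψ χ => ψ.WF dir acc ∧ χ.WF dir acc
  | _, inX _ => True
  | acc, inY _ => acc = true
  | acc, arcIn => acc = true ∧ dir = true
  | acc, arcOut => acc = true ∧ dir = true
  | _, dia _ _ ψ => ψ.WF dir true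
  | _, box _ _ ψ => ψ.WF dir true

/-- `ψ.Sat G X Y v o`: the formula `ψ` is true in the vertex `v`, where `o = some e` if `v` has been
accessed through the edge `e`, and `o = none` if no modal quantifier has been evaluated yet (the
edge operators are then not admitted). A neighbour accessible through two opposite arcs is
considered once for each of them. -/
def Sat {dir : Bool} (G : FinGraph dir) (X : ι → Finset (Fin G.n)) (Y : κ → Finset (Fin G.m)) :
    CMLFormula ι κ → Fin G.n → Option (Fin G.m) → Prop
  | neg ψ, v, o => ¬ ψ.Sat G X Y v o
  | and ψ χ, v, o => ψ.Sat G X Y v o ∧ χ.Sat G X Y v o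
  | or ψ χ, v, o => ψ.Sat G X Y v o ∨ χ.Sat G X Y v o
  | imp ψ χ, v, o => ψ.Sat G X Y v o → χ.Sat G X Y v o
  | iff ψ χ, v, o => ψ.Sat G X Y v o ↔ χ.Sat G X Y v o
  | inX i, v, _ => v ∈ X i
  | inY j, _, o => ∃ e, o = some e ∧ e ∈ Y j
  | arcIn, v, o => ∃ e, o = some e ∧ (G.ends e).2 = v
  | arcOut, v, o => ∃ e, o = some e ∧ (G.ends e).1 = v
  | dia S _ ψ, v, _ => {e | G.Inc e v ∧ ψ.Sat G X Y (G.other e v) (some e)}.ncard ∈ S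
  | box S _ ψ, v, _ => ¬ {e | G.Inc e v ∧ ¬ ψ.Sat G X Y (G.other e v) (some e)}.ncard ∈ S

end CMLFormula

/-! ### Existential counting modal logic -/

/-- Arithmetic terms over `r` parameters, the numbers of vertices and edges, and the cardinalities
of `a` fixed and `p` quantified vertex sets and of `b` fixed and `q` quantified edge sets. -/
inductive ArithTerm (a b r p q : ℕ) : Type
  | const (z : ℤ) : ArithTerm a b r p q
  | param (i : Fin r) : ArithTerm a b r p q
  | numV : ArithTerm a b r p q
  | numE : ArithTerm a b r p q
  | cardFX (i : Fin a) : ArithTerm a b r p q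
  | cardFY (j : Fin b) : ArithTerm a b r p q
  | cardX (i : Fin p) : ArithTerm a b r p q
  | cardY (j : Fin q) : ArithTerm a b r p q
  | add (s t : ArithTerm a b r p q) : ArithTerm a b r p q
  | sub (s t : ArithTerm a b r p q) : ArithTerm a b r p q
  | mul (s t : ArithTerm a b r p q) : ArithTerm a b r p q

/-- Quantifier-free arithmetic formulas. -/
inductive ArithFormula (a b r p q : ℕ) : Type
  | eq (s t : ArithTerm a b r p q) : ArithFormula a b r p q
  | le (s t : ArithTerm a b r p q) : ArithFormula a b r p q
  | lt (s t : ArithTerm a b r p q) : ArithFormula a b r p q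
  | neg (f : ArithFormula a b r p q) : ArithFormula a b r p q
  | and (f g : ArithFormula a b r p q) : ArithFormula a b r p q
  | or (f g : ArithFormula a b r p q) : ArithFormula a b r p q
  | imp (f g : ArithFormula a b r p q) : ArithFormula a b r p q
  | iff (f g : ArithFormula a b r p q) : ArithFormula a b r p q

section Semantics

variable {dir : Bool} {a b r p q : ℕ}

/-- The value of an arithmetic term. -/
def ArithTerm.eval (I : ECMLInstance dir a b r) (X : Fin p → Finset (Fin I.G.n))
    (Y : Fin q → Finset (Fin I.G.m)) : ArithTerm a b r p q → ℤ
  | const z => z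
  | param i => I.k i
  | numV => I.G.n
  | numE => I.G.m
  | cardFX i => (I.FX i).card
  | cardFY j => (I.FY j).card
  | cardX i => (X i).card
  | cardY j => (Y j).card
  | add s t => s.eval I X Y + t.eval I X Y
  | sub s t => s.eval I X Y - t.eval I X Y
  | mul s t => s.eval I X Y * t.eval I X Y

/-- The truth of an arithmetic formula. -/
def ArithFormula.Holds (I : ECMLInstance dir a b r) (X : Fin p → Finset (Fin I.G.n))
    (Y : Fin q → Finset (Fin I.G.m)) : ArithFormula a b r p q → Prop
  | eq s t => s.eval I X Y = t.eval I X Y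
  | le s t => s.eval I X Y ≤ t.eval I X Y
  | lt s t => s.eval I X Y < t.eval I X Y
  | neg f => ¬ f.Holds I X Y
  | and f g => f.Holds I X Y ∧ g.Holds I X Y
  | or f g => f.Holds I X Y ∨ g.Holds I X Y
  | imp f g => f.Holds I X Y → g.Holds I X Y
  | iff f g => f.Holds I X Y ↔ g.Holds I X Y

end Semantics

/-- A formula `∃ X₁ … X_p ∃ Y₁ … Y_q [arith ∧ ∀ v, modal]`, where the modal part speaks about all
fixed and quantified sets. -/
structure ECMLFormula (dir : Bool) (a b r p q : ℕ) where
  arith : ArithFormula a b r p q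
  modal : CMLFormula (Fin a ⊕ Fin p) (Fin b ⊕ Fin q)
  wf : modal.WF dir false

namespace ECMLFormula

variable {dir : Bool} {a b r p q : ℕ}

/-- The vectors `X`, `Y` satisfy the part of the formula inside the set quantifiers. -/
def Solution (φ : ECMLFormula dir a b r p q) (I : ECMLInstance dir a b r)
    (X : Fin p → Finset (Fin I.G.n)) (Y : Fin q → Finset (Fin I.G.m)) : Prop :=
  φ.arith.Holds I X Y ∧ ∀ v, φ.modal.Sat I.G (Sum.elim I.FX X) (Sum.elim I.FY Y) v none

/-- `φ` defines the class `K`: an instance belongs to `K` iff it satisfies `φ`. -/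
def Defines (φ : ECMLFormula dir a b r p q) (K : Set (ECMLInstance dir a b r)) : Prop :=
  ∀ I, I ∈ K ↔ ∃ X Y, φ.Solution I X Y

/-- The number of pairs of vectors `X`, `Y` that satisfy the formula. -/
noncomputable def numSolutions (φ : ECMLFormula dir a b r p q) (I : ECMLInstance dir a b r) : ℕ :=
  {S : (Fin p → Finset (Fin I.G.n)) × (Fin q → Finset (Fin I.G.m)) | φ.Solution I S.1 S.2}.ncard

end ECMLFormula

/-- A class of instances is expressible in existential counting modal logic. -/
def ExpressibleInECML {dir : Bool} {a b r : ℕ} (K : Set (ECMLInstance dir a b r)) : Prop :=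
  ∃ (p q : ℕ) (φ : ECMLFormula dir a b r p q), φ.Defines K

/-! ### Inputs of algorithms and running time -/

namespace ECMLInstance

variable {dir : Bool} {a b r : ℕ}

/-- The encoding of an instance: the number of vertices, the list of edges, the fixed sets and the
parameters. -/
def encode (I : ECMLInstance dir a b r) : TreeVal :=
  .ofList
    [.ofNat I.G.n,
     .ofVec fun e => .ofFinPair (I.G.ends e),
     .ofVec fun i => .ofFinset (I.FX i),
     .ofVec fun j => .ofFinset (I.FY j),
     .ofVec fun i => .ofInt (I.k i)]

end ECMLInstance

open Classical in
/-- The encoding of a tree decomposition: the number of nodes, the list of edges of the tree and the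
list of bags. -/
noncomputable def FinGraph.TreeDecomposition.encode {dir : Bool} {G : FinGraph dir}
    (D : G.TreeDecomposition) : TreeVal :=
  .ofList
    [.ofNat D.N,
     .ofList ((((List.finRange D.N).product (List.finRange D.N)).filter
        fun e => decide (e.1 < e.2 ∧ D.tree.Adj e.1 e.2)).map .ofFinPair),
     .ofVec fun x => .ofFinset (D.bag x)]

/-- The size of the input: `|G|`, plus the number of nodes of the tree decomposition, plus the
lengths of the binary representations of the parameters. -/
def inputSize {dir : Bool} {a b r : ℕ} (I : ECMLInstance dir a b r)
    (D : I.G.TreeDecomposition) : ℕ :=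
  I.G.size + D.N + ∑ i, (I.k i).natAbs.size

/-- There are constants `C`, `c`, `d` and an algorithm that, given any instance `I` along with a tree
decomposition of its graph, outputs `f I` in time `C * c ^ t * s ^ d`, where `t` is the width of the
tree decomposition and `s` is the size of the input. -/
def ComputableInSingleExponentialTime {dir : Bool} {a b r : ℕ}
    (f : ECMLInstance dir a b r → TreeVal) : Prop :=
  ∃ (C c d : ℕ) (P : TreeProg), ∀ (I : ECMLInstance dir a b r) (D : I.G.TreeDecomposition),
    P.RunsWithin (.cons I.encode D.encode) (f I) (C * c ^ D.width * inputSize I D ^ d)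

/-!
# Counting solutions of existential counting modal logic over tree decompositions

Both claims follow from one algorithm that counts the solutions `(X, Y)`: membership in the class
means that their number is not zero.

*Local verification.* A modal formula has finitely many modal subformulas, and their truth values at
the vertices are determined by local conditions: each vertex guesses these truth values, and the
guess for `◇^S ψ` at `v` has to agree with the number of edges at `v` leading to vertices where `ψ`
holds, computed in a finite monoid that recognizes `S`. The monoid may be replaced by the image of
`ℕ`, hence is commutative, and the order of the edges plays no role. There is exactly one correct
guess for given sets (`CMLFormula.exists_verifies`), so counting solutions amounts to counting
guesses. Let each vertex choose a label (the sets containing it and its guess) and each edge choose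
the labels of its endpoints and the sets containing it. A choice then contributes to each vertex a
state in a finite commutative monoid `Q`, namely the set of the labels attributed to the vertex so
far together with the sum of the counts received. A vertex accepts its total state if exactly one
label is attributed to it and this label passes the check. The solutions correspond to the choices
for which all vertices accept and the arithmetic formula holds for the sums of the counters, which
are the cardinalities of the sets (`Verifier.numSolutions_eq`).

*Elimination.* A table is a formal combination of keys, where a key assigns a state to each vertex and
a value to each counter; tables are multiplied by convolution, that is, in the monoid algebra of the
monoid of keys. Each vertex and each edge has a table of its choices, and the number of solutions is
obtained by evaluating the product of all tables. The vertices are eliminated one by one: the tables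
with a nonzero state at `v` are multiplied, the keys whose state at `v` is not accepted are
discarded, and the state at `v` is forgotten (`Table.evalKeys_eliminate`). For any set of remaining
vertices some bag contains all those that share a bag with a suitable remaining `v`
(`SimpleGraph.IsTree.exists_simplicial`); eliminating such a `v` keeps the nonzero states of each
table within a bag. Hence a table has at most `|Q| ^ (t + 1)` times polynomially many keys
(`Table.length_le`), the polynomial factor accounting for the counters.

*Running time.* Running times are measured in a size that is part of the encoding of a type and need
not be the number of cons cells; for inputs it includes `|Q| ^ (t + 1)`. All that has to be shown is
then that the algorithm takes polynomial time (`PT`), which follows from closure properties of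
polynomial-time functions, once the sizes of all intermediate tables are bounded (`PT.prod_run`).
-/

set_option linter.unusedSectionVars false


/-! ### Polynomially bounded functions -/

/-- A type whose elements are represented by values of the machine. The size `sz` is the measure in
which running times are stated; it is not required to be the number of cons cells, so that it can
include quantities such as `c ^ t`. -/
class Enc (α : Type) where
  enc : α → TreeVal
  sz : α → ℕ

open Enc (enc sz)

/-- `g` is bounded by a polynomial in the size of its argument. -/
def PolyLe {α : Type} [Enc α] (g : α → ℕ) : Prop := ∃ k : ℕ, ∀ x, g x ≤ (sz x + 2) ^ k

namespace PolyLe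

variable {α β : Type} [Enc α] [Enc β] {f g : α → ℕ}

theorem mono (hg : PolyLe g) (h : ∀ x, f x ≤ g x) : PolyLe f := by
  obtain ⟨k, hk⟩ := hg
  exact ⟨k, fun x => (h x).trans (hk x)⟩

theorem const (c : ℕ) : PolyLe fun _ : α => c := by
  refine ⟨c, fun x => ?_⟩
  calc c ≤ 2 ^ c := Nat.lt_two_pow_self.le
    _ ≤ _ := Nat.pow_le_pow_left (by omega) _

theorem size : PolyLe fun x : α => sz x := ⟨1, fun x => by simp⟩

theorem mul (hf : PolyLe f) (hg : PolyLe g) : PolyLe fun x => f x * g x := by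
  obtain ⟨k, hk⟩ := hf
  obtain ⟨l, hl⟩ := hg
  exact ⟨k + l, fun x => by rw [pow_add]; exact Nat.mul_le_mul (hk x) (hl x)⟩

theorem add (hf : PolyLe f) (hg : PolyLe g) : PolyLe fun x => f x + g x := by
  obtain ⟨k, hk⟩ := hf
  obtain ⟨l, hl⟩ := hg
  refine ⟨k + l + 1, fun x => ?_⟩
  have h1 : (sz x + 2) ^ k ≤ (sz x + 2) ^ (k + l) := Nat.pow_le_pow_right (by omega) (by omega)
  have h2 : (sz x + 2) ^ l ≤ (sz x + 2) ^ (k + l) := Nat.pow_le_pow_right (by omega) (by omega)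
  calc f x + g x ≤ (sz x + 2) ^ (k + l) * 2 := by have := hk x; have := hl x; omega
    _ ≤ (sz x + 2) ^ (k + l) * (sz x + 2) := Nat.mul_le_mul_left _ (by omega)
    _ = _ := by rw [pow_succ]

theorem pow (hf : PolyLe f) (c : ℕ) : PolyLe fun x => f x ^ c := by
  obtain ⟨k, hk⟩ := hf
  exact ⟨k * c, fun x => by rw [pow_mul]; exact Nat.pow_le_pow_left (hk x) c⟩

theorem comp {u : β → ℕ} {p : α → β} (hu : PolyLe u) (hp : PolyLe fun x => sz (p x)) :
    PolyLe fun x => u (p x) := by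
  obtain ⟨k, hk⟩ := hu
  exact ((hp.add (const 2)).pow k).mono fun x => hk (p x)

end PolyLe

/-! ### Encodings of data -/

instance : Enc Bool := ⟨TreeVal.ofBool, fun _ => 1⟩

instance {α β : Type} [Enc α] [Enc β] : Enc (α × β) :=
  ⟨fun x => .cons (enc x.1) (enc x.2), fun x => sz x.1 + sz x.2⟩

instance {α : Type} [Enc α] : Enc (List α) :=
  ⟨fun l => .ofList (l.map enc), fun l => (l.map fun a => sz a + 1).sum⟩

instance : Enc ℕ := ⟨TreeVal.ofNat, Nat.size⟩

instance : Enc ℤ := ⟨TreeVal.ofInt, fun z => z.natAbs.size⟩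

/-- A subtype inherits the encoding, so that statements about inputs from a set can be made. -/
instance {α : Type} [Enc α] {p : α → Prop} : Enc {x // p x} := ⟨fun x => enc x.1, fun x => sz x.1⟩

section EncLemmas

variable {α β : Type} [Enc α] [Enc β]

@[simp] theorem sz_prod (x : α × β) : sz x = sz x.1 + sz x.2 := rfl
@[simp] theorem sz_bool (x : Bool) : sz x = 1 := rfl
@[simp] theorem sz_nat (x : ℕ) : sz x = x.size := rfl
@[simp] theorem sz_int (x : ℤ) : sz x = x.natAbs.size := rfl
@[simp] theorem sz_nil : sz ([] : List α) = 0 := rfl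
@[simp] theorem sz_cons (a : α) (l : List α) : sz (a :: l) = sz a + 1 + sz l := by
  simp [Enc.sz]
@[simp] theorem sz_append (l l' : List α) : sz (l ++ l') = sz l + sz l' := by
  simp [Enc.sz]
@[simp] theorem sz_reverse (l : List α) : sz l.reverse = sz l := by
  simp [Enc.sz]
@[simp] theorem sz_subtype {p : α → Prop} (x : {x // p x}) : sz x = sz x.1 := rfl

theorem sz_list (l : List α) : sz l = (l.map fun a => sz a + 1).sum := rfl

theorem length_le_sz (l : List α) : l.length ≤ sz l := by
  induction l with
  | nil => simp
  | cons a l ih => simp; omega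

theorem sz_le_of_mem {l : List α} {a : α} (h : a ∈ l) : sz a < sz l := by
  obtain ⟨s, t, rfl⟩ := List.append_of_mem h
  simp; omega

theorem sz_list_le {l : List α} {b : ℕ} (h : ∀ a ∈ l, sz a ≤ b) : sz l ≤ l.length * (b + 1) := by
  rw [sz_list]
  have := List.sum_le_card_nsmul (l.map fun a => sz a + 1) (b + 1) (by
    intro x hx
    obtain ⟨a, ha, rfl⟩ := List.mem_map.1 hx
    exact Nat.succ_le_succ (h a ha))
  simpa using this

theorem sz_sublist {l l' : List α} (h : l.Sublist l') : sz l ≤ sz l' :=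
  (h.map _).sum_le_sum (by simp)

end EncLemmas

namespace TreeProg.RunsWithin

open TreeProg

theorem mono {P : TreeProg} {x y : TreeVal} {S T : ℕ} (h : P.RunsWithin x y S) (hST : S ≤ T) :
    P.RunsWithin x y T := by
  obtain ⟨s, hs, hr⟩ := h
  exact ⟨s, hs.trans hST, hr⟩

theorem id (x : TreeVal) : TreeProg.id.RunsWithin x x 1 := ⟨1, le_rfl, .id x⟩
theorem nil (x : TreeVal) : TreeProg.nil.RunsWithin x .nil 1 := ⟨1, le_rfl, .nil x⟩
theorem hd (x : TreeVal) : TreeProg.hd.RunsWithin x x.hd 1 := ⟨1, le_rfl, .hd x⟩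
theorem tl (x : TreeVal) : TreeProg.tl.RunsWithin x x.tl 1 := ⟨1, le_rfl, .tl x⟩

theorem cons {P Q : TreeProg} {x y z : TreeVal} {S T : ℕ} (h : P.RunsWithin x y S)
    (h' : Q.RunsWithin x z T) : (TreeProg.cons P Q).RunsWithin x (.cons y z) (S + T + 1) := by
  obtain ⟨s, hs, hr⟩ := h
  obtain ⟨t, ht, hr'⟩ := h'
  exact ⟨s + t + 1, by omega, .cons hr hr'⟩

theorem seq {P Q : TreeProg} {x y z : TreeVal} {S T : ℕ} (h : P.RunsWithin x y S)
    (h' : Q.RunsWithin y z T) : (TreeProg.seq P Q).RunsWithin x z (S + T + 1) := by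
  obtain ⟨s, hs, hr⟩ := h
  obtain ⟨t, ht, hr'⟩ := h'
  exact ⟨s + t + 1, by omega, .seq hr hr'⟩

theorem ite_true {P Q R : TreeProg} {x u v y : TreeVal} {S T : ℕ}
    (h : P.RunsWithin x (.cons u v) S) (h' : Q.RunsWithin x y T) :
    (TreeProg.ite P Q R).RunsWithin x y (S + T + 1) := by
  obtain ⟨s, hs, hr⟩ := h
  obtain ⟨t, ht, hr'⟩ := h'
  exact ⟨s + t + 1, by omega, .ite_true hr hr'⟩

theorem ite_false {P Q R : TreeProg} {x y : TreeVal} {S T : ℕ}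
    (h : P.RunsWithin x .nil S) (h' : R.RunsWithin x y T) :
    (TreeProg.ite P Q R).RunsWithin x y (S + T + 1) := by
  obtain ⟨s, hs, hr⟩ := h
  obtain ⟨t, ht, hr'⟩ := h'
  exact ⟨s + t + 1, by omega, .ite_false hr hr'⟩

theorem loop_stop {P Q : TreeProg} {x : TreeVal} {S : ℕ} (h : P.RunsWithin x .nil S) :
    (TreeProg.loop P Q).RunsWithin x x (S + 1) := by
  obtain ⟨s, hs, hr⟩ := h
  exact ⟨s + 1, by omega, Run.loop_stop hr⟩

theorem loop_step {P Q : TreeProg} {x u v y z : TreeVal} {S T U : ℕ}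
    (h : P.RunsWithin x (.cons u v) S) (h' : Q.RunsWithin x y T)
    (h'' : (TreeProg.loop P Q).RunsWithin y z U) :
    (TreeProg.loop P Q).RunsWithin x z (S + T + U + 1) := by
  obtain ⟨s, hs, hr⟩ := h
  obtain ⟨t, ht, hr'⟩ := h'
  obtain ⟨w, hw, hr''⟩ := h''
  exact ⟨s + t + w + 1, by omega, .loop_step hr hr' hr''⟩

end TreeProg.RunsWithin

/-! ### Polynomial-time functions -/

/-- One round of a loop over a list: on a triple of the remaining list, the context and the
accumulator, apply `P` to the context, the accumulator and the head of the list. -/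
def TreeProg.foldBody (P : TreeProg) : TreeProg :=
  .cons (.seq .hd .tl) (.cons (.seq .tl .hd)
    (.seq (.cons (.seq .tl .hd) (.cons (.seq .tl .tl) (.seq .hd .hd))) P))

/-- A loop over a list computes the fold, if `P` computes each step in time `t`. The constant `30` is
a bound for the bookkeeping of one round. -/
theorem TreeProg.runsWithin_fold {α β : Type} [Enc α] [Enc β] {P : TreeProg} {c : TreeVal}
    {f : β → α → β} {t : ℕ} (l : List α) (b : β)
    (h : ∀ pre a suf, l = pre ++ a :: suf →
      P.RunsWithin (.cons c (.cons (enc (pre.foldl f b)) (enc a)))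
        (enc (f (pre.foldl f b) a)) t) :
    (TreeProg.loop .hd P.foldBody).RunsWithin (.cons (enc l) (.cons c (enc b)))
      (.cons .nil (.cons c (enc (l.foldl f b)))) (l.length * (t + 30) + 2) := by
  induction l generalizing b with
  | nil => exact (RunsWithin.loop_stop (.hd _)).mono (by simp)
  | cons a l ih =>
    have h0 := h [] a l rfl
    have ih' := ih (f b a) fun pre a' suf e => h (a :: pre) a' suf (by simp [e])
    refine (RunsWithin.loop_step (T := t + 20) (.hd _) ?_ ih').mono ?_
    · exact (RunsWithin.cons (.seq (.hd _) (.tl _)) (.cons (.seq (.tl _) (.hd _))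
        (.seq (.cons (.seq (.tl _) (.hd _)) (.cons (.seq (.tl _) (.tl _)) (.seq (.hd _) (.hd _))))
          h0))).mono (by omega)
    · simp only [List.length_cons]
      ring_nf; omega

theorem List.foldl_cons_eq {α β : Type*} (l : List α) (f : α → β) (init : List β) :
    l.foldl (fun acc a => f a :: acc) init = (l.map f).reverse ++ init := by
  induction l generalizing init with
  | nil => rfl
  | cons a l ih => simp [ih]

/-- `f` is computed by a program in polynomial time and has values of polynomial size, both in terms
of `sz`. The closure properties below play the role of a programming language: an algorithm is
written as an ordinary function, and its running time is bounded by following its definition. -/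
def PT {α β : Type} [Enc α] [Enc β] (f : α → β) : Prop :=
  PolyLe (fun x => sz (f x)) ∧ ∃ (P : TreeProg) (T : α → ℕ), PolyLe T ∧
    ∀ x, P.RunsWithin (enc x) (enc (f x)) (T x)

namespace PT

variable {α β γ δ ε : Type} [Enc α] [Enc β] [Enc γ] [Enc δ] [Enc ε]

theorem congr {f g : α → β} (hf : PT f) (h : ∀ x, g x = f x) : PT g := by
  rwa [show g = f from funext h]

/-- A function that does not change the encoding. -/
theorem of_enc_eq {f : α → β} (h : ∀ x, enc (f x) = enc x) (hs : PolyLe fun x => sz (f x)) :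
    PT f :=
  ⟨hs, .id, fun _ => 1, .const 1, fun x => by rw [h]; exact .id _⟩

theorem id : PT fun x : α => x := of_enc_eq (fun _ => rfl) .size

theorem comp {g : β → γ} {f : α → β} (hg : PT g) (hf : PT f) : PT fun x => g (f x) := by
  obtain ⟨hgs, P, T, hT, hP⟩ := hg
  obtain ⟨hfs, Q, U, hU, hQ⟩ := hf
  exact ⟨hgs.comp hfs, .seq Q P, _, (hU.add (hT.comp hfs)).add (.const 1),
    fun x => (hQ x).seq (hP (f x))⟩

theorem val {p : α → Prop} : PT fun x : {x : α // p x} => x.1 := of_enc_eq (fun _ => rfl) .size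

/-- Restriction of the target to a subtype. -/
theorem subtype_mk {p : β → Prop} {f : α → β} (hf : PT f) (h : ∀ x, p (f x)) :
    PT fun x => (⟨f x, h x⟩ : {y // p y}) := hf

theorem pair {f : α → β} {g : α → γ} (hf : PT f) (hg : PT g) : PT fun x => (f x, g x) := by
  obtain ⟨hgs, P, T, hT, hP⟩ := hg
  obtain ⟨hfs, Q, U, hU, hQ⟩ := hf
  exact ⟨hfs.add hgs, .cons Q P, _, (hU.add hT).add (.const 1), fun x => (hQ x).cons (hP x)⟩

theorem fst {f : α → β × γ} (hf : PT f) : PT fun x => (f x).1 :=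
  comp (g := Prod.fst) ⟨PolyLe.size.mono fun x => by simp, .hd, _, .const 1, fun x => .hd _⟩ hf

theorem snd {f : α → β × γ} (hf : PT f) : PT fun x => (f x).2 :=
  comp (g := Prod.snd) ⟨PolyLe.size.mono fun x => by simp, .tl, _, .const 1, fun x => .tl _⟩ hf

theorem exists_const (v : TreeVal) : ∃ (P : TreeProg) (t : ℕ), ∀ x, P.RunsWithin x v t := by
  induction v with
  | nil => exact ⟨.nil, 1, fun x => .nil x⟩
  | cons u v hu hv =>
    obtain ⟨P, s, hP⟩ := hu
    obtain ⟨Q, t, hQ⟩ := hv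
    exact ⟨.cons P Q, _, fun x => (hP x).cons (hQ x)⟩

theorem const (b : β) : PT fun _ : α => b := by
  obtain ⟨P, t, hP⟩ := exists_const (enc b)
  exact ⟨.const _, P, _, .const t, fun x => hP _⟩

theorem cond {b : α → Bool} {f g : α → β} (hb : PT b) (hf : PT f) (hg : PT g) :
    PT fun x => bif b x then f x else g x := by
  obtain ⟨-, R, V, hV, hR⟩ := hb
  obtain ⟨hgs, P, T, hT, hP⟩ := hg
  obtain ⟨hfs, Q, U, hU, hQ⟩ := hf
  refine ⟨(hfs.add hgs).mono fun x => ?_, .ite R Q P, _, ((hV.add hU).add hT).add (.const 1),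
    fun x => ?_⟩
  · dsimp only
    cases b x <;> simp
  · have := hR x
    dsimp only
    cases h : b x
    · rw [h] at this
      exact (TreeProg.RunsWithin.ite_false this (hP x)).mono (by omega)
    · rw [h] at this
      exact (TreeProg.RunsWithin.ite_true this (hQ x)).mono (by omega)

theorem ite {p : α → Prop} [DecidablePred p] {f g : α → β} (hb : PT fun x => decide (p x))
    (hf : PT f) (hg : PT g) : PT fun x => if p x then f x else g x :=
  (cond hb hf hg).congr fun x => by by_cases h : p x <;> simp [h]

theorem not {b : α → Bool} (hb : PT b) : PT fun x => !b x :=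
  (cond hb (const false) (const true)).congr fun x => by cases b x <;> rfl

theorem and {b b' : α → Bool} (hb : PT b) (hb' : PT b') : PT fun x => b x && b' x :=
  (cond hb hb' (const false)).congr fun x => by cases b x <;> rfl

theorem or {b b' : α → Bool} (hb : PT b) (hb' : PT b') : PT fun x => b x || b' x :=
  (cond hb (const true) hb').congr fun x => by cases b x <;> rfl

theorem beq_bool {b b' : α → Bool} (hb : PT b) (hb' : PT b') : PT fun x => b x == b' x :=
  (cond hb hb' hb'.not).congr fun x => by cases b x <;> cases b' x <;> rfl

theorem xor {b b' : α → Bool} (hb : PT b) (hb' : PT b') : PT fun x => b x ^^ b' x :=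
  (cond hb hb'.not hb').congr fun x => by cases b x <;> cases b' x <;> rfl

/-! ### Polynomial-time functions on lists -/

theorem cons {f : α → β} {l : α → List β} (hf : PT f) (hl : PT l) : PT fun x => f x :: l x := by
  obtain ⟨hgs, P, T, hT, hP⟩ := hl
  obtain ⟨hfs, Q, U, hU, hQ⟩ := hf
  exact ⟨((hfs.add (.const 1)).add hgs).mono fun x => by simp, .cons Q P, _,
    (hU.add hT).add (.const 1), fun x => (hQ x).cons (hP x)⟩

/-- Case distinction on a list, where the function for nonempty lists has to be computable only on
the heads and tails that actually occur. -/
theorem listCases_of_eq {l : α → List β} {f : α → γ} {g : α × β × List β → γ} (hl : PT l)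
    (hf : PT f)
    (hg : PT fun y : {y : α × β × List β // l y.1 = y.2.1 :: y.2.2} => g y.1) :
    PT fun x => (l x).casesOn (motive := fun _ => γ) (f x) fun a t => g (x, a, t) := by
  obtain ⟨hls, R, V, hV, hR⟩ := hl
  obtain ⟨hgs, P, T, hT, hP⟩ := hg
  obtain ⟨hfs, Q, U, hU, hQ⟩ := hf
  obtain ⟨k, hk⟩ := hgs
  obtain ⟨k', hk'⟩ := hT
  have key : ∀ x a t, l x = a :: t → sz (x, a, t) ≤ sz x + sz (l x) := by
    intro x a t h
    rw [h]; simp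
  refine ⟨(hfs.add (((PolyLe.size.add hls).add (.const 2)).pow k)).mono fun x => ?_,
    .ite R (.seq (.cons .id R) P) Q, _,
    (((hV.add hU).add (((PolyLe.size.add hls).add (.const 2)).pow k')).add hV).add (.const 5),
    fun x => ?_⟩
  · dsimp only
    cases h : l x with
    | nil => simp
    | cons a t =>
      have := (hk ⟨(x, a, t), h⟩).trans
        (Nat.pow_le_pow_left (Nat.add_le_add_right (key x a t h) 2) k)
      rw [h] at this
      exact this.trans (Nat.le_add_left _ _)
  · have h1 := hR x
    dsimp only
    cases h : l x with
    | nil =>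
      rw [h] at h1
      exact (TreeProg.RunsWithin.ite_false h1 (hQ x)).mono (by omega)
    | cons a t =>
      have := (hk' ⟨(x, a, t), h⟩).trans
        (Nat.pow_le_pow_left (Nat.add_le_add_right (key x a t h) 2) k')
      have h2 := h1
      rw [h] at h1
      rw [h] at h2 this
      exact (TreeProg.RunsWithin.ite_true h1
        (.seq (.cons (.id _) h2) (hP ⟨(x, a, t), h⟩))).mono (by omega)

theorem listCases {l : α → List β} {f : α → γ} {g : α × β × List β → γ} (hl : PT l) (hf : PT f)
    (hg : PT g) :
    PT fun x => (l x).casesOn (motive := fun _ => γ) (f x) fun a t => g (x, a, t) :=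
  listCases_of_eq hl hf (hg.comp val)

theorem isEmpty {l : α → List β} (hl : PT l) : PT fun x => (l x).isEmpty :=
  (listCases (g := fun _ => false) hl (const true) (const false)).congr fun x => by
    cases l x <;> rfl

theorem tail {l : α → List β} (hl : PT l) : PT fun x => (l x).tail :=
  (listCases (g := fun y => y.2.2) hl (const []) id.snd.snd).congr fun x => by
    cases l x <;> rfl

theorem headD {l : α → List β} (hl : PT l) (d : β) : PT fun x => (l x).headD d :=
  (listCases (g := fun y => y.2.1) hl (const d) id.snd.fst).congr fun x => by
    cases l x <;> rfl

/-- Iteration over a list, where the step function has to be computable only on the accumulators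
that actually occur. -/
theorem foldl_of_reachable {l : γ → List α} {init : γ → β} {step : γ → β → α → β}
    (hl : PT l) (hi : PT init)
    (hs : ∃ B : γ → ℕ, PolyLe B ∧ ∀ c pre suf, l c = pre ++ suf →
      sz (pre.foldl (step c) (init c)) ≤ B c)
    (hstep : PT fun x : {x : γ × β × α // ∃ pre suf, l x.1 = pre ++ x.2.2 :: suf ∧
      x.2.1 = pre.foldl (step x.1) (init x.1)} => step x.1.1 x.1.2.1 x.1.2.2) :
    PT fun c => (l c).foldl (step c) (init c) := by
  obtain ⟨hls, R, V, hV, hR⟩ := hl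
  obtain ⟨his, Q, U, hU, hQ⟩ := hi
  obtain ⟨B, hB, hs⟩ := hs
  obtain ⟨-, P, T, ⟨k, hT⟩, hP⟩ := hstep
  have hD := (((PolyLe.size.add hB).add hls).add (.const 2)).pow k
  refine ⟨hB.mono fun c => hs c (l c) [] (by simp),
    .seq (.seq (.cons R (.cons .id Q)) (.loop .hd P.foldBody)) (.seq .tl .tl), _,
    ((hV.add hU).add (hls.mul (hD.add (.const 30)))).add (.const 20), fun c => ?_⟩
  have := TreeProg.runsWithin_fold (P := P) (c := enc c) (f := step c) (l c) (init c)
    (t := (sz c + B c + sz (l c) + 2) ^ k) fun pre a suf e => by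
      refine (hP ⟨(c, pre.foldl (step c) (init c), a), pre, suf, e, rfl⟩).mono
        ((hT _).trans (Nat.pow_le_pow_left ?_ k))
      have h1 := hs c pre _ e
      have h2 : sz a < sz (l c) := sz_le_of_mem (by simp [e])
      simp only [sz_subtype, sz_prod]
      omega
  refine (TreeProg.RunsWithin.seq (.seq ((hR c).cons (.cons (.id _) (hQ c))) this)
    (.seq (.tl _) (.tl _))).mono ?_
  have : (l c).length * ((sz c + B c + sz (l c) + 2) ^ k + 30) ≤
      sz (l c) * ((sz c + B c + sz (l c) + 2) ^ k + 30) :=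
    Nat.mul_le_mul_right _ (length_le_sz _)
  omega

theorem foldl {l : γ → List α} {init : γ → β} {step : γ → β → α → β} (hl : PT l) (hi : PT init)
    (hs : ∃ B : γ → ℕ, PolyLe B ∧ ∀ c pre suf, l c = pre ++ suf →
      sz (pre.foldl (step c) (init c)) ≤ B c)
    (hstep : PT fun x : γ × β × α => step x.1 x.2.1 x.2.2) :
    PT fun c => (l c).foldl (step c) (init c) :=
  foldl_of_reachable hl hi hs (hstep.comp val)

/-- The size of the image of a list under a polynomial-time function. -/
theorem polyLe_map {l : γ → List α} {f : γ × α → β} (hl : PT l) (hf : PT f) :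
    PolyLe fun c => sz ((l c).map fun a => f (c, a)) := by
  obtain ⟨k, hk⟩ := hf.1
  refine (hl.1.mul ((((PolyLe.size.add hl.1).add (.const 2)).pow k).add (.const 1))).mono
    fun c => ?_
  refine (sz_list_le (b := (sz c + sz (l c) + 2) ^ k) ?_).trans ?_
  · intro b hb
    obtain ⟨a, ha, rfl⟩ := List.mem_map.1 hb
    have := sz_le_of_mem ha
    exact (hk (c, a)).trans (Nat.pow_le_pow_left (by simp; omega) k)
  · rw [List.length_map]
    exact Nat.mul_le_mul_right _ (length_le_sz _)

theorem revMapAppend {l : γ → List α} {f : γ × α → β} {i : γ → List β} (hl : PT l) (hf : PT f)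
    (hi : PT i) : PT fun c => ((l c).map fun a => f (c, a)).reverse ++ i c := by
  refine congr (f := fun c => (l c).foldl (fun acc a => f (c, a) :: acc) (i c)) ?_ fun c =>
    (List.foldl_cons_eq _ _ _).symm
  refine foldl (step := fun c acc a => f (c, a) :: acc) hl hi
    ⟨_, (polyLe_map hl hf).add hi.1, fun c pre suf e => ?_⟩
    (cons (hf.comp (id.fst.pair id.snd.snd)) id.snd.fst)
  rw [List.foldl_cons_eq, e]
  simp

theorem reverse {l : γ → List α} (hl : PT l) : PT fun c => (l c).reverse :=
  (revMapAppend (f := Prod.snd) hl id.snd (const [])).congr fun c => by simp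

theorem append {l l' : γ → List α} (hl : PT l) (hl' : PT l') : PT fun c => l c ++ l' c :=
  (revMapAppend (f := Prod.snd) hl.reverse id.snd hl').congr fun c => by simp

theorem map {l : γ → List α} {f : γ × α → β} (hl : PT l) (hf : PT f) :
    PT fun c => (l c).map fun a => f (c, a) :=
  (revMapAppend hl hf (const [])).reverse.congr fun c => by simp

theorem flatten {l : γ → List (List α)} (hl : PT l) : PT fun c => (l c).flatten := by
  have e : ∀ (l : List (List α)) i, l.foldl (fun acc a => acc ++ a) i = i ++ l.flatten := by
    intro l
    induction l with
    | nil => simp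
    | cons a l ih => intro i; simp [ih]
  have e' : ∀ l : List (List α), sz l.flatten ≤ sz l := by
    intro l
    induction l with
    | nil => simp
    | cons a l ih => simp; omega
  refine congr (f := fun c => (l c).foldl (fun acc a => acc ++ a) []) ?_ fun c => by simp [e]
  refine foldl (step := fun c acc a => acc ++ a) hl (const []) ⟨_, hl.1, fun c pre suf h => ?_⟩
    (append id.snd.fst id.snd.snd)
  rw [e, h]
  have := e' pre
  simp; omega

theorem flatMap {l : γ → List α} {f : γ × α → List β} (hl : PT l) (hf : PT f) :
    PT fun c => (l c).flatMap fun a => f (c, a) :=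
  (flatten (map hl hf)).congr fun c => by rw [List.flatMap_def]

theorem filter {l : γ → List α} {f : γ × α → Bool} (hl : PT l) (hf : PT f) :
    PT fun c => (l c).filter fun a => f (c, a) := by
  refine (flatMap (f := fun x => bif f x then [x.2] else []) hl
    (cond hf (cons id.snd (const [])) (const []))).congr fun c => ?_
  induction l c with
  | nil => rfl
  | cons a l ih => cases h : f (c, a) <;> simp [h, ih]

theorem any {l : γ → List α} {f : γ × α → Bool} (hl : PT l) (hf : PT f) :
    PT fun c => (l c).any fun a => f (c, a) := by
  refine (filter hl hf).isEmpty.not.congr fun c => ?_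
  rw [Bool.eq_iff_iff]
  simp

theorem all {l : γ → List α} {f : γ × α → Bool} (hl : PT l) (hf : PT f) :
    PT fun c => (l c).all fun a => f (c, a) := by
  refine (any hl hf.not).not.congr fun c => ?_
  rw [Bool.eq_iff_iff]
  simp

theorem getD {l : γ → List α} (hl : PT l) (i : ℕ) (d : α) : PT fun c => (l c).getD i d := by
  induction i generalizing l with
  | zero => exact (headD hl d).congr fun c => by cases l c <;> rfl
  | succ i ih => exact (ih (tail hl)).congr fun c => by cases l c <;> simp

theorem zip {l : γ → List α} {l' : γ → List β} (hl : PT l) (hl' : PT l') :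
    PT fun c => (l c).zip (l' c) := by
  let step : List β × List (α × β) → α → List β × List (α × β) := fun s a =>
    s.1.casesOn s fun b t => (t, (a, b) :: s.2)
  have e : ∀ (l : List α) (l' : List β) out,
      (l.foldl step (l', out)).2 = (l.zip l').reverse ++ out ∧
      sz (l.foldl step (l', out)) ≤ sz l + sz l' + sz out := by
    intro l
    induction l with
    | nil => simp
    | cons a l ih =>
      intro l' out
      cases l' with
      | nil =>
        have := ih [] out
        simp only [List.foldl_cons, step]
        refine ⟨by simpa using this.1, this.2.trans (by simp)⟩
      | cons b t =>
        have := ih t ((a, b) :: out)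
        simp only [List.foldl_cons, step]
        refine ⟨by simpa using this.1, this.2.trans (by simp; omega)⟩
  refine (reverse (snd (foldl (l := l) (init := fun c => (l' c, []))
    (step := fun _ s a => step s a) hl (hl'.pair (const []))
    ⟨_, (hl.1.add hl'.1), fun c pre suf h => ?_⟩ ?_))).congr fun c => ?_
  · refine (e _ _ _).2.trans ?_
    rw [h]; simp
  · exact listCases (f := fun x : γ × (List β × List (α × β)) × α => x.2.1)
      (g := fun y : (γ × (List β × List (α × β)) × α) × β × List β =>
        (y.2.2, (y.1.2.2, y.2.1) :: y.1.2.1.2)) id.snd.fst.fst id.snd.fst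
      (id.snd.snd.pair (cons (id.fst.snd.snd.pair id.snd.fst) id.fst.snd.fst.snd))
  · rw [(e _ _ _).1]; simp

theorem zipWith {l : γ → List α} {l' : γ → List β} {f : γ × α × β → δ} (hl : PT l) (hl' : PT l')
    (hf : PT f) : PT fun c => List.zipWith (fun a b => f (c, a, b)) (l c) (l' c) :=
  (map (zip hl hl') hf).congr fun c => by simp [List.zip, List.map_zipWith]

/-! ### Equality tests -/

/-- Equality of elements is decidable in polynomial time. -/
class EqTest (α : Type) [Enc α] [DecidableEq α] : Prop where
  pt : PT fun x : α × α => decide (x.1 = x.2)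

theorem eq [DecidableEq α] [EqTest α] {f g : γ → α} (hf : PT f) (hg : PT g) :
    PT fun c => decide (f c = g c) :=
  EqTest.pt.comp (hf.pair hg)

instance : EqTest Bool := ⟨(beq_bool id.fst id.snd).congr fun x => by
  rcases x with ⟨_ | _, _ | _⟩ <;> rfl⟩

instance [DecidableEq α] [DecidableEq β] [EqTest α] [EqTest β] : EqTest (α × β) :=
  ⟨(and (eq id.fst.fst id.snd.fst) (eq id.fst.snd id.snd.snd)).congr fun x => by
    rw [Bool.eq_iff_iff]; simp [Prod.ext_iff]⟩

instance [DecidableEq α] [EqTest α] : EqTest (List α) := by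
  let step : Bool × List α → α → Bool × List α := fun s a =>
    s.2.casesOn (false, []) fun b t => (s.1 && decide (a = b), t)
  have e : ∀ (l l' : List α) o,
      ((l.foldl step (o, l')).1 && (l.foldl step (o, l')).2.isEmpty) = (o && decide (l = l')) ∧
      sz (l.foldl step (o, l')) ≤ 1 + sz l' := by
    intro l
    induction l with
    | nil => intro l' o; cases l' <;> simp
    | cons a l ih =>
      intro l' o
      cases l' with
      | nil =>
        have := ih [] false
        simp only [List.foldl_cons, step]
        refine ⟨by simpa using this.1, this.2.trans (by simp)⟩
      | cons b t =>
        have := ih t (o && decide (a = b))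
        simp only [List.foldl_cons, step]
        refine ⟨?_, this.2.trans (by simp)⟩
        rw [this.1, Bool.eq_iff_iff]
        simp [and_assoc]
  constructor
  have h : PT fun x : List α × List α => x.1.foldl step (true, x.2) := by
    refine foldl (step := fun _ => step) id.fst ((const true).pair id.snd)
      ⟨_, PolyLe.size.add (.const 1), fun c pre suf h => (e _ _ _).2.trans (by simp; omega)⟩ ?_
    exact listCases
      (f := fun _ => (false, []))
      (g := fun y : ((List α × List α) × (Bool × List α) × α) × α × List α =>
        (y.1.2.1.1 && decide (y.1.2.2 = y.2.1), y.2.2)) id.snd.fst.snd (const _)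
      ((and id.fst.snd.fst.fst (eq id.fst.snd.snd id.snd.fst)).pair id.snd.snd)
  exact (and h.fst h.snd.isEmpty).congr fun x => by rw [(e _ _ _).1]; simp

theorem mem [DecidableEq α] [EqTest α] {f : γ → α} {l : γ → List α} (hf : PT f) (hl : PT l) :
    PT fun c => decide (f c ∈ l c) :=
  (any (f := fun x : γ × α => decide (f x.1 = x.2)) hl
    (eq (hf.comp id.fst) id.snd)).congr fun c => by rw [Bool.eq_iff_iff]; simp

/-- A function that is applied to finitely many arguments only is computed by table look-up. -/
theorem lookup [Nonempty β] [DecidableEq α] [EqTest α] {f : γ → α} (F : α → β) (hf : PT f)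
    (S : Finset α) (hS : ∀ c, f c ∈ S) : PT fun c => F (f c) := by
  have : ∀ S : Finset α, ∃ F' : α → β, PT F' ∧ ∀ a ∈ S, F' a = F a := by
    intro S
    induction S using Finset.induction_on with
    | empty => exact ⟨fun _ => Classical.arbitrary β, const _, by simp⟩
    | insert a S _ ih =>
      obtain ⟨F', h, h'⟩ := ih
      refine ⟨fun x => if x = a then F a else F' x, ite (eq id (const a)) (const _) h, ?_⟩
      intro b hb
      by_cases hba : b = a
      · simp [hba]
      · simp only [hba, if_false]
        exact h' b ((Finset.mem_insert.1 hb).resolve_left hba)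
  obtain ⟨F', h, h'⟩ := this S
  exact (h.comp hf).congr fun c => (h' _ (hS c)).symm

end PT

/-! ### Binary arithmetic -/

namespace PT

variable {α β γ : Type} [Enc α] [Enc β] [Enc γ]

theorem sz_bits (n : ℕ) : sz n.bits = 2 * n.size := by
  rw [← Nat.size_eq_bits_len, sz_list]
  simp [mul_comm]

theorem bits {f : γ → ℕ} (hf : PT f) : PT fun c => (f c).bits :=
  comp (g := Nat.bits) (of_enc_eq (fun _ => rfl) (((PolyLe.const 2).mul .size).mono fun n => by
    rw [sz_bits]; simp)) hf

theorem of_bits {f : γ → ℕ} (hf : PT fun c => (f c).bits) : PT f := by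
  obtain ⟨hs, h⟩ := hf
  refine ⟨hs.mono fun c => ?_, h⟩
  rw [sz_bits]; simp; omega

theorem bodd {f : γ → ℕ} (hf : PT f) : PT fun c => (f c).bodd :=
  (headD (bits hf) false).congr fun c => by
    induction f c using Nat.binaryRec' with
    | zero => rfl
    | bit b n h _ => rw [Nat.bits_append_bit _ _ h]; simp

theorem div2 {f : γ → ℕ} (hf : PT f) : PT fun c => (f c).div2 :=
  of_bits <| (tail (bits hf)).congr fun c => by
    induction f c using Nat.binaryRec' with
    | zero => rfl
    | bit b n h _ => rw [Nat.bits_append_bit _ _ h]; simp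

theorem bit {f : γ → ℕ} {b : γ → Bool} (hb : PT b) (hf : PT f) :
    PT fun c => Nat.bit (b c) (f c) :=
  of_bits <| (cond (or hb (isEmpty (bits hf)).not) (cons hb (bits hf)) (const [])).congr
    fun c => by
      cases hc : b c
      · by_cases h0 : f c = 0
        · simp [h0]
        · rw [Nat.bits_append_bit _ _ fun h => absurd h h0]
          have : (f c).bits.isEmpty = false := by
            rw [List.isEmpty_eq_false_iff, ne_eq, ← List.length_eq_zero_iff, Nat.size_eq_bits_len]
            exact fun h => h0 (Nat.size_eq_zero.1 h)
          simp [this]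
      · rw [Nat.bits_append_bit _ _ fun _ => rfl]; simp

theorem size_bit_le (b : Bool) (n : ℕ) : (Nat.bit b n).size ≤ n.size + 1 := by
  by_cases h : Nat.bit b n = 0
  · simp [h]
  · rw [Nat.size_bit h]

/-- Appending the binary digits `l`, most significant first, to those of `f`. -/
theorem ofBits {l : γ → List Bool} {f : γ → ℕ} (hl : PT l) (hf : PT f) :
    PT fun c => (l c).foldl (fun acc b => Nat.bit b acc) (f c) := by
  have e : ∀ (l : List Bool) n, (l.foldl (fun acc b => Nat.bit b acc) n).size ≤
      l.length + n.size := by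
    intro l
    induction l with
    | nil => simp
    | cons b l ih =>
      intro n
      have := ih (Nat.bit b n)
      have := size_bit_le b n
      simp only [List.foldl_cons, List.length_cons]
      omega
  refine foldl (step := fun _ acc b => Nat.bit b acc) hl hf
    ⟨_, hl.1.add hf.1, fun c pre suf h => ?_⟩ (bit id.snd.snd id.snd.fst)
  have h1 := e pre (f c)
  have h2 := length_le_sz (l c)
  have h3 : pre.length ≤ (l c).length := by simp [h]
  simp only [sz_nat]
  omega

/-- One step of binary addition: two summands, the carry and the digits found so far. -/
def addStep (s : ℕ × ℕ × Bool × List Bool) : ℕ × ℕ × Bool × List Bool :=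
  (s.1.div2, s.2.1.div2,
    (s.1.bodd && s.2.1.bodd) || ((s.1.bodd ^^ s.2.1.bodd) && s.2.2.1),
    ((s.1.bodd ^^ s.2.1.bodd) ^^ s.2.2.1) :: s.2.2.2)

theorem addStep_digit (s : ℕ × ℕ × Bool × List Bool) :
    Nat.bit ((s.1.bodd ^^ s.2.1.bodd) ^^ s.2.2.1)
      ((addStep s).1 + (addStep s).2.1 + (addStep s).2.2.1.toNat) =
      s.1 + s.2.1 + s.2.2.1.toNat := by
  obtain ⟨x, y, c, o⟩ := s
  have hx := Nat.bit_bodd_div2 x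
  have hy := Nat.bit_bodd_div2 y
  rw [Nat.bit_val] at hx hy
  simp only [addStep, Nat.bit_val]
  generalize x.bodd = bx at *
  generalize y.bodd = bz at *
  cases bx <;> cases bz <;> cases c <;> simp at * <;> omega

/-- Invariant of the addition loop: once the rest of the sum is prefixed to the digits found so far,
the value is that of the sum. -/
theorem addStep_foldl (l : List Bool) (s : ℕ × ℕ × Bool × List Bool) :
    ((l.foldl (fun s _ => addStep s) s).2.2.2.foldl (fun acc b => Nat.bit b acc)
      ((s.1 + s.2.1 + s.2.2.1.toNat) / 2 ^ l.length)) =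
      s.2.2.2.foldl (fun acc b => Nat.bit b acc) (s.1 + s.2.1 + s.2.2.1.toNat) ∧
    sz (l.foldl (fun s _ => addStep s) s) ≤ sz s + 2 * l.length := by
  induction l generalizing s with
  | nil => simp
  | cons b l ih =>
    have h := addStep_digit s
    have h2 : (addStep s).1 + (addStep s).2.1 + (addStep s).2.2.1.toNat =
        (s.1 + s.2.1 + s.2.2.1.toNat) / 2 := by
      rw [← h, Nat.bit_div_two]
    have ih' := ih (addStep s)
    rw [h2, Nat.div_div_eq_div_mul] at ih'
    simp only [List.foldl_cons, List.length_cons]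
    refine ⟨?_, ih'.2.trans ?_⟩
    · rw [pow_succ', ih'.1]
      conv_lhs => rw [addStep]
      rw [List.foldl_cons, ← h2, h]
    · obtain ⟨x, y, c, o⟩ := s
      have hx : x.div2.size ≤ x.size := Nat.size_le_size (by rw [Nat.div2_val]; omega)
      have hy : y.div2.size ≤ y.size := Nat.size_le_size (by rw [Nat.div2_val]; omega)
      simp [addStep]
      omega

theorem add {f g : γ → ℕ} (hf : PT f) (hg : PT g) : PT fun c => f c + g c := by
  have h : PT fun c => ((f c).bits ++ (g c).bits ++ [true]).foldl (fun s _ => addStep s)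
      (f c, g c, false, []) := by
    refine foldl (step := fun _ s _ => addStep s) (append (append (bits hf) (bits hg)) (const _))
      (hf.pair (hg.pair (const _))) ⟨fun c => 3 * sz (f c) + 3 * sz (g c) + 3,
        (((PolyLe.const 3).mul hf.1).add ((PolyLe.const 3).mul hg.1)).add (.const 3),
        fun c pre suf e => (addStep_foldl _ _).2.trans ?_⟩ ?_
    · have := congrArg List.length e
      simp [Nat.size_eq_bits_len] at this ⊢
      omega
    · exact (div2 id.snd.fst.fst).pair <| (div2 id.snd.fst.snd.fst).pair <|
        (or (and (bodd id.snd.fst.fst) (bodd id.snd.fst.snd.fst))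
          (and (xor (bodd id.snd.fst.fst) (bodd id.snd.fst.snd.fst)) id.snd.fst.snd.snd.fst)).pair
        (cons (xor (xor (bodd id.snd.fst.fst) (bodd id.snd.fst.snd.fst)) id.snd.fst.snd.snd.fst)
          id.snd.fst.snd.snd.snd)
  refine (ofBits h.snd.snd.snd (const 0)).congr fun c => ?_
  have := (addStep_foldl ((f c).bits ++ (g c).bits ++ [true]) (f c, g c, false, [])).1
  rw [Nat.div_eq_of_lt] at this
  · rw [this]; simp
  · have h1 := Nat.lt_size_self (f c)
    have h2 := Nat.lt_size_self (g c)
    have h3 : 2 ^ (f c).size ≤ 2 ^ ((f c).size + (g c).size) :=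
      Nat.pow_le_pow_right (by omega) (by omega)
    have h4 : 2 ^ (g c).size ≤ 2 ^ ((f c).size + (g c).size) :=
      Nat.pow_le_pow_right (by omega) (by omega)
    simp only [List.length_append, Nat.size_eq_bits_len, List.length_singleton, pow_succ]
    simp
    omega

theorem foldr_bits (n : ℕ) : n.bits.foldr (fun b acc => 2 * acc + b.toNat) 0 = n := by
  induction n using Nat.binaryRec' with
  | zero => rfl
  | bit b n h ih => rw [Nat.bits_append_bit _ _ h, List.foldr_cons, ih, Nat.bit_val]

theorem size_mul_le (a b : ℕ) : (a * b).size ≤ a.size + b.size := by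
  rw [Nat.size_le, pow_add]
  exact Nat.mul_lt_mul'' (Nat.lt_size_self a) (Nat.lt_size_self b)

/-- Multiplication by Horner's scheme. -/
theorem mul {f g : γ → ℕ} (hf : PT f) (hg : PT g) : PT fun c => f c * g c := by
  have e : ∀ (a : ℕ) (l : List Bool), l.foldr (fun b acc => 2 * acc + (bif b then a else 0)) 0 =
      a * l.foldr (fun b acc => 2 * acc + b.toNat) 0 := by
    intro a l
    induction l with
    | nil => rfl
    | cons b l ih => cases b <;> simp [ih] <;> ring
  have e' : ∀ l : List Bool, l.foldr (fun b acc => 2 * acc + b.toNat) 0 < 2 ^ l.length := by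
    intro l
    induction l with
    | nil => simp
    | cons b l ih => cases b <;> simp [pow_succ] <;> omega
  refine congr (f := fun c => (g c).bits.reverse.foldl
    (fun acc b => Nat.bit false acc + (bif b then f c else 0)) 0) ?_ fun c => ?_
  · refine foldl (step := fun c acc b => Nat.bit false acc + (bif b then f c else 0))
      (reverse (bits hg)) (const 0) ⟨_, hf.1.add hg.1, fun c pre suf h => ?_⟩
      (add (bit (const false) id.snd.fst) (cond id.snd.snd (hf.comp id.fst) (const 0)))
    have h1 : pre.length ≤ (g c).size := by
      have := congrArg List.length h
      simp [Nat.size_eq_bits_len] at this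
      omega
    have h2 := e (f c) pre.reverse
    have h3 := e' pre.reverse
    rw [← Nat.size_le] at h3
    simp only [List.foldr_reverse, List.length_reverse] at h2 h3
    simp only [Nat.bit_val, sz_nat]
    simp only [Bool.toNat_false, add_zero, h2]
    exact (size_mul_le _ _).trans (by omega)
  · have := e (f c) (g c).bits
    rw [foldr_bits] at this
    simp only [List.foldl_reverse, Nat.bit_val]
    simpa using this.symm

/-- Comparison, digit by digit from the least significant one. The third component of the state tells
the result of the comparison of the digits read so far. -/
theorem le {f g : γ → ℕ} (hf : PT f) (hg : PT g) : PT fun c => decide (f c ≤ g c) := by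
  let step : ℕ × ℕ × Bool → Bool → ℕ × ℕ × Bool := fun s _ =>
    (s.1.div2, s.2.1.div2, bif s.1.bodd == s.2.1.bodd then s.2.2 else s.2.1.bodd)
  let R : ℕ × ℕ × Bool → Prop := fun s => s.1 < s.2.1 ∨ s.1 = s.2.1 ∧ s.2.2
  have e : ∀ s b, R (step s b) ↔ R s := by
    rintro ⟨x, y, r⟩ b
    have hx := Nat.bit_bodd_div2 x
    have hy := Nat.bit_bodd_div2 y
    rw [Nat.bit_val] at hx hy
    simp only [R, step]
    generalize x.bodd = bx at *
    generalize y.bodd = bz at *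
    cases bx <;> cases bz <;> cases r <;> simp at * <;> omega
  have e' : ∀ (l : List Bool) s, (R (l.foldl step s) ↔ R s) ∧
      (l.foldl step s).1 = s.1 / 2 ^ l.length ∧ (l.foldl step s).2.1 = s.2.1 / 2 ^ l.length := by
    intro l
    induction l with
    | nil => simp
    | cons b l ih =>
      intro s
      obtain ⟨h1, h2, h3⟩ := ih (step s b)
      simp only [List.foldl_cons, List.length_cons, pow_succ']
      refine ⟨h1.trans (e s b), ?_, ?_⟩
      · rw [h2, ← Nat.div_div_eq_div_mul, ← Nat.div2_val]
      · rw [h3, ← Nat.div_div_eq_div_mul, ← Nat.div2_val]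
  have h : PT fun c => ((f c).bits ++ (g c).bits).foldl step (f c, g c, true) := by
    refine foldl (step := fun _ => step) (append (bits hf) (bits hg)) (hf.pair (hg.pair (const _)))
      ⟨fun c => sz (f c) + sz (g c) + 1, (hf.1.add hg.1).add (.const 1), fun c pre suf e => ?_⟩ ?_
    · obtain ⟨-, h2, h3⟩ := e' pre (f c, g c, true)
      simp only [sz_prod, h2, h3, sz_nat, sz_bool]
      have := Nat.size_le_size (Nat.div_le_self (f c) (2 ^ pre.length))
      have := Nat.size_le_size (Nat.div_le_self (g c) (2 ^ pre.length))
      omega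
    · exact (div2 id.snd.fst.fst).pair <| (div2 id.snd.fst.snd.fst).pair <|
        cond (beq_bool (bodd id.snd.fst.fst) (bodd id.snd.fst.snd.fst)) id.snd.fst.snd.snd
          (bodd id.snd.fst.snd.fst)
  refine h.snd.snd.congr fun c => ?_
  obtain ⟨h1, h2, h3⟩ := e' ((f c).bits ++ (g c).bits) (f c, g c, true)
  have l1 := Nat.lt_size_self (f c)
  have l2 := Nat.lt_size_self (g c)
  have l3 : 2 ^ (f c).size ≤ 2 ^ ((f c).size + (g c).size) :=
    Nat.pow_le_pow_right (by omega) (by omega)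
  have l4 : 2 ^ (g c).size ≤ 2 ^ ((f c).size + (g c).size) :=
    Nat.pow_le_pow_right (by omega) (by omega)
  simp only [List.length_append, Nat.size_eq_bits_len] at h2 h3
  rw [Nat.div_eq_of_lt (by omega)] at h2 h3
  simp only [R, h2, h3] at h1
  rw [Bool.eq_iff_iff, decide_eq_true_iff]
  simp only [lt_irrefl, true_and, false_or, and_true] at h1
  rw [h1]
  omega

instance : EqTest ℕ := ⟨(and (le id.fst id.snd) (le id.snd id.fst)).congr fun x => by
  rw [Bool.eq_iff_iff]; simp; omega⟩

theorem size_sum_le (l : List ℕ) : l.sum.size ≤ sz l := by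
  induction l with
  | nil => simp
  | cons a l ih =>
    rw [Nat.size_le] at ih ⊢
    have h1 := Nat.lt_size_self a
    have h3 : 2 ^ a.size ≤ 2 ^ (a.size + sz l) := Nat.pow_le_pow_right (by omega) (by omega)
    have h4 : 2 ^ sz l ≤ 2 ^ (a.size + sz l) := Nat.pow_le_pow_right (by omega) (by omega)
    rw [List.sum_cons, sz_cons, sz_nat, show a.size + 1 + sz l = a.size + sz l + 1 by omega,
      pow_succ]
    omega

theorem sum {l : γ → List ℕ} (hl : PT l) : PT fun c => (l c).sum := by
  refine congr (f := fun c => (l c).foldl (fun a b => a + b) 0) ?_ fun c => by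
    rw [List.sum_eq_foldl]
  refine foldl (step := fun _ a b => a + b) hl (const 0)
    ⟨_, hl.1, fun c pre suf h => ?_⟩ (add id.snd.fst id.snd.snd)
  rw [← List.sum_eq_foldl, h]
  have := size_sum_le pre
  simp at this ⊢
  omega

/-! ### Integers as differences of natural numbers -/

/-- `f` is the difference of two polynomial-time functions with values in `ℕ`. Such functions are closed
under ring operations, and can be compared, without a subtraction algorithm. -/
def IntDiff (f : γ → ℤ) : Prop := ∃ p n : γ → ℕ, PT p ∧ PT n ∧ ∀ c, f c = (p c : ℤ) - n c

namespace IntDiff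

variable {f g : γ → ℤ}

theorem natCast {f : γ → ℕ} (hf : PT f) : IntDiff fun c => (f c : ℤ) :=
  ⟨f, fun _ => 0, hf, PT.const 0, by simp⟩

theorem int (hf : PT f) : IntDiff f := by
  have h1 : PT fun c => decide (f c < 0) := comp (g := fun z : ℤ => decide (z < 0))
    ⟨PolyLe.const 1, .hd, _, .const 1, fun z => .hd _⟩ hf
  have h2 : PT fun c => (f c).natAbs := comp (g := Int.natAbs)
    ⟨PolyLe.size.mono fun z => by simp, .tl, _, .const 1, fun z => .tl _⟩ hf
  refine ⟨_, _, ite (p := fun c => f c < 0) h1 (PT.const 0) h2,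
    ite (p := fun c => f c < 0) h1 h2 (PT.const 0), fun c => ?_⟩
  split_ifs <;> simp only [Int.natCast_natAbs, Nat.cast_zero] <;> grind

theorem const (z : ℤ) : IntDiff fun _ : γ => z := int (PT.const z)

theorem add (hf : IntDiff f) (hg : IntDiff g) : IntDiff fun c => f c + g c := by
  obtain ⟨p, n, hp, hn, h⟩ := hf
  obtain ⟨p', n', hp', hn', h'⟩ := hg
  exact ⟨_, _, hp.add hp', hn.add hn', fun c => by simp only [h, h']; push_cast; ring⟩

theorem sub (hf : IntDiff f) (hg : IntDiff g) : IntDiff fun c => f c - g c := by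
  obtain ⟨p, n, hp, hn, h⟩ := hf
  obtain ⟨p', n', hp', hn', h'⟩ := hg
  exact ⟨_, _, hp.add hn', hn.add hp', fun c => by simp only [h, h']; push_cast; ring⟩

theorem mul (hf : IntDiff f) (hg : IntDiff g) : IntDiff fun c => f c * g c := by
  obtain ⟨p, n, hp, hn, h⟩ := hf
  obtain ⟨p', n', hp', hn', h'⟩ := hg
  exact ⟨_, _, (hp.mul hp').add (hn.mul hn'), (hp.mul hn').add (hn.mul hp'), fun c => by
    simp only [h, h']; push_cast; ring⟩

theorem le (hf : IntDiff f) (hg : IntDiff g) : PT fun c => decide (f c ≤ g c) := by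
  obtain ⟨p, n, hp, hn, h⟩ := hf
  obtain ⟨p', n', hp', hn', h'⟩ := hg
  exact (PT.le (hp.add hn') (hp'.add hn)).congr fun c => by
    rw [Bool.eq_iff_iff, h, h']; simp; omega

end IntDiff

end PT

/-! ### Tables with multiplicities -/

/-- Adds the entry `e` to a list of keys with multiplicities; the multiplicities of equal keys are
added up. -/
def insertCount {κ : Type} [DecidableEq κ] (T : List (κ × ℕ)) (e : κ × ℕ) : List (κ × ℕ) :=
  if e.1 ∈ T.map Prod.fst then T.map fun x => if x.1 = e.1 then (x.1, x.2 + e.2) else x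
  else e :: T

/-- Merges the entries with equal keys. -/
def collect {κ : Type} [DecidableEq κ] (l : List (κ × ℕ)) : List (κ × ℕ) := l.foldl insertCount []

section Collect

variable {κ : Type} [DecidableEq κ]

theorem map_fst_insertCount (T : List (κ × ℕ)) (e : κ × ℕ) :
    (insertCount T e).map Prod.fst =
      if e.1 ∈ T.map Prod.fst then T.map Prod.fst else e.1 :: T.map Prod.fst := by
  unfold insertCount
  split_ifs with h
  · rw [List.map_map]
    refine List.map_congr_left fun x _ => ?_
    simp only [Function.comp]
    split_ifs <;> rfl
  · rfl

theorem sum_insertCount {A : Type*} [AddCommMonoid A] (h : κ → ℕ → A)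
    (hadd : ∀ k a b, h k (a + b) = h k a + h k b) (T : List (κ × ℕ)) (e : κ × ℕ)
    (hT : (T.map Prod.fst).Nodup) :
    ((insertCount T e).map fun x => h x.1 x.2).sum = (T.map fun x => h x.1 x.2).sum + h e.1 e.2 := by
  unfold insertCount
  split_ifs with he
  · induction T with
    | nil => simp at he
    | cons x T ih =>
      rw [List.map_cons, List.nodup_cons] at hT
      by_cases hx : x.1 = e.1
      · have : T.map (fun x => if x.1 = e.1 then (x.1, x.2 + e.2) else x) = T := by
          conv_rhs => rw [← List.map_id T]
          refine List.map_congr_left fun y hy => ?_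
          rw [if_neg, id]
          intro hye
          exact hT.1 (hx ▸ hye ▸ List.mem_map_of_mem hy)
        rw [List.map_cons, this]
        simp only [hx, if_true, List.map_cons, List.sum_cons, hadd]
        abel
      · have he' : e.1 ∈ T.map Prod.fst := by
          simpa [Ne.symm hx] using he
        have := ih hT.2 he'
        rw [List.map_cons, if_neg hx, List.map_cons, List.sum_cons, this, List.map_cons,
          List.sum_cons, add_assoc]
  · simp [add_comm]

theorem nodup_foldl_insertCount (l T : List (κ × ℕ)) (hT : (T.map Prod.fst).Nodup) :
    ((l.foldl insertCount T).map Prod.fst).Nodup := by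
  induction l generalizing T with
  | nil => exact hT
  | cons e l ih =>
    refine ih _ ?_
    rw [map_fst_insertCount]
    split_ifs with h
    · exact hT
    · exact List.nodup_cons.2 ⟨h, hT⟩

theorem nodup_collect (l : List (κ × ℕ)) : ((collect l).map Prod.fst).Nodup :=
  nodup_foldl_insertCount l [] (by simp)

theorem sum_collect {A : Type*} [AddCommMonoid A] (h : κ → ℕ → A)
    (hadd : ∀ k a b, h k (a + b) = h k a + h k b) (l : List (κ × ℕ)) :
    ((collect l).map fun x => h x.1 x.2).sum = (l.map fun x => h x.1 x.2).sum := by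
  have : ∀ (l T : List (κ × ℕ)), (T.map Prod.fst).Nodup →
      ((l.foldl insertCount T).map fun x => h x.1 x.2).sum =
        (T.map fun x => h x.1 x.2).sum + (l.map fun x => h x.1 x.2).sum := by
    intro l
    induction l with
    | nil => simp
    | cons e l ih =>
      intro T hT
      rw [List.foldl_cons, ih (insertCount T e) (nodup_foldl_insertCount [e] T hT),
        sum_insertCount h hadd T e hT, List.map_cons, List.sum_cons, add_assoc]
  simpa [collect] using this l [] (by simp)

theorem length_collect_le (l : List (κ × ℕ)) : (collect l).length ≤ l.length := by
  have : ∀ l T : List (κ × ℕ), (l.foldl insertCount T).length ≤ T.length + l.length := by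
    intro l
    induction l with
    | nil => simp
    | cons e l ih =>
      intro T
      refine (ih _).trans ?_
      have : (insertCount T e).length ≤ T.length + 1 := by
        unfold insertCount
        split_ifs <;> simp
      simp only [List.length_cons]
      omega
  simpa [collect] using this l []

theorem mem_collect {l : List (κ × ℕ)} {x : κ × ℕ} (hx : x ∈ collect l) :
    x.1 ∈ l.map Prod.fst ∧ x.2 ≤ (l.map Prod.snd).sum := by
  have : ∀ l T : List (κ × ℕ), ∀ x ∈ l.foldl insertCount T, ∃ t : ℕ,
      ((x.1, t) ∈ T ∨ t = 0 ∧ x.1 ∈ l.map Prod.fst) ∧ x.2 ≤ t + (l.map Prod.snd).sum := by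
    intro l
    induction l with
    | nil => intro T x hx; exact ⟨x.2, Or.inl hx, by simp⟩
    | cons e l ih =>
      intro T x hx
      obtain ⟨t, ht, hle⟩ := ih _ x hx
      simp only [List.map_cons, List.sum_cons]
      rcases ht with ht | ⟨rfl, ht⟩
      · unfold insertCount at ht
        split_ifs at ht with h
        · obtain ⟨y, hy, hyx⟩ := List.mem_map.1 ht
          split_ifs at hyx with hye
          · rw [Prod.mk.injEq] at hyx
            exact ⟨y.2, Or.inl (hyx.1 ▸ hy), by omega⟩
          · subst hyx
            exact ⟨t, Or.inl hy, by dsimp only at *; omega⟩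
        · rcases List.mem_cons.1 ht with rfl | ht
          · exact ⟨0, Or.inr ⟨rfl, by simp⟩, by dsimp only at *; omega⟩
          · exact ⟨t, Or.inl ht, by omega⟩
      · exact ⟨0, Or.inr ⟨rfl, List.mem_cons_of_mem _ ht⟩, by omega⟩
  obtain ⟨t, ht, hle⟩ := this l [] x hx
  rcases ht with ht | ⟨rfl, ht⟩
  · simp at ht
  · exact ⟨ht, by omega⟩

end Collect

namespace PT

variable {γ κ α : Type} [Enc γ] [Enc κ] [Enc α] [DecidableEq κ] [EqTest κ]

theorem insertCount {T : γ → List (κ × ℕ)} {e : γ → κ × ℕ} (hT : PT T) (he : PT e) :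
    PT fun c => insertCount (T c) (e c) :=
  ite (mem he.fst (map hT id.snd.fst))
    (map hT (f := fun x : γ × (κ × ℕ) =>
        if x.2.1 = (e x.1).1 then (x.2.1, x.2.2 + (e x.1).2) else x.2)
      (ite (eq id.snd.fst (he.comp id.fst).fst)
        (id.snd.fst.pair (add id.snd.snd (he.comp id.fst).snd)) id.snd))
    (cons he hT)

theorem collect {l : γ → List (κ × ℕ)} (hl : PT l) : PT fun c => collect (l c) := by
  refine foldl (step := fun _ T e => _root_.insertCount T e) hl (const [])
    ⟨fun c => sz (l c) * (sz (l c) + sz (l c) + 1), hl.1.mul ((hl.1.add hl.1).add (.const 1)),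
      fun c pre suf e => ?_⟩ (insertCount id.snd.fst id.snd.snd)
  have h1 : sz pre ≤ sz (l c) := by rw [e]; simp
  have h2 : (_root_.collect pre).length ≤ sz (l c) :=
    (length_collect_le _).trans ((length_le_sz _).trans h1)
  refine (sz_list_le (b := sz (l c) + sz (l c)) fun x hx => ?_).trans
    (Nat.mul_le_mul_right _ h2)
  obtain ⟨h3, h4⟩ := mem_collect hx
  obtain ⟨y, hy, hyx⟩ := List.mem_map.1 h3
  have h5 := sz_le_of_mem hy
  have h6 : (pre.map Prod.snd).sum.size ≤ sz pre := by
    refine (size_sum_le _).trans ?_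
    rw [sz_list, sz_list, List.map_map]
    exact List.sum_le_sum fun i _ => by simp
  have h7 := Nat.size_le_size h4
  rw [sz_prod, ← hyx, sz_nat]
  rw [sz_prod] at h5
  omega

end PT

/-! ### Keys and the operations on tables -/

/-- A key lists a state for every vertex and the values of some counters. -/
abbrev Key (Q : Type) := List (ℕ × Q) × List ℕ

/-- A table is a list of keys with multiplicities: the number of partial solutions with this key. -/
abbrev Table (Q : Type) := List (Key Q × ℕ)

/-- The sum of two keys that list the same vertices in the same order. -/
def Key.add {Q : Type} [Add Q] (k l : Key Q) : Key Q :=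
  (List.zipWith (fun a b => (a.1, a.2 + b.2)) k.1 l.1, List.zipWith (fun a b => a + b) k.2 l.2)

namespace Table

variable {Q : Type} [DecidableEq Q] [AddCommMonoid Q]

/-- The convolution product of two tables. -/
def mul (T U : Table Q) : Table Q :=
  collect (T.flatMap fun e => U.map fun x => (e.1.add x.1, e.2 * x.2))

/-- The product of a list of tables, starting from `one`. -/
def prod (one : Table Q) (F : List (Table Q)) : Table Q := F.foldl mul one

/-- Does some key of the table have a nonzero state at `v`? -/
def touches (v : ℕ) (T : Table Q) : Bool :=
  T.any fun e => e.1.1.any fun a => decide (a.1 = v) && !decide (a.2 = 0)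

/-- Keeps the entries whose state at `v` is accepted, and resets this state. -/
def sumOut (acc : Q → Bool) (v : ℕ) (T : Table Q) : Table Q :=
  collect ((T.filter fun e => e.1.1.all fun a => !decide (a.1 = v) || acc a.2).map fun e =>
    ((e.1.1.map fun a => if a.1 = v then (a.1, 0) else a, e.1.2), e.2))

/-- Replaces the tables that touch `v` by their product, with `v` summed out. -/
def eliminate (acc : Q → Bool) (one : Table Q) (v : ℕ) (F : List (Table Q)) : List (Table Q) :=
  sumOut acc v (prod one (F.filter (touches v))) :: F.filter fun T => !touches v T

/-- The vertices `v` of `U` such that one of the bags contains the trace on `U` of each bag that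
contains `v`. -/
def simplicial (bags : List (List ℕ)) (U : List ℕ) : List ℕ :=
  U.filter fun v => bags.any fun x => bags.all fun y =>
    !decide (v ∈ y) || y.all fun u => !decide (u ∈ U) || decide (u ∈ x)

/-- One round of the algorithm: eliminate a simplicial vertex. -/
def round (bags : List (List ℕ)) (acc : Q → Bool) (one : Table Q)
    (s : List ℕ × List (Table Q)) : List ℕ × List (Table Q) :=
  match simplicial bags s.1 with
  | [] => s
  | v :: _ => (s.1.filter fun u => !decide (u = v), eliminate acc one v s.2)

end Table

namespace PT

variable {γ Q : Type} [Enc γ] [Enc Q] [DecidableEq Q] [EqTest Q] [AddCommMonoid Q]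

/-- Every function on a finite type is computed by table look-up. -/
theorem ofFinite {α β : Type} [Enc α] [DecidableEq α] [EqTest α] [Enc β] [Nonempty β] [Finite α]
    {f : γ → α} (F : α → β) (hf : PT f) : PT fun c => F (f c) :=
  have := Fintype.ofFinite α
  lookup F hf Finset.univ fun _ => Finset.mem_univ _

theorem keyAdd [Finite Q] {k l : γ → Key Q} (hk : PT k) (hl : PT l) : PT fun c => (k c).add (l c) :=
  (zipWith (f := fun x : γ × (ℕ × Q) × (ℕ × Q) => (x.2.1.1, x.2.1.2 + x.2.2.2)) hk.fst hl.fst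
    (id.snd.fst.fst.pair (ofFinite (fun y : Q × Q => y.1 + y.2)
      (id.snd.fst.snd.pair id.snd.snd.snd)))).pair
  (zipWith (f := fun x : γ × ℕ × ℕ => x.2.1 + x.2.2) hk.snd hl.snd (add id.snd.fst id.snd.snd))

theorem tableMul [Finite Q] {T U : γ → Table Q} (hT : PT T) (hU : PT U) :
    PT fun c => (T c).mul (U c) :=
  collect (flatMap (f := fun y : γ × (Key Q × ℕ) =>
      (U y.1).map fun x => (y.2.1.add x.1, y.2.2 * x.2))
    hT (map (f := fun z : (γ × (Key Q × ℕ)) × (Key Q × ℕ) => (z.1.2.1.add z.2.1, z.1.2.2 * z.2.2))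
      (hU.comp id.fst)
      ((keyAdd id.fst.snd.fst id.snd.fst).pair (mul id.fst.snd.snd id.snd.snd))))

theorem touches {v : γ → ℕ} {T : γ → Table Q} (hv : PT v) (hT : PT T) :
    PT fun c => (T c).touches (v c) :=
  any (f := fun y : γ × (Key Q × ℕ) => y.2.1.1.any fun a =>
      decide (a.1 = v y.1) && !decide (a.2 = 0)) hT
    (any (f := fun z : (γ × (Key Q × ℕ)) × (ℕ × Q) =>
        decide (z.2.1 = v z.1.1) && !decide (z.2.2 = 0)) id.snd.fst.fst
      (and (eq id.snd.fst (hv.comp id.fst.fst)) (eq id.snd.snd (const 0)).not))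

theorem sumOut [Finite Q] (acc : Q → Bool) {v : γ → ℕ} {T : γ → Table Q} (hv : PT v) (hT : PT T) :
    PT fun c => (T c).sumOut acc (v c) := by
  refine collect (map (f := fun y : γ × (Key Q × ℕ) =>
    ((y.2.1.1.map fun a => if a.1 = v y.1 then (a.1, 0) else a, y.2.1.2), y.2.2))
    (filter (f := fun y : γ × (Key Q × ℕ) => y.2.1.1.all fun a =>
      !decide (a.1 = v y.1) || acc a.2) hT ?_) ?_)
  · exact all (f := fun z : (γ × (Key Q × ℕ)) × (ℕ × Q) =>
        !decide (z.2.1 = v z.1.1) || acc z.2.2) id.snd.fst.fst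
      (or (eq id.snd.fst (hv.comp id.fst.fst)).not (ofFinite acc id.snd.snd))
  · exact ((map (f := fun z : (γ × (Key Q × ℕ)) × (ℕ × Q) =>
        if z.2.1 = v z.1.1 then (z.2.1, 0) else z.2) id.snd.fst.fst
      (ite (eq id.snd.fst (hv.comp id.fst.fst)) (id.snd.fst.pair (const 0)) id.snd)).pair
        id.snd.fst.snd).pair id.snd.snd

theorem simplicial {bags : γ → List (List ℕ)} {U : γ → List ℕ} (hb : PT bags) (hU : PT U) :
    PT fun c => Table.simplicial (bags c) (U c) := by
  refine filter (f := fun x : γ × ℕ => (bags x.1).any fun b => (bags x.1).all fun y =>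
    !decide (x.2 ∈ y) || y.all fun u => !decide (u ∈ U x.1) || decide (u ∈ b)) hU ?_
  refine any (f := fun x : (γ × ℕ) × List ℕ => (bags x.1.1).all fun y =>
    !decide (x.1.2 ∈ y) || y.all fun u => !decide (u ∈ U x.1.1) || decide (u ∈ x.2))
    (hb.comp id.fst) ?_
  refine all (f := fun x : ((γ × ℕ) × List ℕ) × List ℕ =>
    !decide (x.1.1.2 ∈ x.2) || x.2.all fun u => !decide (u ∈ U x.1.1.1) || decide (u ∈ x.1.2))
    (hb.comp id.fst.fst) ?_
  refine or (mem id.fst.fst.snd id.snd).not ?_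
  exact all (f := fun x : (((γ × ℕ) × List ℕ) × List ℕ) × ℕ =>
    !decide (x.2 ∈ U x.1.1.1.1) || decide (x.2 ∈ x.1.1.2)) id.snd
    (or (mem id.snd (hU.comp id.fst.fst.fst.fst)).not (mem id.snd id.fst.fst.snd))

end PT

/-! ### Correctness of the elimination of a vertex -/

section Semantics

variable {Q : Type}

/-- The key with states `f` at the listed vertices and counters `g 0, …, g (s - 1)`. -/
def keyOf (verts : List ℕ) (s : ℕ) (f : ℕ → Q) (g : ℕ → ℕ) : Key Q :=
  (verts.map fun v => (v, f v), (List.range s).map g)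

variable [AddCommMonoid Q]

/-- The state that a key lists for `v`, zero if there is none. -/
def Key.state (k : Key Q) (v : ℕ) : Q := ((k.1.find? fun a => a.1 = v).map Prod.snd).getD 0

/-- A key as an element of a commutative monoid. -/
def Key.dec (k : Key Q) : (ℕ → Q) × (ℕ → ℕ) := (k.state, fun i => k.2.getD i 0)

theorem state_keyOf (verts : List ℕ) (s : ℕ) (f : ℕ → Q) (g : ℕ → ℕ) (v : ℕ) :
    (keyOf verts s f g).state v = if v ∈ verts then f v else 0 := by
  unfold Key.state keyOf
  induction verts with
  | nil => simp
  | cons u verts ih =>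
    by_cases h : u = v
    · simp [h]
    · simp only [List.map_cons, List.find?_cons, h, decide_false, List.mem_cons]
      rw [ih]
      simp [Ne.symm h]

theorem counter_keyOf (verts : List ℕ) (s : ℕ) (f : ℕ → Q) (g : ℕ → ℕ) (i : ℕ) :
    (keyOf verts s f g).2.getD i 0 = if i < s then g i else 0 := by
  unfold keyOf
  by_cases h : i < s <;> simp [h, List.getD_eq_getElem?_getD]

theorem add_keyOf (verts : List ℕ) (s : ℕ) (f f' : ℕ → Q) (g g' : ℕ → ℕ) :
    (keyOf verts s f g).add (keyOf verts s f' g') = keyOf verts s (f + f') (g + g') := by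
  simp [Key.add, keyOf, List.zipWith_map]

theorem dec_keyOf (verts : List ℕ) (s : ℕ) (f : ℕ → Q) (g : ℕ → ℕ) :
    (keyOf verts s f g).dec =
      (fun v => if v ∈ verts then f v else 0, fun i => if i < s then g i else 0) := by
  refine Prod.ext (funext fun v => state_keyOf verts s f g v)
    (funext fun i => counter_keyOf verts s f g i)

theorem dec_add_keyOf (verts : List ℕ) (s : ℕ) (f f' : ℕ → Q) (g g' : ℕ → ℕ) :
    (keyOf verts s (f + f') (g + g')).dec = (keyOf verts s f g).dec + (keyOf verts s f' g').dec := by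
  simp only [dec_keyOf]
  refine Prod.ext (funext fun v => ?_) (funext fun i => ?_)
  · by_cases h : v ∈ verts <;> simp [h]
  · by_cases h : i < s <;> simp [h]

/-- Resetting the state of `v` to zero. -/
def clearState (v : ℕ) (k : (ℕ → Q) × (ℕ → ℕ)) : (ℕ → Q) × (ℕ → ℕ) :=
  (fun u => if u = v then 0 else k.1 u, k.2)

/-- Evaluation of a function of the keys on a formal combination of keys. -/
noncomputable def evalKeys (h : (ℕ → Q) × (ℕ → ℕ) → ℕ) :
    AddMonoidAlgebra ℕ ((ℕ → Q) × (ℕ → ℕ)) →+ ℕ :=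
  (Finsupp.liftAddHom fun k => AddMonoidHom.mulRight (h k)).comp
    AddMonoidAlgebra.coeffAddEquiv.toAddMonoidHom

theorem evalKeys_single (h : (ℕ → Q) × (ℕ → ℕ) → ℕ) (k : (ℕ → Q) × (ℕ → ℕ)) (c : ℕ) :
    evalKeys h (AddMonoidAlgebra.single k c) = c * h k := by
  change (Finsupp.single k c).sum (fun k c => c * h k) = _
  simp

namespace Table

/-- The formal combination of keys that a table stands for. -/
noncomputable def sem (T : Table Q) : AddMonoidAlgebra ℕ ((ℕ → Q) × (ℕ → ℕ)) :=
  (T.map fun e => AddMonoidAlgebra.single e.1.dec e.2).sum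

/-- All keys list the vertices `verts` and `s` counters. -/
def Good (verts : List ℕ) (s : ℕ) (T : Table Q) : Prop := ∀ e ∈ T, ∃ f g, e.1 = keyOf verts s f g

/-- The table that is neutral for the product. -/
def unit (verts : List ℕ) (s : ℕ) : Table Q := [(keyOf verts s 0 0, 1)]

theorem sem_unit (verts : List ℕ) (s : ℕ) : (unit verts s : Table Q).sem = 1 := by
  have : (keyOf verts s (0 : ℕ → Q) 0).dec = 0 := by
    rw [dec_keyOf]
    refine Prod.ext (funext fun v => ?_) (funext fun i => ?_) <;> simp
  simp [sem, unit, this, AddMonoidAlgebra.one_def]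

theorem evalKeys_sem_mul (h : (ℕ → Q) × (ℕ → ℕ) → ℕ) (T U : Table Q) :
    evalKeys h (T.sem * U.sem) =
      (T.map fun e => (U.map fun x => e.2 * x.2 * h (e.1.dec + x.1.dec)).sum).sum := by
  unfold sem
  rw [← List.sum_map_mul_right]
  simp only [← List.sum_map_mul_left, map_list_sum, List.map_map, Function.comp_def,
    AddMonoidAlgebra.single_mul_single, evalKeys_single]

theorem evalKeys_sem (h : (ℕ → Q) × (ℕ → ℕ) → ℕ) (T : Table Q) :
    evalKeys h T.sem = (T.map fun e => e.2 * h e.1.dec).sum := by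
  simp only [sem, map_list_sum, List.map_map, Function.comp_def, evalKeys_single]

variable [DecidableEq Q] {verts : List ℕ} {s : ℕ} {T U : Table Q}

theorem good_collect {l : List (Key Q × ℕ)} (hl : Good verts s l) : Good verts s (collect l) := by
  intro e he
  obtain ⟨x, hx, hxe⟩ := List.mem_map.1 (mem_collect he).1
  obtain ⟨f, g, h⟩ := hl x hx
  exact ⟨f, g, by rw [← hxe, h]⟩

theorem sem_collect (l : List (Key Q × ℕ)) : sem (collect l) = sem l :=
  sum_collect (fun (k : Key Q) c => AddMonoidAlgebra.single k.dec c)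
    (fun _ _ _ => AddMonoidAlgebra.single_add _ _ _) l

theorem good_mul (hT : Good verts s T) (hU : Good verts s U) : Good verts s (T.mul U) := by
  refine good_collect fun e he => ?_
  obtain ⟨x, hx, he⟩ := List.mem_flatMap.1 he
  obtain ⟨y, hy, rfl⟩ := List.mem_map.1 he
  obtain ⟨f, g, h⟩ := hT x hx
  obtain ⟨f', g', h'⟩ := hU y hy
  exact ⟨_, _, by rw [h, h', add_keyOf]⟩

theorem sem_mul (hT : Good verts s T) (hU : Good verts s U) :
    (T.mul U).sem = T.sem * U.sem := by
  rw [mul, sem_collect]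
  unfold sem
  rw [← List.sum_map_mul_right, List.map_flatMap, List.flatMap_def, List.sum_flatten, List.map_map]
  refine congrArg List.sum (List.map_congr_left fun e he => ?_)
  simp only [Function.comp_apply, List.map_map, ← List.sum_map_mul_left]
  refine congrArg List.sum (List.map_congr_left fun x hx => ?_)
  obtain ⟨f, g, h⟩ := hT e he
  obtain ⟨f', g', h'⟩ := hU x hx
  simp only [Function.comp_apply, AddMonoidAlgebra.single_mul_single, h, h', add_keyOf,
    dec_add_keyOf]

theorem good_unit : Good verts s (unit verts s : Table Q) := by
  intro e he
  rw [unit, List.mem_singleton] at he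
  exact ⟨0, 0, by rw [he]⟩

theorem prod_concat (one : Table Q) (F : List (Table Q)) (T : Table Q) :
    prod one (F ++ [T]) = (prod one F).mul T := by
  simp [prod]

theorem good_prod {F : List (Table Q)} (hF : ∀ T ∈ F, Good verts s T) :
    Good verts s (prod (unit verts s) F) := by
  induction F using List.reverseRecOn with
  | nil => exact good_unit
  | append_singleton F T ih =>
    rw [prod_concat]
    exact good_mul (ih fun T hT => hF T (by simp [hT])) (hF T (by simp))

theorem sem_prod {F : List (Table Q)} (hF : ∀ T ∈ F, Good verts s T) :
    (prod (unit verts s) F).sem = (F.map sem).prod := by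
  induction F using List.reverseRecOn with
  | nil => exact sem_unit verts s
  | append_singleton F T ih =>
    have h : ∀ T ∈ F, Good verts s T := fun T hT => hF T (by simp [hT])
    rw [prod_concat, sem_mul (good_prod h) (hF T (by simp)), ih h]
    simp

theorem touches_iff (hT : Good verts s T) (v : ℕ) :
    T.touches v = true ↔ ∃ e ∈ T, e.1.state v ≠ 0 := by
  unfold touches
  rw [List.any_eq_true]
  refine exists_congr fun e => and_congr_right fun he => ?_
  obtain ⟨f, g, h⟩ := hT e he
  rw [h, state_keyOf]
  by_cases hv : v ∈ verts <;> simp [keyOf, hv]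

theorem touches_collect {l : List (Key Q × ℕ)} {v : ℕ} (h : touches v (collect l) = true) :
    touches v l = true := by
  unfold touches at *
  rw [List.any_eq_true] at *
  obtain ⟨e, he, h⟩ := h
  obtain ⟨x, hx, hxe⟩ := List.mem_map.1 (mem_collect he).1
  exact ⟨x, hx, hxe ▸ h⟩

theorem touches_mul (hT : Good verts s T) (hU : Good verts s U) {v : ℕ}
    (h : (T.mul U).touches v = true) : T.touches v = true ∨ U.touches v = true := by
  obtain ⟨e, he, h⟩ := List.any_eq_true.1 (touches_collect h)
  obtain ⟨x, hx, he⟩ := List.mem_flatMap.1 he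
  obtain ⟨y, hy, rfl⟩ := List.mem_map.1 he
  obtain ⟨f, g, hf⟩ := hT x hx
  obtain ⟨f', g', hf'⟩ := hU y hy
  rw [hf, hf', add_keyOf] at h
  simp only [keyOf, List.any_map, List.any_eq_true, Function.comp_apply, Bool.and_eq_true,
    decide_eq_true_eq, Bool.not_eq_true', decide_eq_false_iff_not, Pi.add_apply] at h
  obtain ⟨u, hu, rfl, hne⟩ := h
  rw [touches_iff hT, touches_iff hU]
  by_cases h0 : f u = 0
  · refine Or.inr ⟨y, hy, ?_⟩
    rw [hf', state_keyOf, if_pos hu]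
    simpa [h0] using hne
  · refine Or.inl ⟨x, hx, ?_⟩
    rw [hf, state_keyOf, if_pos hu]
    exact h0

theorem touches_prod {F : List (Table Q)} (hF : ∀ T ∈ F, Good verts s T) {v : ℕ}
    (h : (prod (unit verts s) F).touches v = true) : ∃ T ∈ F, T.touches v = true := by
  induction F using List.reverseRecOn with
  | nil =>
    simp [prod, unit, touches, keyOf] at h
  | append_singleton F T ih =>
    have hF' : ∀ T ∈ F, Good verts s T := fun T hT => hF T (by simp [hT])
    rw [prod_concat] at h
    rcases touches_mul (good_prod hF') (hF T (by simp)) h with h | h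
    · obtain ⟨U, hU, h⟩ := ih hF' h
      exact ⟨U, by simp [hU], h⟩
    · exact ⟨T, by simp, h⟩

theorem sumOut_entry (f : ℕ → Q) (g : ℕ → ℕ) (v : ℕ) :
    ((keyOf verts s f g).1.map fun a => if a.1 = v then (a.1, 0) else a, (keyOf verts s f g).2) =
      keyOf verts s (fun u => if u = v then 0 else f u) g := by
  simp only [keyOf, List.map_map, Prod.mk.injEq, and_true]
  refine List.map_congr_left fun u _ => ?_
  by_cases h : u = v <;> simp [h]

theorem good_sumOut (acc : Q → Bool) (v : ℕ) (hT : Good verts s T) :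
    Good verts s (T.sumOut acc v) := by
  refine good_collect fun e he => ?_
  obtain ⟨x, hx, rfl⟩ := List.mem_map.1 he
  obtain ⟨f, g, h⟩ := hT x (List.mem_of_mem_filter hx)
  exact ⟨_, g, by rw [h]; exact sumOut_entry f g v⟩

theorem touches_sumOut (acc : Q → Bool) {u v : ℕ} (hT : Good verts s T)
    (h : (T.sumOut acc v).touches u = true) : u ≠ v ∧ T.touches u = true := by
  obtain ⟨e, he, h⟩ := List.any_eq_true.1 (touches_collect h)
  obtain ⟨x, hx, rfl⟩ := List.mem_map.1 he
  have hx' := List.mem_of_mem_filter hx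
  obtain ⟨f, g, hf⟩ := hT x hx'
  rw [hf, sumOut_entry] at h
  simp only [keyOf, List.any_map, List.any_eq_true, Function.comp_apply, Bool.and_eq_true,
    decide_eq_true_eq, Bool.not_eq_true', decide_eq_false_iff_not] at h
  obtain ⟨w, hw, rfl, hne⟩ := h
  split_ifs at hne with hwv
  · exact absurd rfl hne
  · rw [touches_iff hT]
    exact ⟨hwv, x, hx', by rwa [hf, state_keyOf, if_pos hw]⟩

open Classical in
/-- Summing out `v` in one factor is the same as summing out `v` in the product, if the other factor
does not touch `v`. -/
theorem evalKeys_sumOut_mul (acc : Q → Bool) (h : (ℕ → Q) × (ℕ → ℕ) → ℕ) {v : ℕ} (hv : v ∈ verts)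
    (hT : Good verts s T) (hU : Good verts s U) (hUv : U.touches v = false) :
    evalKeys h ((T.sumOut acc v).sem * U.sem) =
      evalKeys (fun k => if acc (k.1 v) then h (clearState v k) else 0) (T.sem * U.sem) := by
  rw [sumOut, sem_collect, evalKeys_sem_mul, evalKeys_sem_mul]
  have key : ∀ T : Table Q, Good verts s T →
      (((T.filter fun e => e.1.1.all fun a => !decide (a.1 = v) || acc a.2).map fun e =>
        (((e.1.1.map fun a => if a.1 = v then (a.1, 0) else a, e.1.2), e.2) : Key Q × ℕ)).map
        fun e => (U.map fun x => e.2 * x.2 * h (e.1.dec + x.1.dec)).sum).sum =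
      (T.map fun e => (U.map fun x => e.2 * x.2 * (if acc ((e.1.dec + x.1.dec).1 v) then
        h (clearState v (e.1.dec + x.1.dec)) else 0)).sum).sum := by
    intro T hT
    induction T with
    | nil => rfl
    | cons e T ih =>
      have ih := ih fun x hx => hT x (List.mem_cons_of_mem _ hx)
      obtain ⟨⟨k, c⟩, m⟩ := e
      obtain ⟨f, g, hf⟩ := hT _ List.mem_cons_self
      have hf : (k, c) = keyOf verts s f g := hf
      have hx0 : ∀ x ∈ U, ((keyOf verts s f g).dec + x.1.dec).1 v = f v := by
        intro x hx
        have : x.1.state v = 0 := by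
          by_contra h0
          rw [(touches_iff hU v).2 ⟨x, hx, h0⟩] at hUv
          exact absurd hUv (by simp)
        change (keyOf verts s f g).state v + x.1.state v = f v
        rw [this, state_keyOf, if_pos hv, add_zero]
      have hall : (k.all fun a => !decide (a.1 = v) || acc a.2) = acc (f v) := by
        have hk : k = (keyOf verts s f g).1 := by rw [← hf]
        rw [hk, Bool.eq_iff_iff]
        simp only [keyOf, List.all_map, List.all_eq_true, Function.comp_apply, Bool.or_eq_true,
          Bool.not_eq_true', decide_eq_false_iff_not]
        constructor
        · intro H
          exact (H v hv).resolve_left (by simp)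
        · intro H u _
          by_cases huv : u = v
          · exact Or.inr (huv ▸ H)
          · exact Or.inl huv
      rw [List.filter_cons, hall]
      by_cases ha : acc (f v) = true
      · rw [if_pos ha, List.map_cons, List.map_cons, List.sum_cons, ih, List.map_cons,
          List.sum_cons]
        congr 2
        refine List.map_congr_left fun x hx => ?_
        dsimp only
        rw [hf, hx0 x hx, if_pos ha]
        congr 2
        have := sumOut_entry (verts := verts) (s := s) f g v
        rw [← hf] at this
        rw [this, dec_keyOf, dec_keyOf]
        have hxv : x.1.state v = 0 := by
          by_contra h0
          rw [(touches_iff hU v).2 ⟨x, hx, h0⟩] at hUv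
          exact absurd hUv (by simp)
        refine Prod.ext (funext fun u => ?_) rfl
        by_cases huv : u = v
        · subst huv
          simpa [clearState] using (show x.1.dec.1 u = 0 from hxv)
        · simp [clearState, huv]
      · rw [if_neg ha, ih, List.map_cons, List.sum_cons]
        symm
        rw [Nat.add_eq_right]
        refine List.sum_eq_zero fun y hy => ?_
        obtain ⟨x, hx, rfl⟩ := List.mem_map.1 hy
        dsimp only
        rw [hf, hx0 x hx, if_neg ha, mul_zero]
  exact key T hT

open Classical in
/-- After the elimination of `v`, the product of all tables represents the keys of the former product
whose state at `v` is accepted, with this state reset. -/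
theorem evalKeys_eliminate (acc : Q → Bool) (h : (ℕ → Q) × (ℕ → ℕ) → ℕ) {v : ℕ} (hv : v ∈ verts)
    {F : List (Table Q)} (hF : ∀ T ∈ F, Good verts s T) :
    evalKeys h ((eliminate acc (unit verts s) v F).map sem).prod =
      evalKeys (fun k => if acc (k.1 v) then h (clearState v k) else 0) (F.map sem).prod := by
  have h1 : ∀ T ∈ F.filter (touches v), Good verts s T := fun T hT =>
    hF T (List.mem_of_mem_filter hT)
  have h2 : ∀ T ∈ F.filter (fun T => !touches v T), Good verts s T := fun T hT =>
    hF T (List.mem_of_mem_filter hT)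
  have h3 : (F.map sem).prod =
      ((F.filter (touches v)).map sem).prod * ((F.filter fun T => !touches v T).map sem).prod := by
    rw [← List.prod_append, ← List.map_append]
    exact ((List.filter_append_perm _ F).map _).prod_eq.symm
  have h4 : touches v (prod (unit verts s) (F.filter fun T => !touches v T)) = false := by
    rw [Bool.eq_false_iff]
    intro H
    obtain ⟨T, hT, hTv⟩ := touches_prod h2 H
    simpa [hTv] using List.of_mem_filter hT
  rw [eliminate, List.map_cons, List.prod_cons, h3, ← sem_prod h1, ← sem_prod h2,
    evalKeys_sumOut_mul acc h hv (good_prod h1) (good_prod h2) h4]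

theorem good_eliminate (acc : Q → Bool) (v : ℕ) {F : List (Table Q)}
    (hF : ∀ T ∈ F, Good verts s T) : ∀ T ∈ eliminate acc (unit verts s) v F, Good verts s T := by
  intro T hT
  rcases List.mem_cons.1 hT with rfl | hT
  · exact good_sumOut acc v (good_prod fun T hT => hF T (List.mem_of_mem_filter hT))
  · exact hF T (List.mem_of_mem_filter hT)

end Table

end Semantics

/-! ### Sizes of tables -/

namespace Table

variable {Q : Type} [AddCommMonoid Q]

/-- All counters are at most `w`, and the multiplicities add up to at most `L ^ w`. -/
def Bdd (L w : ℕ) (T : Table Q) : Prop :=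
  (∀ e ∈ T, ∀ x ∈ e.1.2, x ≤ w) ∧ (T.map Prod.snd).sum ≤ L ^ w

/-- The least `w` such that the counters and the logarithm of the sum of the multiplicities are
bounded by `w`. It is subadditive with respect to products of tables. -/
noncomputable def weight (L : ℕ) (T : Table Q) : ℕ := sInf {w | Bdd L w T}

theorem Bdd.weight_le {L w : ℕ} {T : Table Q} (h : Bdd L w T) : weight L T ≤ w := Nat.sInf_le h

theorem bdd_weight {L : ℕ} (hL : 2 ≤ L) (T : Table Q) : Bdd L (weight L T) T := by
  refine Nat.sInf_mem (s := {w | Bdd L w T})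
    ⟨(T.map fun e => e.1.2.sum).sum + (T.map Prod.snd).sum, ?_, ?_⟩
  · intro e he x hx
    exact ((List.le_sum_of_mem hx).trans (List.le_sum_of_mem
      (List.mem_map_of_mem (f := fun e : Key Q × ℕ => e.1.2.sum) he))).trans (Nat.le_add_right _ _)
  · exact (Nat.lt_pow_self (by omega)).le.trans (Nat.pow_le_pow_right (by omega) (by omega))

variable [DecidableEq Q] {verts : List ℕ} {s : ℕ} {T U : Table Q} {L : ℕ}

theorem sum_snd_collect (l : List (Key Q × ℕ)) :
    ((collect l).map Prod.snd).sum = (l.map Prod.snd).sum :=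
  sum_collect (fun (_ : Key Q) c => c) (fun _ _ _ => rfl) l

theorem Bdd.mul {w w' : ℕ} (hT : Bdd L w T) (hU : Bdd L w' U) : Bdd L (w + w') (T.mul U) := by
  refine ⟨fun e he x hx => ?_, ?_⟩
  · obtain ⟨y, hy, hye⟩ := List.mem_map.1 (mem_collect he).1
    obtain ⟨a, ha, hy⟩ := List.mem_flatMap.1 hy
    obtain ⟨b, hb, rfl⟩ := List.mem_map.1 hy
    rw [← hye] at hx
    obtain ⟨i, hi, rfl⟩ := List.getElem_of_mem hx
    simp only [Key.add, List.getElem_zipWith]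
    exact Nat.add_le_add (hT.1 a ha _ (List.getElem_mem _)) (hU.1 b hb _ (List.getElem_mem _))
  · rw [Table.mul, sum_snd_collect, pow_add]
    refine le_trans (le_of_eq ?_) (Nat.mul_le_mul hT.2 hU.2)
    rw [← List.sum_map_mul_right, List.map_flatMap, List.flatMap_def, List.sum_flatten,
      List.map_map]
    refine congrArg List.sum (List.map_congr_left fun e he => ?_)
    simp [List.map_map, Function.comp_def, List.sum_map_mul_left]

theorem Bdd.sumOut {w : ℕ} (acc : Q → Bool) (v : ℕ) (hT : Bdd L w T) :
    Bdd L w (T.sumOut acc v) := by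
  refine ⟨fun e he x hx => ?_, ?_⟩
  · obtain ⟨y, hy, hye⟩ := List.mem_map.1 (mem_collect he).1
    obtain ⟨a, ha, rfl⟩ := List.mem_map.1 hy
    rw [← hye] at hx
    exact hT.1 a (List.mem_of_mem_filter ha) x hx
  · rw [Table.sumOut, sum_snd_collect, List.map_map]
    refine le_trans ?_ hT.2
    exact (List.filter_sublist.map Prod.snd).sum_le_sum (by simp)

theorem bdd_unit : Bdd L 0 (unit verts s : Table Q) := by
  refine ⟨fun e he x hx => ?_, by simp [unit]⟩
  rw [unit, List.mem_singleton] at he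
  subst he
  simp [keyOf] at hx
  omega

theorem weight_prod_le (hL : 2 ≤ L) (F : List (Table Q)) :
    weight L (prod (unit verts s) F) ≤ (F.map (weight L)).sum := by
  induction F using List.reverseRecOn with
  | nil => exact bdd_unit.weight_le
  | append_singleton F T ih =>
    rw [prod_concat]
    refine ((bdd_weight hL _).mul (bdd_weight hL T)).weight_le.trans ?_
    simpa using ih

theorem nodup_prod (F : List (Table Q)) :
    ((prod (unit verts s) F).map Prod.fst).Nodup := by
  induction F using List.reverseRecOn with
  | nil => simp [prod, unit]
  | append_singleton F T ih =>
    rw [prod_concat]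
    exact nodup_collect _

theorem getD_le {w : ℕ} {l : List ℕ} (h : ∀ x ∈ l, x ≤ w) (i : ℕ) : l.getD i 0 ≤ w := by
  rw [List.getD_eq_getElem?_getD]
  by_cases hi : i < l.length
  · rw [List.getElem?_eq_getElem hi]
    exact h _ (List.getElem_mem hi)
  · rw [List.getElem?_eq_none (by omega)]
    simp

/-- Without repeated keys, the number of entries is at most exponential in the number of touched
vertices. -/
theorem length_le [Finite Q] {w : ℕ} (S : Finset ℕ) (hT : Good verts s T)
    (hN : (T.map Prod.fst).Nodup) (hw : Bdd L w T) (hS : ∀ v, T.touches v = true → v ∈ S) :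
    T.length ≤ Nat.card Q ^ S.card * (w + 1) ^ s := by
  classical
  have := Fintype.ofFinite Q
  have hc : Nat.card Q ^ S.card * (w + 1) ^ s =
      (Finset.univ : Finset ((S → Q) × (Fin s → Fin (w + 1)))).card := by
    simp
  have hl : T.length = (T.map Prod.fst).toFinset.card := by
    rw [List.toFinset_card_of_nodup hN, List.length_map]
  rw [hc, hl]
  refine Finset.card_le_card_of_injOn (fun k => (fun v => k.state v,
    fun i => ⟨min (k.2.getD i 0) w, by omega⟩)) (by simp) ?_
  intro k hk l hl hkl
  simp only [Finset.mem_coe, List.mem_toFinset, List.mem_map] at hk hl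
  obtain ⟨e, he, rfl⟩ := hk
  obtain ⟨x, hx, rfl⟩ := hl
  obtain ⟨f, g, hf⟩ := hT e he
  obtain ⟨f', g', hf'⟩ := hT x hx
  simp only [Prod.mk.injEq] at hkl
  obtain ⟨h1, h2⟩ := hkl
  have hst : ∀ v, e.1.state v = x.1.state v := by
    intro v
    by_cases hv : v ∈ S
    · exact congrFun h1 ⟨v, hv⟩
    · have h3 : ∀ y ∈ T, y.1.state v = 0 := fun y hy => by
        by_contra h0
        exact hv (hS v ((touches_iff hT v).2 ⟨y, hy, h0⟩))
      rw [h3 e he, h3 x hx]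
  have hct : ∀ i < s, e.1.2.getD i 0 = x.1.2.getD i 0 := by
    intro i hi
    have := congrArg Fin.val (congrFun h2 ⟨i, hi⟩)
    simp only at this
    have := getD_le (hw.1 e he) i
    have := getD_le (hw.1 x hx) i
    omega
  rw [hf, hf'] at hst hct ⊢
  unfold keyOf
  refine Prod.ext (List.map_congr_left fun v hv => ?_) (List.map_congr_left fun i hi => ?_)
  · have := hst v
    rw [state_keyOf, state_keyOf, if_pos hv, if_pos hv] at this
    rw [this]
  · have hi := List.mem_range.1 hi
    have := hct i hi
    rwa [counter_keyOf, counter_keyOf, if_pos hi, if_pos hi] at this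

theorem sz_table_le [Finite Q] [Enc Q] {B w : ℕ} (hB : ∀ q : Q, sz q ≤ B) (S : Finset ℕ)
    (hT : Good verts s T) (hN : (T.map Prod.fst).Nodup) (hw : Bdd L w T)
    (hS : ∀ v, T.touches v = true → v ∈ S) :
    sz T ≤ Nat.card Q ^ S.card * (w + 1) ^ s *
      (sz verts + verts.length * B + s * (w + 1) + (w * L.size + 1) + 1) := by
  refine (sz_list_le (b := sz verts + verts.length * B + s * (w + 1) + (w * L.size + 1))
    fun e he => ?_).trans (Nat.mul_le_mul_right _ (length_le S hT hN hw hS))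
  obtain ⟨f, g, hf⟩ := hT e he
  have h1 : sz e.1.1 ≤ sz verts + verts.length * B := by
    rw [hf]
    simp only [keyOf]
    clear hf hT hN hS he
    induction verts with
    | nil => simp
    | cons v verts ih =>
      have := hB (f v)
      simp only [List.map_cons, sz_cons, sz_prod, List.length_cons, add_mul, one_mul]
      omega
  have h2 : sz e.1.2 ≤ s * (w + 1) := by
    have hl : e.1.2.length = s := by simp [hf, keyOf]
    rw [← hl]
    refine sz_list_le fun x hx => ?_
    exact (Nat.size_le.2 ((hw.1 e he x hx).trans_lt Nat.lt_two_pow_self))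
  have h3 : sz e.2 ≤ w * L.size + 1 := by
    rw [sz_nat, Nat.size_le]
    have h4 : e.2 ≤ L ^ w := (List.le_sum_of_mem (List.mem_map_of_mem he)).trans hw.2
    have h5 : L ^ w ≤ 2 ^ (w * L.size) := by
      rw [mul_comm, pow_mul]
      exact Nat.pow_le_pow_left (Nat.lt_size_self L).le w
    rw [pow_succ]
    have : 0 < 2 ^ (w * L.size) := by positivity
    omega
  rw [sz_prod, sz_prod]
  omega

/-! ### The elimination of all vertices -/

theorem mem_simplicial {bags : List (List ℕ)} {U : List ℕ} {v : ℕ} :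
    v ∈ simplicial bags U ↔
      v ∈ U ∧ ∃ x ∈ bags, ∀ y ∈ bags, v ∈ y → ∀ u ∈ y, u ∈ U → u ∈ x := by
  simp only [simplicial, List.mem_filter, List.any_eq_true, List.all_eq_true, Bool.or_eq_true,
    Bool.not_eq_true', decide_eq_false_iff_not, decide_eq_true_eq, ← imp_iff_not_or]

/-- The invariant of the algorithm on the set `p.1` of remaining vertices and the list `p.2` of
tables: the vertices touched by each table remain and lie in a common bag, and the total weight
does not grow. -/
structure Inv (bags : List (List ℕ)) (verts : List ℕ) (s L : ℕ) (F₀ : List (Table Q))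
    (p : List ℕ × List (Table Q)) : Prop where
  sub : p.1.Sublist verts
  good : ∀ T ∈ p.2, Good verts s T
  nodup : ∀ T ∈ p.2, (T.map Prod.fst).Nodup
  supp : ∀ T ∈ p.2, ∃ x ∈ bags, ∀ v, T.touches v = true → v ∈ x ∧ v ∈ p.1
  wt : (p.2.map (weight L)).sum ≤ (F₀.map (weight L)).sum
  len : p.2.length + p.1.length ≤ F₀.length + verts.length

variable {bags : List (List ℕ)} {F₀ : List (Table Q)} {p : List ℕ × List (Table Q)}

theorem Inv.supp_prod (hp : Inv bags verts s L F₀ p) {v : ℕ} (hv : v ∈ simplicial bags p.1)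
    {F : List (Table Q)} (hF : ∀ T ∈ F, T ∈ p.2 ∧ T.touches v = true) :
    ∃ x ∈ bags, ∀ u, (prod (unit verts s) F).touches u = true → u ∈ x ∧ u ∈ p.1 := by
  obtain ⟨-, x, hx, hvx⟩ := mem_simplicial.1 hv
  refine ⟨x, hx, fun u hu => ?_⟩
  obtain ⟨T, hT, hTu⟩ := touches_prod (fun T hT => hp.good T (hF T hT).1) hu
  obtain ⟨y, hy, hTy⟩ := hp.supp T (hF T hT).1
  exact ⟨hvx y hy (hTy v (hF T hT).2).1 u (hTy u hTu).1 (hTy u hTu).2, (hTy u hTu).2⟩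

theorem Inv.round (hL : 2 ≤ L) (acc : Q → Bool) (hp : Inv bags verts s L F₀ p) :
    Inv bags verts s L F₀ (round bags acc (unit verts s) p) := by
  unfold Table.round
  split
  · exact hp
  · rename_i v t hv
    have hv : v ∈ simplicial bags p.1 := by rw [hv]; simp
    have hF : ∀ T ∈ p.2.filter (touches v), T ∈ p.2 ∧ T.touches v = true := fun T hT =>
      List.mem_filter.1 hT
    have hF' : ∀ T ∈ p.2.filter (touches v), Good verts s T := fun T hT => hp.good T (hF T hT).1
    refine ⟨List.filter_sublist.trans hp.sub, good_eliminate acc v hp.good, ?_, ?_, ?_, ?_⟩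
    · intro T hT
      rcases List.mem_cons.1 hT with rfl | hT
      · exact nodup_collect _
      · exact hp.nodup T (List.mem_of_mem_filter hT)
    · intro T hT
      simp only [List.mem_filter, Bool.not_eq_true', decide_eq_false_iff_not]
      rcases List.mem_cons.1 hT with rfl | hT
      · obtain ⟨x, hx, h⟩ := hp.supp_prod hv hF
        refine ⟨x, hx, fun u hu => ?_⟩
        obtain ⟨huv, hu⟩ := touches_sumOut acc (good_prod hF') hu
        exact ⟨(h u hu).1, (h u hu).2, huv⟩
      · obtain ⟨hT, hTv⟩ := List.mem_filter.1 hT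
        obtain ⟨x, hx, h⟩ := hp.supp T hT
        refine ⟨x, hx, fun u hu => ⟨(h u hu).1, (h u hu).2, ?_⟩⟩
        rintro rfl
        simp [hu] at hTv
    · refine le_trans ?_ hp.wt
      rw [← ((List.filter_append_perm (touches v) p.2).map (weight L)).sum_eq, List.map_append,
        List.sum_append, eliminate, List.map_cons, List.sum_cons]
      exact Nat.add_le_add_right
        (((bdd_weight hL _).sumOut acc v).weight_le.trans (weight_prod_le hL _)) _
    · have h1 : (p.1.filter fun u => !decide (u = v)).length < p.1.length :=
        List.length_filter_lt_length_iff_exists.2 ⟨v, (mem_simplicial.1 hv).1, by simp⟩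
      have h2 := List.length_filter_le (fun T => !touches v T) p.2
      have := hp.len
      simp only [eliminate, List.length_cons]
      omega

/-- The state of the algorithm after a round for each element of `l`. -/
def run (bags : List (List ℕ)) (acc : Q → Bool) (one : Table Q) (l : List ℕ)
    (p : List ℕ × List (Table Q)) : List ℕ × List (Table Q) :=
  l.foldl (fun p _ => round bags acc one p) p

theorem Inv.run (hL : 2 ≤ L) (acc : Q → Bool) (l : List ℕ) (hp : Inv bags verts s L F₀ p) :
    Inv bags verts s L F₀ (run bags acc (unit verts s) l p) := by
  induction l generalizing p with
  | nil => exact hp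
  | cons a l ih => exact ih (hp.round hL acc)

/-- Every round eliminates a vertex, since there always is a simplicial one. -/
theorem length_run (hs : ∀ U : List ℕ, U.Sublist verts → U ≠ [] → simplicial bags U ≠ [])
    (hL : 2 ≤ L) (acc : Q → Bool) (l : List ℕ) (hp : Inv bags verts s L F₀ p) :
    (Table.run bags acc (unit verts s) l p).1.length ≤ p.1.length - l.length := by
  induction l generalizing p with
  | nil => simp [Table.run]
  | cons a l ih =>
    have h := ih (hp.round hL acc)
    have h' : (Table.round bags acc (unit verts s) p).1.length ≤ p.1.length - 1 := by
      by_cases h0 : p.1 = []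
      · unfold Table.round
        simp [h0, simplicial]
      · unfold Table.round
        split
        · rename_i h1
          exact absurd h1 (hs _ hp.sub h0)
        · rename_i v t hv
          have hv : v ∈ simplicial bags p.1 := by rw [hv]; simp
          have h1 : (p.1.filter fun u => !decide (u = v)).length < p.1.length :=
            List.length_filter_lt_length_iff_exists.2 ⟨v, (mem_simplicial.1 hv).1, by simp⟩
          dsimp only
          omega
    change (Table.run bags acc (unit verts s) l _).1.length ≤ _
    simp only [List.length_cons]
    omega

open Classical in
/-- Evaluates the counters of the keys whose states at the vertices of `U` are accepted. -/
noncomputable def acceptedValue (acc : Q → Bool) (h : (ℕ → ℕ) → ℕ) (U : List ℕ)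
    (k : (ℕ → Q) × (ℕ → ℕ)) : ℕ := if ∀ v ∈ U, acc (k.1 v) = true then h k.2 else 0

/-- The number of accepted choices is invariant under the rounds of the algorithm. -/
theorem evalKeys_run (hL : 2 ≤ L) (acc : Q → Bool) (h : (ℕ → ℕ) → ℕ) (l : List ℕ)
    (hp : Inv bags verts s L F₀ p) :
    evalKeys (acceptedValue acc h (Table.run bags acc (unit verts s) l p).1)
      ((Table.run bags acc (unit verts s) l p).2.map sem).prod =
      evalKeys (acceptedValue acc h p.1) (p.2.map sem).prod := by
  induction l generalizing p with
  | nil => rfl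
  | cons a l ih =>
    refine (ih (hp.round hL acc)).trans ?_
    unfold Table.round
    split
    · rfl
    · rename_i v t hv
      have hv : v ∈ simplicial bags p.1 := by rw [hv]; simp
      have hvU := (mem_simplicial.1 hv).1
      dsimp only
      rw [evalKeys_eliminate acc _ (hp.sub.subset hvU) hp.good]
      congr 2
      funext k
      unfold acceptedValue
      by_cases ha : acc (k.1 v) = true
      · rw [if_pos ha]
        refine if_congr ⟨fun H u hu => ?_, fun H u hu => ?_⟩ rfl rfl
        · by_cases huv : u = v
          · rwa [huv]
          · simpa [clearState, huv] using H u (by simp [hu, huv])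
        · simp only [List.mem_filter, Bool.not_eq_true', decide_eq_false_iff_not] at hu
          simpa [clearState, hu.2] using H u hu.1
      · rw [if_neg ha, if_neg fun H => ha (H v hvU)]

end Table

namespace PT

open Table

variable {γ Q : Type} [Enc γ] [Enc Q] [DecidableEq Q] [EqTest Q] [AddCommMonoid Q] [Finite Q]

theorem unit {verts : γ → List ℕ} (hv : PT verts) (s : ℕ) :
    PT fun c => (Table.unit (verts c) s : Table Q) :=
  cons (((map (f := fun x : γ × ℕ => (x.2, (0 : Q))) hv (id.snd.pair (const 0))).pair
    (const ((List.range s).map fun _ => 0))).pair (const 1)) (const [])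

/-- The product of the tables that remain after the elimination of all vertices is computed in
polynomial time, if the number of states to the power of the size of each bag is polynomially
bounded. -/
theorem prod_run {bags : γ → List (List ℕ)} {verts : γ → List ℕ} {F₀ : γ → List (Table Q)}
    (hb : PT bags) (hv : PT verts) (hF : PT F₀) (acc : Q → Bool) {s L : ℕ} (hL : 2 ≤ L)
    (hInv : ∀ c, Inv (bags c) (verts c) s L (F₀ c) (verts c, F₀ c))
    (hs : ∀ c, ∀ U : List ℕ, U.Sublist (verts c) → U ≠ [] → Table.simplicial (bags c) U ≠ [])
    (hW : PolyLe fun c => ((F₀ c).map (weight L)).sum)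
    (hR : ∃ R : γ → ℕ, PolyLe R ∧ ∀ c, ∀ x ∈ bags c, Nat.card Q ^ x.toFinset.card ≤ R c) :
    PT fun c => prod (Table.unit (verts c) s)
      (run (bags c) acc (Table.unit (verts c) s) (verts c) (verts c, F₀ c)).2 := by
  classical
  have := Fintype.ofFinite Q
  obtain ⟨R, hR, hbR⟩ := hR
  obtain ⟨B, hB⟩ : ∃ B, ∀ q : Q, sz q ≤ B :=
    ⟨Finset.univ.sup fun q : Q => sz q, fun q => Finset.le_sup (f := fun q : Q => sz q)
      (Finset.mem_univ q)⟩
  let W : γ → ℕ := fun c => ((F₀ c).map (weight L)).sum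
  let D : γ → ℕ := fun c => (R c + 1) * (W c + 1) ^ s *
    (sz (verts c) + sz (verts c) * B + s * (W c + 1) + (W c * L.size + 1) + 1)
  have hD : PolyLe D :=
    ((hR.add (.const 1)).mul ((hW.add (.const 1)).pow s)).mul
      ((((hv.1.add (hv.1.mul (.const B))).add ((PolyLe.const s).mul (hW.add (.const 1)))).add
        ((hW.mul (.const _)).add (.const 1))).add (.const 1))
  -- the size of a table whose touched vertices lie in a bag
  have hszT : ∀ c (T : Table Q) (S : Finset ℕ), Good (verts c) s T → (T.map Prod.fst).Nodup →
      weight L T ≤ W c → (∀ v, T.touches v = true → v ∈ S) → Nat.card Q ^ S.card ≤ R c + 1 →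
      sz T ≤ D c := by
    intro c T S hT hN hw hS hSR
    refine (sz_table_le hB S hT hN (bdd_weight hL T) hS).trans ?_
    have := length_le_sz (verts c)
    exact Nat.mul_le_mul (Nat.mul_le_mul hSR (Nat.pow_le_pow_left (by omega) s)) (by gcongr)
  let E : γ → ℕ := fun c => sz (verts c) + (sz (F₀ c) + sz (verts c)) * (D c + 1)
  have hE : PolyLe E := hv.1.add ((hF.1.add hv.1).mul (hD.add (.const 1)))
  have hszInv : ∀ c p, Inv (bags c) (verts c) s L (F₀ c) p → sz p ≤ E c := by
    intro c p hp
    have h1 : sz p.1 ≤ sz (verts c) := sz_sublist hp.sub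
    have h2 : sz p.2 ≤ p.2.length * (D c + 1) := by
      refine sz_list_le fun T hT => ?_
      obtain ⟨x, hx, h⟩ := hp.supp T hT
      exact hszT c T x.toFinset (hp.good T hT) (hp.nodup T hT)
        ((List.le_sum_of_mem (List.mem_map_of_mem hT)).trans hp.wt)
        (fun v hv => List.mem_toFinset.2 (h v hv).1) ((hbR c x hx).trans (by omega))
    have h3 : p.2.length ≤ sz (F₀ c) + sz (verts c) := by
      have := hp.len
      have := length_le_sz (F₀ c)
      have := length_le_sz (verts c)
      omega
    rw [sz_prod]
    exact Nat.add_le_add h1 (h2.trans (Nat.mul_le_mul_right _ h3))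
  have hrun : PT fun c => run (bags c) acc (Table.unit (verts c) s) (verts c) (verts c, F₀ c) := by
    refine foldl_of_reachable
      (step := fun c p _ => Table.round (bags c) acc (Table.unit (verts c) s) p)
      hv (hv.pair hF) ⟨E, hE, fun c pre suf _ => hszInv c _ ((hInv c).run hL acc pre)⟩ ?_
    -- one round, on the states that satisfy the invariant
    let δ := {x : γ × (List ℕ × List (Table Q)) // Inv (bags x.1) (verts x.1) s L (F₀ x.1) x.2}
    have hround : PT fun x : δ =>
        Table.round (bags x.1.1) acc (Table.unit (verts x.1.1) s) x.1.2 := by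
      let l : δ → List ℕ := fun x => Table.simplicial (bags x.1.1) x.1.2.1
      have hl : PT l := simplicial (hb.comp val.fst) val.snd.fst
      refine congr (listCases_of_eq (l := l) (f := fun x => x.1.2)
        (g := fun y : δ × ℕ × List ℕ => (y.1.1.2.1.filter fun u => !decide (u = y.2.1),
          eliminate acc (Table.unit (verts y.1.1.1) s) y.2.1 y.1.1.2.2)) hl val.snd ?_) fun x => ?_
      · let ε := {y : δ × ℕ × List ℕ // l y.1 = y.2.1 :: y.2.2}
        have hδ : PT fun y : ε => y.1.1.1 := val.comp val.fst
        have hf : PT fun y : ε => y.1.1.1.2.2.filter (Table.touches y.1.2.1) :=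
          filter (f := fun z : ε × Table Q => z.2.touches z.1.1.2.1) hδ.snd.snd
            (touches (val.snd.fst.comp id.fst) id.snd)
        have hprod : PT fun y : ε => prod (Table.unit (verts y.1.1.1.1) s)
            (y.1.1.1.2.2.filter (Table.touches y.1.2.1)) := by
          refine foldl (step := fun _ => Table.mul) hf (unit (hv.comp hδ.fst) s)
            ⟨fun y => D y.1.1.1.1, hD.comp hδ.fst.1, fun y pre suf e => ?_⟩
            (tableMul id.snd.fst id.snd.snd)
          have hp := y.1.1.2
          have hsimp : y.1.2.1 ∈ Table.simplicial (bags y.1.1.1.1) y.1.1.1.2.1 := by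
            have : l y.1.1 = _ := y.2
            change y.1.2.1 ∈ l y.1.1
            rw [this]; simp
          have hpre : ∀ T ∈ pre, T ∈ y.1.1.1.2.2 ∧ T.touches y.1.2.1 = true := fun T hT =>
            List.mem_filter.1 (by rw [e]; simp [hT])
          obtain ⟨x, hx, h⟩ := hp.supp_prod hsimp hpre
          refine hszT _ _ x.toFinset (good_prod fun T hT => hp.good T (hpre T hT).1)
            (nodup_prod _) ?_ (fun v hv => List.mem_toFinset.2 (h v hv).1)
            ((hbR _ x hx).trans (by omega))
          refine (weight_prod_le hL pre).trans (le_trans ?_ hp.wt)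
          refine List.Sublist.sum_le_sum (List.Sublist.map _ ?_) (by simp)
          exact (List.Sublist.trans (by rw [e]; simp) List.filter_sublist)
        refine (filter (f := fun z : ε × ℕ => !decide (z.2 = z.1.1.2.1)) hδ.snd.fst
          (eq id.snd (val.snd.fst.comp id.fst)).not).pair ?_
        exact cons (sumOut acc val.snd.fst hprod)
          (filter (f := fun z : ε × Table Q => !z.2.touches z.1.1.2.1) hδ.snd.snd
            (touches (val.snd.fst.comp id.fst) id.snd).not)
      · unfold Table.round
        split <;> rename_i h <;> simp only [l, h]
    have hreach : ∀ x : {x : γ × (List ℕ × List (Table Q)) × ℕ // ∃ pre suf,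
        verts x.1 = pre ++ x.2.2 :: suf ∧ x.2.1 = pre.foldl (fun p _ =>
          Table.round (bags x.1) acc (Table.unit (verts x.1) s) p) (verts x.1, F₀ x.1)},
        Inv (bags x.1.1) (verts x.1.1) s L (F₀ x.1.1) x.1.2.1 := by
      rintro ⟨⟨c, p, a⟩, pre, suf, -, h⟩
      dsimp only at h ⊢
      rw [h]
      exact (hInv c).run hL acc pre
    exact hround.comp (subtype_mk (val.fst.pair val.snd.fst) hreach)
  refine foldl (step := fun _ => Table.mul) hrun.snd (unit hv s)
    ⟨D, hD, fun c pre suf e => ?_⟩ (tableMul id.snd.fst id.snd.snd)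
  have hp := (hInv c).run hL acc (verts c)
  have hlen := length_run (hs c) hL acc (verts c) (hInv c)
  have hnil : (run (bags c) acc (Table.unit (verts c) s) (verts c) (verts c, F₀ c)).1 = [] :=
    List.length_eq_zero_iff.1 (by simpa using hlen)
  have hpre : ∀ T ∈ pre, T ∈ (run (bags c) acc (Table.unit (verts c) s) (verts c)
      (verts c, F₀ c)).2 := fun T hT => by rw [e]; simp [hT]
  refine hszT c _ ∅ (good_prod fun T hT => hp.good T (hpre T hT)) (nodup_prod _) ?_ ?_ (by simp)
  · refine (weight_prod_le hL pre).trans (le_trans ?_ hp.wt)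
    exact List.Sublist.sum_le_sum (List.Sublist.map _ (by rw [e]; simp)) (by simp)
  · intro v hv
    obtain ⟨T, hT, hTv⟩ := touches_prod (fun T hT => hp.good T (hpre T hT)) hv
    obtain ⟨x, -, h⟩ := hp.supp T (hpre T hT)
    simpa [hnil] using (h v hTv).2

end PT

/-! ### Simplicial vertices in tree decompositions -/

/-- For every nonempty set `U` of vertices there is a vertex `v ∈ U` and a bag that contains all
vertices of `U` occurring together with `v` in a bag. By induction on the tree, removing a leaf:
either some vertex of `U` occurs in the bag of the leaf only, or the trace on `U` of this bag is
contained in the bag of the neighbour. -/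
theorem SimpleGraph.IsTree.exists_simplicial {α : Type*} (n : ℕ) : ∀ (V : Type) [Fintype V]
    (T : SimpleGraph V) (_ : T.IsTree) (bag : V → Set α)
    (_ : ∀ v x y z (w : T.Walk x y), w.IsPath → z ∈ w.support → v ∈ bag x → v ∈ bag y → v ∈ bag z)
    (U : Set α) (_ : U.Nonempty) (_ : ∀ v ∈ U, ∃ x, v ∈ bag x) (_ : Fintype.card V = n),
    ∃ v ∈ U, ∃ x, ∀ y, v ∈ bag y → ∀ u ∈ bag y, u ∈ U → u ∈ bag x := by
  classical
  induction n with
  | zero =>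
    intro V _ T hT bag _ U _ _ hn
    have := hT.1.nonempty
    exact absurd hn Fintype.card_ne_zero
  | succ n ih =>
    intro V _ T hT bag hpath U hU hcov hn
    rcases subsingleton_or_nontrivial V with hV | hV
    · obtain ⟨v, hv⟩ := hU
      obtain ⟨x, hx⟩ := hcov v hv
      exact ⟨v, hv, x, fun y _ u hu _ => Subsingleton.elim y x ▸ hu⟩
    · obtain ⟨x, hx⟩ := hT.exists_vert_degree_one_of_nontrivial
      obtain ⟨y, hxy, hy⟩ := SimpleGraph.degree_eq_one_iff_existsUnique_adj.1 hx
      have hyx : y ≠ x := hxy.ne'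
      have hsep : ∀ v z, z ≠ x → v ∈ bag x → v ∈ bag z → v ∈ bag y := by
        intro v z hz hvx hvz
        obtain ⟨w, hw⟩ := (hT.1.preconnected x z).exists_isPath
        refine hpath v x z y w hw ?_ hvx hvz
        cases w with
        | nil => exact absurd rfl hz
        | cons h p =>
          have := hy _ h
          subst this
          simp
      by_cases hex : ∃ v ∈ U, v ∈ bag x ∧ v ∉ bag y
      · obtain ⟨v, hv, hvx, hvy⟩ := hex
        refine ⟨v, hv, x, fun z hz u hu _ => ?_⟩
        by_cases hzx : z = x
        · exact hzx ▸ hu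
        · exact absurd (hsep v z hzx hvx hz) hvy
      · push Not at hex
        have hT' : (T.induce {x}ᶜ).IsTree :=
          ⟨hT.1.induce_compl_singleton_of_degree_eq_one hx, hT.2.induce _⟩
        obtain ⟨v, hv, x', hx'⟩ := ih _ (T.induce {x}ᶜ) hT' (fun z => bag z.1) (by
            intro v a b c w hw hc hva hvb
            refine hpath v a.1 b.1 c.1 (w.map (SimpleGraph.Embedding.induce _).toHom) ?_ ?_ hva hvb
            · exact SimpleGraph.Walk.IsPath.map (f := (SimpleGraph.Embedding.induce _).toHom)
                Subtype.val_injective hw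
            · exact (SimpleGraph.Walk.support_map (SimpleGraph.Embedding.induce _).toHom w).symm ▸
                List.mem_map_of_mem (f := (SimpleGraph.Embedding.induce _).toHom) hc)
          U hU (by
            intro v hv
            obtain ⟨z, hz⟩ := hcov v hv
            by_cases hzx : z = x
            · exact ⟨⟨y, hyx⟩, hex v hv (hzx ▸ hz)⟩
            · exact ⟨⟨z, hzx⟩, hz⟩) (by
            rw [Fintype.card_compl_set, hn]; simp)
        refine ⟨v, hv, x'.1, fun z hz u hu huU => ?_⟩
        by_cases hzx : z = x
        · subst hzx
          exact hx' ⟨y, hyx⟩ (hex v hv hz) u (hex u huU hu) huU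
        · exact hx' ⟨z, hzx⟩ hz u hu huU

/-! ### Local verification of formulas of counting modal logic -/

/-- What a formula sees of the edge through which a vertex has been accessed: the edge sets
containing it, and whether it is directed towards and away from the vertex. -/
abbrev EdgeView (κ : Type) := (κ → Bool) × Bool × Bool

/-- The view of the edge `e` from the vertex `v`. -/
noncomputable def FinGraph.view {dir : Bool} {κ : Type} (G : FinGraph dir)
    (Y : κ → Finset (Fin G.m)) (e : Fin G.m) (v : Fin G.n) : EdgeView κ :=
  (fun j => decide (e ∈ Y j), decide ((G.ends e).2 = v), decide ((G.ends e).1 = v))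

open Classical in
/-- The edges incident with `v`. -/
noncomputable def FinGraph.incident {dir : Bool} (G : FinGraph dir) (v : Fin G.n) :
    Finset (Fin G.m) := Finset.univ.filter fun e => G.Inc e v

/-- The sets containing `v`. -/
def memBits {ι : Type} {n : ℕ} (X : ι → Finset (Fin n)) (v : Fin n) : ι → Bool :=
  fun i => decide (v ∈ X i)

/-- A finite-state device that verifies a formula locally. Each vertex guesses an element of `Guess`
(the truth values of the modal subformulas), and sends the elements `contrib` of a finite
commutative monoid to its neighbours; a vertex adds up what it receives, and `check` compares the
sum with its guess. Then `eval` is the truth value of the formula. -/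
structure Verifier (ι κ : Type) where
  Guess : Type
  Count : Type
  finite_guess : Finite Guess
  addCommMonoid : AddCommMonoid Count
  finite_count : Finite Count
  eval : (ι → Bool) → Guess → Option (EdgeView κ) → Prop
  contrib : (ι → Bool) → Guess → EdgeView κ → Count
  check : Guess → Count → Prop

attribute [instance] Verifier.finite_guess Verifier.addCommMonoid Verifier.finite_count

namespace Verifier

variable {ι κ : Type}

/-- All checks succeed for the guesses `g`. -/
def Valid (Γ : Verifier ι κ) {dir : Bool} (G : FinGraph dir) (X : ι → Finset (Fin G.n))
    (Y : κ → Finset (Fin G.m)) (g : Fin G.n → Γ.Guess) : Prop :=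
  ∀ v, Γ.check (g v) (∑ e ∈ G.incident v,
    Γ.contrib (memBits X (G.other e v)) (g (G.other e v)) (G.view Y e (G.other e v)))

/-- There is exactly one valid guess, and `eval` yields the truth of `ψ` for it. -/
def Verifies (Γ : Verifier ι κ) (ψ : CMLFormula ι κ) : Prop :=
  ∀ {dir : Bool} (G : FinGraph dir) (X : ι → Finset (Fin G.n)) (Y : κ → Finset (Fin G.m)),
    ∃ g, Γ.Valid G X Y g ∧ (∀ g', Γ.Valid G X Y g' → g' = g) ∧
      ∀ v o, Γ.eval (memBits X v) (g v) (o.map fun e => G.view Y e v) ↔ ψ.Sat G X Y v o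

/-- The verifier of an atomic formula. -/
def atom (ev : (ι → Bool) → Option (EdgeView κ) → Prop) : Verifier ι κ where
  Guess := Unit
  Count := Unit
  finite_guess := inferInstance
  addCommMonoid := inferInstance
  finite_count := inferInstance
  eval := fun x _ o => ev x o
  contrib := fun _ _ _ => ()
  check := fun _ _ => True

theorem atom_verifies {ev : (ι → Bool) → Option (EdgeView κ) → Prop} {ψ : CMLFormula ι κ}
    (h : ∀ {dir : Bool} (G : FinGraph dir) (X : ι → Finset (Fin G.n)) (Y : κ → Finset (Fin G.m)) v o,
      ev (memBits X v) (o.map fun e => G.view Y e v) ↔ ψ.Sat G X Y v o) :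
    (atom ev).Verifies ψ :=
  fun G X Y => ⟨fun _ => (), fun _ => trivial, fun _ _ => rfl, h G X Y⟩

/-- The verifier of the negation of a formula. -/
def neg (Γ : Verifier ι κ) : Verifier ι κ := { Γ with eval := fun x g o => ¬ Γ.eval x g o }

theorem neg_verifies {Γ : Verifier ι κ} {ψ : CMLFormula ι κ} (h : Γ.Verifies ψ) :
    Γ.neg.Verifies ψ.neg := by
  intro dir G X Y
  obtain ⟨g, h1, h2, h3⟩ := h G X Y
  exact ⟨g, h1, h2, fun v o => not_congr (h3 v o)⟩

/-- The verifier of a combination of two formulas by a connective. -/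
def binary (c : Prop → Prop → Prop) (Γ Δ : Verifier ι κ) : Verifier ι κ where
  Guess := Γ.Guess × Δ.Guess
  Count := Γ.Count × Δ.Count
  finite_guess := inferInstance
  addCommMonoid := inferInstance
  finite_count := inferInstance
  eval := fun x g o => c (Γ.eval x g.1 o) (Δ.eval x g.2 o)
  contrib := fun x g i => (Γ.contrib x g.1 i, Δ.contrib x g.2 i)
  check := fun g s => Γ.check g.1 s.1 ∧ Δ.check g.2 s.2

theorem binary_valid {c : Prop → Prop → Prop} {Γ Δ : Verifier ι κ} {dir : Bool} (G : FinGraph dir)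
    (X : ι → Finset (Fin G.n)) (Y : κ → Finset (Fin G.m)) (g : Fin G.n → Γ.Guess × Δ.Guess) :
    (binary c Γ Δ).Valid G X Y g ↔
      Γ.Valid G X Y (fun v => (g v).1) ∧ Δ.Valid G X Y (fun v => (g v).2) := by
  unfold Valid
  rw [← forall_and]
  refine forall_congr' fun v => ?_
  refine and_congr (iff_of_eq ?_) (iff_of_eq ?_)
  · exact congrArg (Γ.check (g v).1) Prod.fst_sum
  · exact congrArg (Δ.check (g v).2) Prod.snd_sum

theorem binary_verifies {c : Prop → Prop → Prop} {Γ Δ : Verifier ι κ} {ψ χ θ : CMLFormula ι κ}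
    (hΓ : Γ.Verifies ψ) (hΔ : Δ.Verifies χ)
    (h : ∀ {dir : Bool} (G : FinGraph dir) (X : ι → Finset (Fin G.n)) (Y : κ → Finset (Fin G.m)) v o,
      c (ψ.Sat G X Y v o) (χ.Sat G X Y v o) ↔ θ.Sat G X Y v o) :
    (binary c Γ Δ).Verifies θ := by
  intro dir G X Y
  obtain ⟨g, h1, h2, h3⟩ := hΓ G X Y
  obtain ⟨g', h1', h2', h3'⟩ := hΔ G X Y
  refine ⟨fun v => (g v, g' v), (binary_valid G X Y _).2 ⟨h1, h1'⟩, fun k hk => ?_, fun v o => ?_⟩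
  · have := (binary_valid G X Y k).1 hk
    funext v
    exact Prod.ext (congrFun (h2 _ this.1) v) (congrFun (h2' _ this.2) v)
  · rw [← h G X Y v o, ← h3 v o, ← h3' v o]
    rfl

open Classical in
/-- The verifier of a formula `◇^S ψ`: one more truth value is guessed, and the edges leading to
vertices where `ψ` is true are counted in the monoid that recognizes `S`. -/
noncomputable def dia {M : Type} [AddCommMonoid M] [Finite M] (α : ℕ →+ M) (F : Set M)
    (Γ : Verifier ι κ) : Verifier ι κ where
  Guess := Γ.Guess × Bool
  Count := Γ.Count × M
  finite_guess := inferInstance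
  addCommMonoid := inferInstance
  finite_count := inferInstance
  eval := fun _ g _ => g.2 = true
  contrib := fun x g i => (Γ.contrib x g.1 i, if Γ.eval x g.1 (some i) then α 1 else 0)
  check := fun g s => Γ.check g.1 s.1 ∧ (g.2 = true ↔ s.2 ∈ F)

open Classical in
theorem dia_valid {M : Type} [AddCommMonoid M] [Finite M] {α : ℕ →+ M} {F : Set M}
    {Γ : Verifier ι κ} {dir : Bool} (G : FinGraph dir) (X : ι → Finset (Fin G.n))
    (Y : κ → Finset (Fin G.m)) (g : Fin G.n → Γ.Guess × Bool) :
    (dia α F Γ).Valid G X Y g ↔ Γ.Valid G X Y (fun v => (g v).1) ∧ ∀ v, ((g v).2 = true ↔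
      α {e | G.Inc e v ∧ Γ.eval (memBits X (G.other e v)) (g (G.other e v)).1
        (some (G.view Y e (G.other e v)))}.ncard ∈ F) := by
  unfold Valid
  rw [← forall_and]
  refine forall_congr' fun v => ?_
  refine and_congr (iff_of_eq ?_) (iff_congr Iff.rfl (iff_of_eq ?_))
  · exact congrArg (Γ.check (g v).1) Prod.fst_sum
  · refine congrArg (· ∈ F) (Prod.snd_sum.trans ?_)
    dsimp only [dia]
    rw [← Finset.sum_filter, Finset.sum_const, ← map_nsmul, smul_eq_mul, mul_one,
      FinGraph.incident, Finset.filter_filter, ← Set.ncard_coe_finset]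
    simp

theorem dia_verifies {M : Type} [AddCommMonoid M] [Finite M] (α : ℕ →+ M) (F : Set M)
    {Γ : Verifier ι κ} {ψ : CMLFormula ι κ} (h : Γ.Verifies ψ)
    {S : Set ℕ} (hS : FinitelyRecognizable S) (hSF : S = α ⁻¹' F) :
    (dia α F Γ).Verifies (.dia S hS ψ) := by
  classical
  intro dir G X Y
  obtain ⟨g, h1, h2, h3⟩ := h G X Y
  have key : ∀ v o, (α {e | G.Inc e v ∧ Γ.eval (memBits X (G.other e v)) (g (G.other e v))
      (some (G.view Y e (G.other e v)))}.ncard ∈ F) ↔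
      (CMLFormula.dia S hS ψ).Sat G X Y v o := by
    intro v o
    have : {e | G.Inc e v ∧ Γ.eval (memBits X (G.other e v)) (g (G.other e v))
        (some (G.view Y e (G.other e v)))} =
        {e | G.Inc e v ∧ ψ.Sat G X Y (G.other e v) (some e)} := by
      ext e
      exact and_congr_right fun _ => h3 (G.other e v) (some e)
    rw [this, CMLFormula.Sat, hSF, Set.mem_preimage]
  refine ⟨fun v => (g v, decide ((CMLFormula.dia S hS ψ).Sat G X Y v none)),
    (dia_valid G X Y _).2 ⟨h1, fun v => ?_⟩, fun k hk => ?_, fun v o => ?_⟩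
  · rw [decide_eq_true_iff]
    exact (key v none).symm
  · obtain ⟨hk1, hk2⟩ := (dia_valid G X Y k).1 hk
    have hg : ∀ v, (k v).1 = g v := congrFun (h2 _ hk1)
    funext v
    refine Prod.ext (hg v) ?_
    have := hk2 v
    simp only [hg] at this
    rw [Bool.eq_iff_iff, this, key v none, decide_eq_true_iff]
  · change decide _ = true ↔ _
    rw [decide_eq_true_iff, ← key v none, key v o]

end Verifier

/-- A recognizing monoid may be taken commutative: the quotient of `ℕ` by the kernel. -/
theorem FinitelyRecognizable.exists_addCommMonoid {S : Set ℕ} (hS : FinitelyRecognizable S) :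
    ∃ (M : Type) (_ : AddCommMonoid M) (_ : Finite M) (α : ℕ →+ M) (F : Set M), S = α ⁻¹' F := by
  obtain ⟨M, _, _, α, F, rfl⟩ := hS
  refine ⟨(AddCon.ker α).Quotient, inferInstance,
    Finite.of_injective (AddCon.kerLift α) (AddCon.kerLift_injective α), (AddCon.ker α).mk',
    AddCon.kerLift α ⁻¹' F, ?_⟩
  ext n
  rfl

/-- Every formula of counting modal logic can be verified locally. -/
theorem CMLFormula.exists_verifies {ι κ : Type} (ψ : CMLFormula ι κ) :
    ∃ Γ : Verifier ι κ, Γ.Verifies ψ := by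
  induction ψ with
  | neg ψ ih =>
    obtain ⟨Γ, h⟩ := ih
    exact ⟨_, Verifier.neg_verifies h⟩
  | and ψ χ ih ih' =>
    obtain ⟨Γ, h⟩ := ih
    obtain ⟨Δ, h'⟩ := ih'
    exact ⟨_, Verifier.binary_verifies (c := fun p q => p ∧ q) h h' fun _ _ _ _ _ => Iff.rfl⟩
  | or ψ χ ih ih' =>
    obtain ⟨Γ, h⟩ := ih
    obtain ⟨Δ, h'⟩ := ih'
    exact ⟨_, Verifier.binary_verifies (c := fun p q => p ∨ q) h h' fun _ _ _ _ _ => Iff.rfl⟩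
  | imp ψ χ ih ih' =>
    obtain ⟨Γ, h⟩ := ih
    obtain ⟨Δ, h'⟩ := ih'
    exact ⟨_, Verifier.binary_verifies (c := fun p q => p → q) h h' fun _ _ _ _ _ => Iff.rfl⟩
  | iff ψ χ ih ih' =>
    obtain ⟨Γ, h⟩ := ih
    obtain ⟨Δ, h'⟩ := ih'
    exact ⟨_, Verifier.binary_verifies (c := fun p q => p ↔ q) h h' fun _ _ _ _ _ => Iff.rfl⟩
  | inX i =>
    exact ⟨_, Verifier.atom_verifies (ev := fun x _ => x i = true) fun G X Y v o => by
      simp [memBits, CMLFormula.Sat]⟩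
  | inY j =>
    exact ⟨_, Verifier.atom_verifies (ev := fun _ o => ∃ i, o = some i ∧ i.1 j = true)
      fun G X Y v o => by cases o <;> simp [FinGraph.view, CMLFormula.Sat]⟩
  | arcIn =>
    exact ⟨_, Verifier.atom_verifies (ev := fun _ o => ∃ i, o = some i ∧ i.2.1 = true)
      fun G X Y v o => by cases o <;> simp [FinGraph.view, CMLFormula.Sat]⟩
  | arcOut =>
    exact ⟨_, Verifier.atom_verifies (ev := fun _ o => ∃ i, o = some i ∧ i.2.2 = true)
      fun G X Y v o => by cases o <;> simp [FinGraph.view, CMLFormula.Sat]⟩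
  | dia S hS ψ ih =>
    obtain ⟨Γ, h⟩ := ih
    obtain ⟨M, _, _, α, F, hSF⟩ := hS.exists_addCommMonoid
    exact ⟨_, Verifier.dia_verifies α F h hS hSF⟩
  | box S hS ψ ih =>
    obtain ⟨Γ, h⟩ := ih
    obtain ⟨M, _, _, α, F, hSF⟩ := hS.exists_addCommMonoid
    exact ⟨_, Verifier.neg_verifies (Verifier.dia_verifies α F (Verifier.neg_verifies h) hS hSF)⟩

/-! ### Solutions as locally consistent choices -/

/-- Names of the numbers occurring in arithmetic formulas: `none` stands for the number of vertices
or of edges, `some i` for the cardinality of a vertex or edge set. -/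
abbrev Counter (a b p q : ℕ) := Option (Fin a ⊕ Fin p) ⊕ Option (Fin b ⊕ Fin q)

/-- The value of an arithmetic term for given parameters and counters. -/
def ArithTerm.evalAt {a b r p q : ℕ} (k : Fin r → ℤ) (t : Counter a b p q → ℕ) :
    ArithTerm a b r p q → ℤ
  | const z => z
  | param i => k i
  | numV => t (.inl none)
  | numE => t (.inr none)
  | cardFX i => t (.inl (some (.inl i)))
  | cardFY j => t (.inr (some (.inl j)))
  | cardX i => t (.inl (some (.inr i)))
  | cardY j => t (.inr (some (.inr j)))
  | add s u => s.evalAt k t + u.evalAt k t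
  | sub s u => s.evalAt k t - u.evalAt k t
  | mul s u => s.evalAt k t * u.evalAt k t

/-- The truth of an arithmetic formula for given parameters and counters. -/
def ArithFormula.HoldsAt {a b r p q : ℕ} (k : Fin r → ℤ) (t : Counter a b p q → ℕ) :
    ArithFormula a b r p q → Prop
  | eq s u => s.evalAt k t = u.evalAt k t
  | le s u => s.evalAt k t ≤ u.evalAt k t
  | lt s u => s.evalAt k t < u.evalAt k t
  | neg f => ¬ f.HoldsAt k t
  | and f g => f.HoldsAt k t ∧ g.HoldsAt k t
  | or f g => f.HoldsAt k t ∨ g.HoldsAt k t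
  | imp f g => f.HoldsAt k t → g.HoldsAt k t
  | iff f g => f.HoldsAt k t ↔ g.HoldsAt k t

section Counters

variable {dir : Bool} {a b r p q : ℕ}

/-- The values of the counters for given sets. -/
def ECMLInstance.counters (I : ECMLInstance dir a b r) (X : Fin p → Finset (Fin I.G.n))
    (Y : Fin q → Finset (Fin I.G.m)) : Counter a b p q → ℕ
  | .inl none => I.G.n
  | .inl (some i) => (Sum.elim I.FX X i).card
  | .inr none => I.G.m
  | .inr (some j) => (Sum.elim I.FY Y j).card

theorem ArithTerm.evalAt_counters (I : ECMLInstance dir a b r) (X : Fin p → Finset (Fin I.G.n))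
    (Y : Fin q → Finset (Fin I.G.m)) (t : ArithTerm a b r p q) :
    t.evalAt I.k (I.counters X Y) = t.eval I X Y := by
  induction t with
  | add s u hs hu | sub s u hs hu | mul s u hs hu => simp only [evalAt, eval, hs, hu]
  | _ => rfl

theorem ArithFormula.holdsAt_counters (I : ECMLInstance dir a b r) (X : Fin p → Finset (Fin I.G.n))
    (Y : Fin q → Finset (Fin I.G.m)) (f : ArithFormula a b r p q) :
    f.HoldsAt I.k (I.counters X Y) ↔ f.Holds I X Y := by
  induction f with
  | eq s t | le s t | lt s t => simp only [HoldsAt, Holds, ArithTerm.evalAt_counters]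
  | neg f hf => simp only [HoldsAt, Holds, hf]
  | and f g hf hg | or f g hf hg | imp f g hf hg | iff f g hf hg =>
    simp only [HoldsAt, Holds, hf, hg]

end Counters

namespace Verifier

open SetSemiring Set

variable {a b p q : ℕ} (Γ : Verifier (Fin a ⊕ Fin p) (Fin b ⊕ Fin q))

/-- The vertex sets containing a vertex, and its guess. -/
abbrev Label := ((Fin a ⊕ Fin p) → Bool) × Γ.Guess

/-- The labels of the two endpoints of an edge, and the edge sets containing it. -/
abbrev EdgeLabel := Γ.Label × Γ.Label × ((Fin b ⊕ Fin q) → Bool)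

/-- States of a vertex: the set of all labels attributed to it by itself and by its edges, and the
sum of the contributions of its neighbours. -/
abbrev State := SetSemiring Γ.Label × Γ.Count

/-- The state contributed by a vertex that chooses a label. -/
def vertexState (l : Γ.Label) : Γ.State := (Set.up {l}, 0)

/-- The state contributed by an edge to its first endpoint. -/
def fstState (c : Γ.EdgeLabel) : Γ.State :=
  (Set.up {c.1}, Γ.contrib c.2.1.1 c.2.1.2 (c.2.2, true, false))

/-- The state contributed by an edge to its second endpoint. -/
def sndState (c : Γ.EdgeLabel) : Γ.State :=
  (Set.up {c.2.1}, Γ.contrib c.1.1 c.1.2 (c.2.2, false, true))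

/-- A state is accepted if a single label is attributed to the vertex, and this label passes the
check and makes the formula true. -/
def Accepts (s : Γ.State) : Prop :=
  ∃ l : Γ.Label, s.1 = Set.up {l} ∧ Γ.check l.2 s.2 ∧ Γ.eval l.1 l.2 none

/-- What the label of a vertex adds to the counters. -/
def vertexCount (l : Γ.Label) : Counter a b p q → ℕ
  | .inl none => 1
  | .inl (some i) => (l.1 i).toNat
  | .inr _ => 0

/-- What the label of an edge adds to the counters. -/
def edgeCount (c : Γ.EdgeLabel) : Counter a b p q → ℕ
  | .inl _ => 0
  | .inr none => 1
  | .inr (some j) => (c.2.2 j).toNat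

variable {Γ} {dir : Bool} {r : ℕ}

theorem mem_sum_down {α ι : Type*} (s : Finset ι) (f : ι → SetSemiring α) (x : α) :
    x ∈ SetSemiring.down (∑ i ∈ s, f i) ↔ ∃ i ∈ s, x ∈ SetSemiring.down (f i) := by
  classical
  induction s using Finset.induction_on with
  | empty => simp
  | insert i s hi ih =>
    rw [Finset.sum_insert hi, SetSemiring.down_add, Set.mem_union, ih]
    simp

/-- The total state of a vertex. -/
noncomputable def totalState (Γ : Verifier (Fin a ⊕ Fin p) (Fin b ⊕ Fin q)) (G : FinGraph dir)
    (lv : Fin G.n → Γ.Label) (le : Fin G.m → Γ.EdgeLabel) (v : Fin G.n) : Γ.State :=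
  (∑ u, if v = u then Γ.vertexState (lv u) else 0) +
    ∑ e, if v = (G.ends e).1 then Γ.fstState (le e) else
      if v = (G.ends e).2 then Γ.sndState (le e) else 0

theorem mem_totalState (G : FinGraph dir) (lv : Fin G.n → Γ.Label) (le : Fin G.m → Γ.EdgeLabel)
    (v : Fin G.n) (l : Γ.Label) :
    l ∈ SetSemiring.down (totalState Γ G lv le v).1 ↔ l = lv v ∨
      ∃ e, (v = (G.ends e).1 ∧ l = (le e).1) ∨ (v = (G.ends e).2 ∧ l = (le e).2.1) := by
  rw [totalState, Finset.sum_ite_eq, if_pos (Finset.mem_univ _), Prod.fst_add, SetSemiring.down_add,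
    Set.mem_union, Prod.fst_sum, mem_sum_down]
  refine or_congr (by simp [vertexState]) (exists_congr fun e => ?_)
  have := G.loopless e
  by_cases h1 : v = (G.ends e).1
  · have h2 : v ≠ (G.ends e).2 := fun h => this (h1.symm.trans h)
    simp [← h1, h2, fstState]
  · by_cases h2 : v = (G.ends e).2
    · simp [h1, ← h2, sndState]
    · simp [h1, h2]

/-- The edge labels determined by the labels of the vertices and the edge sets. -/
def edgeLabels (G : FinGraph dir) (lv : Fin G.n → Γ.Label) (y : Fin G.m → (Fin b ⊕ Fin q) → Bool)
    (e : Fin G.m) : Γ.EdgeLabel := (lv (G.ends e).1, lv (G.ends e).2, y e)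

theorem totalState_edgeLabels (G : FinGraph dir) (lv : Fin G.n → Γ.Label)
    (Y : (Fin b ⊕ Fin q) → Finset (Fin G.m)) (v : Fin G.n) :
    totalState Γ G lv (edgeLabels G lv fun e j => decide (e ∈ Y j)) v =
      (Set.up {lv v}, ∑ e ∈ G.incident v, Γ.contrib (lv (G.other e v)).1 (lv (G.other e v)).2
        (G.view Y e (G.other e v))) := by
  refine Prod.ext ?_ ?_
  · refine SetSemiring.down.injective (Set.ext fun l => ?_)
    rw [mem_totalState]
    simp only [edgeLabels, SetSemiring.down_up, Set.mem_singleton_iff]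
    constructor
    · rintro (h | ⟨e, ⟨rfl, h⟩ | ⟨rfl, h⟩⟩) <;> exact h
    · exact Or.inl
  · rw [totalState, Finset.sum_ite_eq, if_pos (Finset.mem_univ _), Prod.snd_add, Prod.snd_sum,
      FinGraph.incident, Finset.sum_filter]
    refine (zero_add _).trans (Finset.sum_congr rfl fun e _ => ?_)
    have hl := G.loopless e
    unfold FinGraph.Inc FinGraph.other FinGraph.view
    by_cases h1 : v = (G.ends e).1
    · subst h1
      simp [fstState, edgeLabels, hl]
    · by_cases h2 : v = (G.ends e).2
      · subst h2
        simp [sndState, edgeLabels, hl, Ne.symm hl]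
      · simp [h1, h2, Ne.symm h1, Ne.symm h2]

/-- In an accepted choice, the labels that the edges attribute to their endpoints are those chosen by
the endpoints. -/
theorem eq_of_accepts {G : FinGraph dir} {lv : Fin G.n → Γ.Label} {le : Fin G.m → Γ.EdgeLabel}
    (h : ∀ v, Γ.Accepts (totalState Γ G lv le v)) :
    le = edgeLabels G lv fun e => (le e).2.2 := by
  have key : ∀ v l, l ∈ SetSemiring.down (totalState Γ G lv le v).1 → l = lv v := by
    intro v l hl
    obtain ⟨l', h', -⟩ := h v
    have h0 := (mem_totalState G lv le v (lv v)).2 (Or.inl rfl)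
    rw [h', SetSemiring.down_up, Set.mem_singleton_iff] at h0 hl
    rw [hl, h0]
  funext e
  refine Prod.ext ?_ (Prod.ext ?_ rfl)
  · exact key _ _ ((mem_totalState G lv le _ _).2 (Or.inr ⟨e, Or.inl ⟨rfl, rfl⟩⟩))
  · exact key _ _ ((mem_totalState G lv le _ _).2 (Or.inr ⟨e, Or.inr ⟨rfl, rfl⟩⟩))

theorem accepts_singleton (l : Γ.Label) (s : Γ.Count) :
    Γ.Accepts (Set.up {l}, s) ↔ Γ.check l.2 s ∧ Γ.eval l.1 l.2 none := by
  constructor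
  · rintro ⟨l', h, h'⟩
    have h0 : ({l} : Set Γ.Label) = {l'} := Set.up.injective h
    rw [Set.singleton_eq_singleton_iff] at h0
    exact h0 ▸ h'
  · exact fun h => ⟨l, rfl, h⟩

/-- The labels respect the fixed sets. -/
def Fits (Γ : Verifier (Fin a ⊕ Fin p) (Fin b ⊕ Fin q)) (I : ECMLInstance dir a b r)
    (c : (Fin I.G.n → Γ.Label) × (Fin I.G.m → Γ.EdgeLabel)) : Prop :=
  (∀ v i, (c.1 v).1 (.inl i) = decide (v ∈ I.FX i)) ∧
    ∀ e j, (c.2 e).2.2 (.inl j) = decide (e ∈ I.FY j)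

/-- The total values of the counters. -/
def totalCount (Γ : Verifier (Fin a ⊕ Fin p) (Fin b ⊕ Fin q)) (G : FinGraph dir)
    (c : (Fin G.n → Γ.Label) × (Fin G.m → Γ.EdgeLabel)) (i : Counter a b p q) : ℕ :=
  ∑ v, Γ.vertexCount (c.1 v) i + ∑ e, Γ.edgeCount (c.2 e) i

theorem sum_toNat_decide_mem {n : ℕ} (s : Finset (Fin n)) :
    ∑ v, (decide (v ∈ s)).toNat = s.card := by
  have : ∀ v, (decide (v ∈ s)).toNat = if v ∈ s then 1 else 0 := fun v => by
    by_cases h : v ∈ s <;> simp [h]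
  simp [this]

theorem totalCount_eq_counters {I : ECMLInstance dir a b r}
    {c : (Fin I.G.n → Γ.Label) × (Fin I.G.m → Γ.EdgeLabel)}
    {X : Fin p → Finset (Fin I.G.n)} {Y : Fin q → Finset (Fin I.G.m)}
    (hX : ∀ v, (c.1 v).1 = memBits (Sum.elim I.FX X) v)
    (hY : ∀ e, (c.2 e).2.2 = fun j => decide (e ∈ Sum.elim I.FY Y j)) :
    totalCount Γ I.G c = I.counters X Y := by
  funext i
  rcases i with (_ | i) | (_ | j)
  · simp [totalCount, vertexCount, edgeCount, ECMLInstance.counters]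
  · simp only [totalCount, vertexCount, edgeCount, ECMLInstance.counters, hX, memBits,
      Finset.sum_const_zero, add_zero]
    exact sum_toNat_decide_mem _
  · simp [totalCount, vertexCount, edgeCount, ECMLInstance.counters]
  · simp only [totalCount, vertexCount, edgeCount, ECMLInstance.counters, hY,
      Finset.sum_const_zero, zero_add]
    exact sum_toNat_decide_mem _

/-- The solutions correspond to the choices of labels that fit the fixed sets, are accepted at each
vertex and satisfy the arithmetic formula. -/
theorem numSolutions_eq {φ : ECMLFormula dir a b r p q} (hΓ : Γ.Verifies φ.modal)
    (I : ECMLInstance dir a b r) :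
    φ.numSolutions I = {c : (Fin I.G.n → Γ.Label) × (Fin I.G.m → Γ.EdgeLabel) |
      Fits Γ I c ∧ (∀ v, Γ.Accepts (totalState Γ I.G c.1 c.2 v)) ∧
        φ.arith.HoldsAt I.k (totalCount Γ I.G c)}.ncard := by
  choose g hg1 hg2 hg3 using fun (X : Fin p → Finset (Fin I.G.n)) (Y : Fin q → Finset (Fin I.G.m)) =>
    hΓ I.G (Sum.elim I.FX X) (Sum.elim I.FY Y)
  let lab : (Fin p → Finset (Fin I.G.n)) → (Fin q → Finset (Fin I.G.m)) → Fin I.G.n → Γ.Label :=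
    fun X Y v => (memBits (Sum.elim I.FX X) v, g X Y v)
  have hst : ∀ X Y v, totalState Γ I.G (lab X Y)
      (edgeLabels I.G (lab X Y) fun e j => decide (e ∈ Sum.elim I.FY Y j)) v = _ :=
    fun X Y v => totalState_edgeLabels I.G (lab X Y) (Sum.elim I.FY Y) v
  refine Set.ncard_congr (fun S _ => (lab S.1 S.2,
    edgeLabels I.G (lab S.1 S.2) fun e j => decide (e ∈ Sum.elim I.FY S.2 j))) ?_ ?_ ?_
  · rintro ⟨X, Y⟩ ⟨h1, h2⟩
    dsimp only at h1 h2 ⊢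
    refine ⟨⟨fun v i => rfl, fun e j => rfl⟩, fun v => ?_, ?_⟩
    · dsimp only
      rw [hst, accepts_singleton]
      exact ⟨hg1 X Y v, (hg3 X Y v none).2 (h2 v)⟩
    · rw [totalCount_eq_counters (X := X) (Y := Y) (fun v => rfl) fun e => rfl]
      exact (ArithFormula.holdsAt_counters I X Y _).2 h1
  · rintro ⟨X, Y⟩ ⟨X', Y'⟩ _ _ h
    simp only [Prod.mk.injEq] at h
    refine Prod.ext (funext fun i => Finset.ext fun v => ?_) (funext fun j => Finset.ext fun e => ?_)
    · have := congrFun (congrArg Prod.fst (congrFun h.1 v)) (.inr i)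
      exact decide_eq_decide.1 this
    · have := congrFun (congrArg (fun c => c.2.2) (congrFun h.2 e)) (.inr j)
      exact decide_eq_decide.1 this
  · rintro ⟨lv, le⟩ ⟨⟨hf1, hf2⟩, hacc, har⟩
    dsimp only at hf1 hf2 hacc har
    let X : Fin p → Finset (Fin I.G.n) := fun i => Finset.univ.filter fun v => (lv v).1 (.inr i)
    let Y : Fin q → Finset (Fin I.G.m) := fun j => Finset.univ.filter fun e => (le e).2.2 (.inr j)
    have hX : ∀ v, (lv v).1 = memBits (Sum.elim I.FX X) v := by
      intro v
      funext i
      rcases i with i | i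
      · exact hf1 v i
      · simp [memBits, X]
    have hY : ∀ e, (le e).2.2 = fun j => decide (e ∈ Sum.elim I.FY Y j) := by
      intro e
      funext j
      rcases j with j | j
      · exact hf2 e j
      · simp [Y]
    have hle : le = edgeLabels I.G lv fun e j => decide (e ∈ Sum.elim I.FY Y j) := by
      conv_lhs => rw [eq_of_accepts hacc]
      simp only [hY]
    have hacc' : ∀ v, Γ.check (lv v).2 (∑ e ∈ I.G.incident v, Γ.contrib (lv (I.G.other e v)).1
        (lv (I.G.other e v)).2 (I.G.view (Sum.elim I.FY Y) e (I.G.other e v))) ∧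
        Γ.eval (lv v).1 (lv v).2 none := by
      intro v
      have := hacc v
      rwa [hle, totalState_edgeLabels, accepts_singleton] at this
    have hguess : (fun v => (lv v).2) = g X Y := by
      refine hg2 X Y _ fun v => ?_
      have := (hacc' v).1
      simpa only [hX] using this
    have hlab : lab X Y = lv := by
      funext v
      exact Prod.ext (hX v).symm (congrFun hguess v).symm
    refine ⟨(X, Y), ⟨?_, fun v => ?_⟩, ?_⟩
    · rw [totalCount_eq_counters hX hY] at har
      exact (ArithFormula.holdsAt_counters I X Y _).1 har
    · refine (hg3 X Y v none).1 ?_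
      have := (hacc' v).2
      rw [hX v] at this
      rwa [← congrFun hguess v]
    · dsimp only
      rw [hlab, ← hle]

end Verifier

/-! ### Inputs -/

/-- Inputs of the algorithm. The parameter `K` only determines their size. -/
def Input (dir : Bool) (a b r _K : ℕ) := (I : ECMLInstance dir a b r) × I.G.TreeDecomposition

/-- The size of an input includes `K ^ (t + 1)`, where `t` is the width of the tree decomposition, so
that polynomial time in this size is single exponential in `t`. -/
noncomputable instance {dir : Bool} {a b r K : ℕ} : Enc (Input dir a b r K) :=
  ⟨fun x => .cons x.1.encode x.2.encode, fun x => inputSize x.1 x.2 + K ^ (x.2.width + 1)⟩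

namespace Input

variable {dir : Bool} {a b r K : ℕ} (x : Input dir a b r K)

/-- The bags, as lists of vertices. -/
def bags : List (List ℕ) := List.ofFn fun i => ((x.2.bag i).sort (· ≤ ·)).map Fin.val

/-- The pairs of endpoints of the edges. -/
def edges : List (ℕ × ℕ) := List.ofFn fun e => ((x.1.G.ends e).1.val, (x.1.G.ends e).2.val)

/-- The fixed vertex sets. -/
def vertexSets : List (List ℕ) := List.ofFn fun i => ((x.1.FX i).sort (· ≤ ·)).map Fin.val

/-- The fixed edge sets. -/
def edgeSets : List (List ℕ) := List.ofFn fun i => ((x.1.FY i).sort (· ≤ ·)).map Fin.val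

/-- The parameters. -/
def params : List ℤ := List.ofFn x.1.k

theorem sz_eq : sz x = inputSize x.1 x.2 + K ^ (x.2.width + 1) := rfl

theorem n_le : x.1.G.n ≤ sz x := by
  rw [sz_eq, inputSize, FinGraph.size]; omega

theorem m_le : x.1.G.m ≤ sz x := by
  rw [sz_eq, inputSize, FinGraph.size]; omega

theorem N_le : x.2.N ≤ sz x := by
  rw [sz_eq, inputSize]; omega

theorem size_le_of_lt {i n : ℕ} (h : i < n) : i.size ≤ n :=
  Nat.size_le.2 (h.trans Nat.lt_two_pow_self)

theorem sz_sort_le {n : ℕ} (s : Finset (Fin n)) :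
    sz ((s.sort (· ≤ ·)).map Fin.val) ≤ n * (n + 1) := by
  refine (sz_list_le (b := n) fun i hi => ?_).trans (Nat.mul_le_mul_right _ ?_)
  · obtain ⟨j, -, rfl⟩ := List.mem_map.1 hi
    exact size_le_of_lt j.2
  · simpa using s.card_le_univ

theorem sz_ofFn_sort_le {k n : ℕ} (s : Fin k → Finset (Fin n)) :
    sz (List.ofFn fun i => ((s i).sort (· ≤ ·)).map Fin.val) ≤ k * (n * (n + 1) + 1) := by
  refine (sz_list_le (b := n * (n + 1)) fun l hl => ?_).trans (by simp)
  obtain ⟨i, rfl⟩ := List.mem_ofFn.1 hl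
  exact sz_sort_le _

theorem enc_ofFn_sort {k n : ℕ} (s : Fin k → Finset (Fin n)) :
    enc (List.ofFn fun i => ((s i).sort (· ≤ ·)).map Fin.val) =
      TreeVal.ofVec fun i => TreeVal.ofFinset (s i) := by
  change TreeVal.ofList ((List.ofFn _).map _) = TreeVal.ofList (List.ofFn _)
  rw [List.map_ofFn]
  refine congrArg _ (congrArg _ (funext fun i => ?_))
  change TreeVal.ofList ((List.map _ _).map _) = TreeVal.ofList (List.map _ _)
  rw [List.map_map]
  rfl

open TreeProg.RunsWithin in
theorem pt_bags : PT (bags : Input dir a b r K → _) := by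
  refine ⟨(PolyLe.size.mul ((PolyLe.size.mul (.add .size (.const 1))).add (.const 1))).mono
    fun x => (sz_ofFn_sort_le _).trans ?_, .seq (.seq (.seq .tl .tl) .tl) .hd, _, .const 7,
    fun x => ?_⟩
  · have := x.n_le
    have := x.N_le
    gcongr
  · rw [bags, enc_ofFn_sort]
    exact .seq (.seq (.seq (.tl _) (.tl _)) (.tl _)) (.hd _)

open TreeProg.RunsWithin in
theorem pt_edges : PT (edges : Input dir a b r K → _) := by
  refine ⟨(PolyLe.size.mul ((PolyLe.size.add .size).add (.const 1))).mono fun x => ?_,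
    .seq (.seq .hd .tl) .hd, _, .const 5, fun x => ?_⟩
  · refine (sz_list_le (b := x.1.G.n + x.1.G.n) fun e he => ?_).trans ?_
    · obtain ⟨i, rfl⟩ := List.mem_ofFn.1 he
      exact Nat.add_le_add (size_le_of_lt (Fin.is_lt _)) (size_le_of_lt (Fin.is_lt _))
    · have := x.n_le
      have := x.m_le
      rw [edges, List.length_ofFn]
      gcongr
  · have : enc (edges x) = TreeVal.ofVec fun e => TreeVal.ofFinPair (x.1.G.ends e) := by
      change TreeVal.ofList ((List.ofFn _).map _) = TreeVal.ofList (List.ofFn _)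
      rw [List.map_ofFn]
      rfl
    rw [this]
    exact .seq (.seq (.hd _) (.tl _)) (.hd _)

open TreeProg.RunsWithin in
theorem pt_vertexSets : PT (vertexSets : Input dir a b r K → _) := by
  refine ⟨((PolyLe.const a).mul ((PolyLe.size.mul (.add .size (.const 1))).add (.const 1))).mono
    fun x => (sz_ofFn_sort_le _).trans ?_, .seq (.seq (.seq .hd .tl) .tl) .hd, _, .const 7,
    fun x => ?_⟩
  · have := x.n_le
    gcongr
  · rw [vertexSets, enc_ofFn_sort]
    exact .seq (.seq (.seq (.hd _) (.tl _)) (.tl _)) (.hd _)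

open TreeProg.RunsWithin in
theorem pt_edgeSets : PT (edgeSets : Input dir a b r K → _) := by
  refine ⟨((PolyLe.const b).mul ((PolyLe.size.mul (.add .size (.const 1))).add (.const 1))).mono
    fun x => (sz_ofFn_sort_le _).trans ?_, .seq (.seq (.seq (.seq .hd .tl) .tl) .tl) .hd, _,
    .const 9, fun x => ?_⟩
  · have := x.m_le
    gcongr
  · rw [edgeSets, enc_ofFn_sort]
    exact .seq (.seq (.seq (.seq (.hd _) (.tl _)) (.tl _)) (.tl _)) (.hd _)

open TreeProg.RunsWithin in
theorem pt_params : PT (params : Input dir a b r K → _) := by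
  refine ⟨((PolyLe.const r).mul (PolyLe.size.add (.const 1))).mono fun x => ?_,
    .seq (.seq (.seq (.seq (.seq .hd .tl) .tl) .tl) .tl) .hd, _, .const 11, fun x => ?_⟩
  · refine (sz_list_le (b := sz x) fun e he => ?_).trans (by simp [params])
    obtain ⟨i, rfl⟩ := List.mem_ofFn.1 he
    have := Finset.single_le_sum (f := fun i => (x.1.k i).natAbs.size) (fun _ _ => Nat.zero_le _)
      (Finset.mem_univ i)
    rw [sz_eq, inputSize, sz_int]
    exact this.trans (by omega)
  · have : enc (params x) = TreeVal.ofVec fun i => TreeVal.ofInt (x.1.k i) := by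
      change TreeVal.ofList ((List.ofFn _).map _) = TreeVal.ofList (List.ofFn _)
      rw [List.map_ofFn]
      rfl
    rw [this]
    exact .seq (.seq (.seq (.seq (.seq (.hd _) (.tl _)) (.tl _)) (.tl _)) (.tl _)) (.hd _)

end Input

/-- The elements of a list without repetitions. -/
def uniq (l : List ℕ) : List ℕ := l.foldl (fun acc v => if v ∈ acc then acc else v :: acc) []

theorem uniq_foldl (l acc : List ℕ) (h : acc.Nodup) :
    (l.foldl (fun acc v => if v ∈ acc then acc else v :: acc) acc).Nodup ∧
    (∀ v, v ∈ l.foldl (fun acc v => if v ∈ acc then acc else v :: acc) acc ↔ v ∈ acc ∨ v ∈ l) ∧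
    sz (l.foldl (fun acc v => if v ∈ acc then acc else v :: acc) acc) ≤ sz acc + sz l := by
  induction l generalizing acc with
  | nil => simp [h]
  | cons a l ih =>
    rw [List.foldl_cons]
    split_ifs with ha
    · obtain ⟨h1, h2, h3⟩ := ih acc h
      refine ⟨h1, fun v => ?_, h3.trans (by simp)⟩
      rw [h2, List.mem_cons]
      constructor
      · rintro (h | h) <;> simp [h]
      · rintro (h | rfl | h)
        exacts [Or.inl h, Or.inl ha, Or.inr h]
    · obtain ⟨h1, h2, h3⟩ := ih (a :: acc) (List.nodup_cons.2 ⟨ha, h⟩)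
      refine ⟨h1, fun v => ?_, h3.trans (by simp; omega)⟩
      rw [h2, List.mem_cons, List.mem_cons]
      tauto

theorem nodup_uniq (l : List ℕ) : (uniq l).Nodup := (uniq_foldl l [] List.nodup_nil).1

theorem mem_uniq {l : List ℕ} {v : ℕ} : v ∈ uniq l ↔ v ∈ l := by
  simpa [uniq] using (uniq_foldl l [] List.nodup_nil).2.1 v

namespace PT

variable {γ α : Type} [Enc γ] [Enc α]

theorem uniq {l : γ → List ℕ} (hl : PT l) : PT fun c => uniq (l c) := by
  refine foldl (step := fun _ acc v => if v ∈ acc then acc else v :: acc) hl (const [])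
    ⟨_, hl.1, fun c pre suf e => ?_⟩ (ite (mem id.snd.snd id.snd.fst) id.snd.fst
      (cons id.snd.snd id.snd.fst))
  refine (uniq_foldl pre [] List.nodup_nil).2.2.trans ?_
  rw [e]; simp

theorem zipIdx {l : γ → List α} (hl : PT l) : PT fun c => (l c).zipIdx := by
  have e : ∀ (l : List α) (s : List (α × ℕ) × ℕ),
      l.foldl (fun s a => ((a, s.2) :: s.1, s.2 + 1)) s =
        ((l.zipIdx s.2).reverse ++ s.1, s.2 + l.length) := by
    intro l
    induction l with
    | nil => simp
    | cons a l ih => intro s; simp [ih, List.zipIdx_cons, add_assoc, add_comm 1]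
  have e' : ∀ (l : List α) i, sz (l.zipIdx i) ≤ sz l + l.length * (i + l.length) := by
    intro l
    induction l with
    | nil => simp
    | cons a l ih =>
      intro i
      have := ih (i + 1)
      have h2 : i.size ≤ i := Nat.size_le.2 Nat.lt_two_pow_self
      simp only [List.zipIdx_cons, sz_cons, sz_prod, sz_nat, List.length_cons]
      have h3 : l.length * (i + 1 + l.length) + (i + 1) ≤ (l.length + 1) * (i + (l.length + 1)) := by
        ring_nf; omega
      omega
  refine (reverse (fst (foldl (l := l) (init := fun _ => (([], 0) : List (α × ℕ) × ℕ))
    (step := fun _ s a => ((a, s.2) :: s.1, s.2 + 1)) hl (const _)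
    ⟨fun c => sz (l c) + sz (l c) * sz (l c) + sz (l c),
      (hl.1.add (hl.1.mul hl.1)).add hl.1, fun c pre suf h => ?_⟩ ?_))).congr fun c => ?_
  · rw [e]
    have h1 := e' pre 0
    have h2 : sz pre ≤ sz (l c) := by rw [h]; simp
    have h3 := (length_le_sz pre).trans h2
    have h4 : pre.length.size ≤ pre.length := Nat.size_le.2 Nat.lt_two_pow_self
    have h5 := Nat.mul_le_mul h3 h3
    simp only [zero_add] at h1
    simp only [sz_prod, sz_append, sz_reverse, sz_nil, sz_nat, zero_add]
    omega
  · exact (cons (id.snd.snd.pair id.snd.fst.snd) id.snd.fst.fst).pair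
      (add id.snd.fst.snd (const 1))
  · rw [e]; simp

end PT

/-! ### Factors -/

namespace Table

variable {Q : Type} [DecidableEq Q] [AddCommMonoid Q]

/-- The table of a vertex `v`, for a list of states with counters. -/
def ofVertex (verts : List ℕ) (v : ℕ) (l : List (Q × List ℕ)) : Table Q :=
  collect (l.map fun c => ((verts.map fun u => (u, if u = v then c.1 else 0), c.2), 1))

/-- The table of an edge, for a list of states of its endpoints with counters. -/
def ofEdge (verts : List ℕ) (e : ℕ × ℕ) (l : List ((Q × Q) × List ℕ)) : Table Q :=
  collect (l.map fun c =>
    ((verts.map fun u => (u, if u = e.1 then c.1.1 else if u = e.2 then c.1.2 else 0), c.2), 1))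

/-- The tables of all vertices and edges. The lists of states depend on the fixed sets containing
the vertex or edge. -/
def factors (verts : List ℕ) (edges : List (ℕ × ℕ)) (vertexSets edgeSets : List (List ℕ))
    (vl : List Bool → List (Q × List ℕ)) (el : List Bool → List ((Q × Q) × List ℕ)) :
    List (Table Q) :=
  (verts.map fun v => ofVertex verts v (vl (vertexSets.map fun l => decide (v ∈ l)))) ++
    edges.zipIdx.map fun e => ofEdge verts e.1 (el (edgeSets.map fun l => decide (e.2 ∈ l)))

end Table

namespace PT

variable {γ Q : Type} [Enc γ] [Enc Q] [DecidableEq Q] [EqTest Q] [AddCommMonoid Q]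

/-- Look-up in a table indexed by bit strings of a fixed length. -/
theorem lookup_bits {β : Type} [Enc β] [Nonempty β] {f : γ → List Bool} (n : ℕ) (F : List Bool → β)
    (hf : PT f) (hn : ∀ c, (f c).length = n) : PT fun c => F (f c) :=
  lookup F hf (Finset.univ.image fun g : Fin n → Bool => List.ofFn g) fun c => by
    rw [Finset.mem_image]
    exact ⟨fun i => (f c)[i]'(by rw [hn]; exact i.2), Finset.mem_univ _,
      List.ext_getElem (by simp [hn]) (by simp)⟩

theorem factors {verts : γ → List ℕ} {edges : γ → List (ℕ × ℕ)}
    {vertexSets edgeSets : γ → List (List ℕ)} (hv : PT verts) (he : PT edges)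
    (hvs : PT vertexSets) (hes : PT edgeSets) {a b : ℕ} (ha : ∀ c, (vertexSets c).length = a)
    (hb : ∀ c, (edgeSets c).length = b) (vl : List Bool → List (Q × List ℕ))
    (el : List Bool → List ((Q × Q) × List ℕ)) :
    PT fun c => Table.factors (verts c) (edges c) (vertexSets c) (edgeSets c) vl el := by
  refine append (map (f := fun x : γ × ℕ => Table.ofVertex (verts x.1) x.2
    (vl ((vertexSets x.1).map fun l => decide (x.2 ∈ l)))) hv ?_)
    (map (f := fun x : γ × (ℕ × ℕ) × ℕ => Table.ofEdge (verts x.1) x.2.1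
    (el ((edgeSets x.1).map fun l => decide (x.2.2 ∈ l)))) (zipIdx he) ?_)
  · have h1 : PT fun x : γ × ℕ => vl ((vertexSets x.1).map fun l => decide (x.2 ∈ l)) :=
      lookup_bits a vl (map (f := fun y : (γ × ℕ) × List ℕ => decide (y.1.2 ∈ y.2))
        (hvs.comp id.fst) (mem id.fst.snd id.snd)) (by simp [ha])
    exact collect (map (f := fun y : (γ × ℕ) × (Q × List ℕ) =>
        (((verts y.1.1).map fun u => (u, if u = y.1.2 then y.2.1 else 0), y.2.2), 1)) h1
      (((map (f := fun z : ((γ × ℕ) × (Q × List ℕ)) × ℕ =>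
          (z.2, if z.2 = z.1.1.2 then z.1.2.1 else 0)) (hv.comp id.fst.fst)
        (id.snd.pair (ite (eq id.snd id.fst.fst.snd) id.fst.snd.fst (const 0)))).pair
          id.snd.snd).pair (const 1)))
  · have h1 : PT fun x : γ × (ℕ × ℕ) × ℕ =>
        el ((edgeSets x.1).map fun l => decide (x.2.2 ∈ l)) :=
      lookup_bits b el (map (f := fun y : (γ × (ℕ × ℕ) × ℕ) × List ℕ => decide (y.1.2.2 ∈ y.2))
        (hes.comp id.fst) (mem id.fst.snd.snd id.snd)) (by simp [hb])
    exact collect (map (f := fun y : (γ × (ℕ × ℕ) × ℕ) × ((Q × Q) × List ℕ) =>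
        (((verts y.1.1).map fun u => (u, if u = y.1.2.1.1 then y.2.1.1 else
          if u = y.1.2.1.2 then y.2.1.2 else 0), y.2.2), 1)) h1
      (((map (f := fun z : ((γ × (ℕ × ℕ) × ℕ) × ((Q × Q) × List ℕ)) × ℕ =>
          (z.2, if z.2 = z.1.1.2.1.1 then z.1.2.1.1 else
            if z.2 = z.1.1.2.1.2 then z.1.2.1.2 else 0)) (hv.comp id.fst.fst)
        (id.snd.pair (ite (eq id.snd id.fst.fst.snd.fst.fst) id.fst.snd.fst.fst
          (ite (eq id.snd id.fst.fst.snd.fst.snd) id.fst.snd.fst.snd (const 0))))).pair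
          id.snd.snd).pair (const 1)))

/-! ### Evaluation of arithmetic formulas -/

theorem arithTerm {a b r p q : ℕ} {ks : γ → List ℤ} {c : γ → List ℕ} (hk : PT ks) (hc : PT c)
    (ix : Counter a b p q → ℕ) (t : ArithTerm a b r p q) :
    IntDiff fun x => t.evalAt (fun i => (ks x).getD i 0) (fun j => (c x).getD (ix j) 0) := by
  induction t with
  | const z => exact IntDiff.const z
  | param i => exact IntDiff.int (getD hk i 0)
  | numV | numE | cardFX i | cardFY i | cardX i | cardY i => exact IntDiff.natCast (getD hc _ 0)
  | add s u hs hu => exact hs.add hu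
  | sub s u hs hu => exact hs.sub hu
  | mul s u hs hu => exact hs.mul hu

open Classical in
theorem arithFormula {a b r p q : ℕ} {ks : γ → List ℤ} {c : γ → List ℕ} (hk : PT ks) (hc : PT c)
    (ix : Counter a b p q → ℕ) (f : ArithFormula a b r p q) :
    PT fun x => decide (f.HoldsAt (fun i => (ks x).getD i 0) (fun j => (c x).getD (ix j) 0)) := by
  induction f with
  | eq s u =>
    have hs := arithTerm hk hc ix s
    have hu := arithTerm hk hc ix u
    exact (and (hs.le hu) (hu.le hs)).congr fun x => by
      rw [Bool.eq_iff_iff, decide_eq_true_iff, Bool.and_eq_true, decide_eq_true_iff,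
        decide_eq_true_iff]
      exact le_antisymm_iff
  | le s u =>
    exact ((arithTerm hk hc ix s).le (arithTerm hk hc ix u)).congr fun x => by
      rw [Bool.eq_iff_iff, decide_eq_true_iff, decide_eq_true_iff]
      rfl
  | lt s u =>
    exact ((arithTerm hk hc ix u).le (arithTerm hk hc ix s)).not.congr fun x => by
      rw [Bool.eq_iff_iff, decide_eq_true_iff, Bool.not_eq_true', decide_eq_false_iff_not]
      exact not_le.symm
  | neg f hf =>
    exact hf.not.congr fun x => by
      rw [Bool.eq_iff_iff]; simp [ArithFormula.HoldsAt]
  | and f g hf hg =>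
    exact (hf.and hg).congr fun x => by
      rw [Bool.eq_iff_iff]; simp [ArithFormula.HoldsAt]
  | or f g hf hg =>
    exact (hf.or hg).congr fun x => by
      rw [Bool.eq_iff_iff]; simp [ArithFormula.HoldsAt]
  | imp f g hf hg =>
    exact (hf.not.or hg).congr fun x => by
      rw [Bool.eq_iff_iff]; simp [ArithFormula.HoldsAt, imp_iff_not_or]
  | iff f g hf hg =>
    exact (hf.beq_bool hg).congr fun x => by
      rw [Bool.eq_iff_iff]; simp [ArithFormula.HoldsAt]

end PT

/-! ### The algorithm on instances -/

namespace Table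

variable {Q : Type} [DecidableEq Q] [AddCommMonoid Q] {verts : List ℕ} {s L : ℕ}

theorem ofVertex_spec {v : ℕ} {l : List (Q × List ℕ)} (hl : l.length ≤ L)
    (hg : ∀ c ∈ l, ∃ g : ℕ → ℕ, c.2 = (List.range s).map g ∧ ∀ i, g i ≤ 1) :
    Good verts s (ofVertex verts v l) ∧ ((ofVertex verts v l).map Prod.fst).Nodup ∧
      Bdd L 1 (ofVertex verts v l) ∧
      ∀ u, (ofVertex verts v l).touches u = true → u ∈ verts ∧ u = v := by
  refine ⟨good_collect fun e he => ?_, nodup_collect _, ⟨fun e he x hx => ?_, ?_⟩, fun u hu => ?_⟩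
  · obtain ⟨c, hc, rfl⟩ := List.mem_map.1 he
    obtain ⟨g, hg, -⟩ := hg c hc
    exact ⟨_, g, Prod.ext rfl hg⟩
  · obtain ⟨y, hy, hye⟩ := List.mem_map.1 (mem_collect he).1
    obtain ⟨c, hc, rfl⟩ := List.mem_map.1 hy
    obtain ⟨g, hg, hg1⟩ := hg c hc
    rw [← hye] at hx
    dsimp only at hx
    rw [hg] at hx
    obtain ⟨i, -, rfl⟩ := List.mem_map.1 hx
    exact hg1 i
  · rw [ofVertex, sum_snd_collect, List.map_map]
    simpa [Function.comp_def] using hl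
  · obtain ⟨e, he, h⟩ := List.any_eq_true.1 (touches_collect hu)
    obtain ⟨c, hc, rfl⟩ := List.mem_map.1 he
    obtain ⟨y, hy, h⟩ := List.any_eq_true.1 h
    obtain ⟨w, hw, rfl⟩ := List.mem_map.1 hy
    simp only [Bool.and_eq_true, decide_eq_true_eq, Bool.not_eq_true', decide_eq_false_iff_not] at h
    obtain ⟨rfl, hne⟩ := h
    refine ⟨hw, ?_⟩
    by_contra hwv
    exact hne (if_neg hwv)

theorem ofEdge_spec {e : ℕ × ℕ} {l : List ((Q × Q) × List ℕ)} (hl : l.length ≤ L)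
    (hg : ∀ c ∈ l, ∃ g : ℕ → ℕ, c.2 = (List.range s).map g ∧ ∀ i, g i ≤ 1) :
    Good verts s (ofEdge verts e l) ∧ ((ofEdge verts e l).map Prod.fst).Nodup ∧
      Bdd L 1 (ofEdge verts e l) ∧
      ∀ u, (ofEdge verts e l).touches u = true → u ∈ verts ∧ (u = e.1 ∨ u = e.2) := by
  refine ⟨good_collect fun x hx => ?_, nodup_collect _, ⟨fun y hy x hx => ?_, ?_⟩, fun u hu => ?_⟩
  · obtain ⟨c, hc, rfl⟩ := List.mem_map.1 hx
    obtain ⟨g, hg, -⟩ := hg c hc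
    exact ⟨_, g, Prod.ext rfl hg⟩
  · obtain ⟨z, hz, hzy⟩ := List.mem_map.1 (mem_collect hy).1
    obtain ⟨c, hc, rfl⟩ := List.mem_map.1 hz
    obtain ⟨g, hg, hg1⟩ := hg c hc
    rw [← hzy] at hx
    dsimp only at hx
    rw [hg] at hx
    obtain ⟨i, -, rfl⟩ := List.mem_map.1 hx
    exact hg1 i
  · rw [ofEdge, sum_snd_collect, List.map_map]
    simpa [Function.comp_def] using hl
  · obtain ⟨x, hx, h⟩ := List.any_eq_true.1 (touches_collect hu)
    obtain ⟨c, hc, rfl⟩ := List.mem_map.1 hx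
    obtain ⟨y, hy, h⟩ := List.any_eq_true.1 h
    obtain ⟨w, hw, rfl⟩ := List.mem_map.1 hy
    simp only [Bool.and_eq_true, decide_eq_true_eq, Bool.not_eq_true', decide_eq_false_iff_not] at h
    obtain ⟨rfl, hne⟩ := h
    refine ⟨hw, ?_⟩
    by_contra hwv
    rw [not_or] at hwv
    exact hne (by rw [if_neg hwv.1, if_neg hwv.2])

end Table

namespace Input

variable {dir : Bool} {a b r K : ℕ} (x : Input dir a b r K)

/-- The list of all vertices: those occurring in the bags. -/
def verts : List ℕ := uniq x.bags.flatten

theorem pt_verts : PT (verts : Input dir a b r K → _) := PT.uniq (PT.flatten pt_bags)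

theorem mem_bag {l : List ℕ} : l ∈ x.bags ↔
    ∃ i, l = ((x.2.bag i).sort (· ≤ ·)).map Fin.val := by
  simp [bags, List.mem_ofFn, eq_comm]

theorem mem_sort_map {n : ℕ} {s : Finset (Fin n)} {v : Fin n} :
    (v : ℕ) ∈ (s.sort (· ≤ ·)).map Fin.val ↔ v ∈ s := by
  rw [List.mem_map]
  constructor
  · rintro ⟨u, hu, h⟩
    rw [Fin.ext_iff.2 h.symm]
    exact (Finset.mem_sort _).1 hu
  · exact fun h => ⟨v, (Finset.mem_sort _).2 h, rfl⟩

theorem mem_verts {v : ℕ} : v ∈ x.verts ↔ v < x.1.G.n := by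
  rw [verts, mem_uniq, List.mem_flatten]
  constructor
  · rintro ⟨l, hl, hv⟩
    obtain ⟨i, rfl⟩ := x.mem_bag.1 hl
    obtain ⟨u, -, rfl⟩ := List.mem_map.1 hv
    exact u.2
  · intro hv
    obtain ⟨i, hi⟩ := x.2.cover ⟨v, hv⟩
    exact ⟨_, x.mem_bag.2 ⟨i, rfl⟩, (mem_sort_map (v := ⟨v, hv⟩)).2 hi⟩

theorem nodup_verts : x.verts.Nodup := nodup_uniq _

/-- Any nonempty list of vertices contains one that can be eliminated. -/
theorem simplicial_ne_nil {U : List ℕ} (hU : U.Sublist x.verts) (h : U ≠ []) :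
    Table.simplicial x.bags U ≠ [] := by
  have hlt : ∀ v ∈ U, v < x.1.G.n := fun v hv => x.mem_verts.1 (hU.subset hv)
  obtain ⟨v, hv, i, hi⟩ := SimpleGraph.IsTree.exists_simplicial _ (Fin x.2.N) x.2.tree x.2.isTree
    (fun i => (x.2.bag i : Set (Fin x.1.G.n))) (fun v i j k w hw hk hi hj =>
      x.2.path v i j k w hw hk hi hj) {v | (v : ℕ) ∈ U} (by
        obtain ⟨v, hv⟩ := List.exists_mem_of_ne_nil U h
        exact ⟨⟨v, hlt v hv⟩, hv⟩) (fun v _ => x.2.cover v) rfl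
  refine List.ne_nil_of_mem (a := (v : ℕ)) (Table.mem_simplicial.2 ⟨hv, _, x.mem_bag.2 ⟨i, rfl⟩, ?_⟩)
  intro l hl hvl u hul huU
  obtain ⟨j, rfl⟩ := x.mem_bag.1 hl
  obtain ⟨u, hu, rfl⟩ := List.mem_map.1 hul
  exact mem_sort_map.2 (hi j (mem_sort_map.1 hvl) u ((Finset.mem_sort _).1 hu) huU)

theorem card_bag_le {l : List ℕ} (hl : l ∈ x.bags) : l.toFinset.card ≤ x.2.width + 1 := by
  obtain ⟨i, rfl⟩ := x.mem_bag.1 hl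
  refine (List.toFinset_card_le _).trans ?_
  rw [List.length_map, Finset.length_sort]
  have : (x.2.bag i).card ≤ Finset.univ.sup fun i => (x.2.bag i).card :=
    Finset.le_sup (f := fun i => (x.2.bag i).card) (Finset.mem_univ i)
  unfold FinGraph.TreeDecomposition.width
  omega

section Algorithm

variable {Q : Type} [DecidableEq Q] [AddCommMonoid Q]
  (vl : List Bool → List (Q × List ℕ)) (el : List Bool → List ((Q × Q) × List ℕ))

/-- The initial tables. -/
def tables : List (Table Q) := Table.factors x.verts x.edges x.vertexSets x.edgeSets vl el

/-- The table that remains after the elimination of all vertices. -/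
def finalTable (acc : Q → Bool) (s : ℕ) : Table Q :=
  Table.prod (Table.unit x.verts s)
    (Table.run x.bags acc (Table.unit x.verts s) x.verts (x.verts, x.tables vl el)).2

/-- There are at most `L` possible choices for each vertex and edge, and each of them comes with `s`
counters with values at most `1`. -/
structure BddChoices (vl : List Bool → List (Q × List ℕ)) (el : List Bool → List ((Q × Q) × List ℕ))
    (s L : ℕ) : Prop where
  two_le : 2 ≤ L
  vertex_length : ∀ l, (vl l).length ≤ L
  edge_length : ∀ l, (el l).length ≤ L
  vertex_counters : ∀ l, ∀ c ∈ vl l, ∃ g : ℕ → ℕ, c.2 = (List.range s).map g ∧ ∀ i, g i ≤ 1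
  edge_counters : ∀ l, ∀ c ∈ el l, ∃ g : ℕ → ℕ, c.2 = (List.range s).map g ∧ ∀ i, g i ≤ 1

variable {vl el} {s L : ℕ}

theorem tables_spec (h : BddChoices vl el s L) {T : Table Q} (hT : T ∈ x.tables vl el) :
    Table.Good x.verts s T ∧ (T.map Prod.fst).Nodup ∧ Table.Bdd L 1 T ∧
      ∃ l ∈ x.bags, ∀ v, T.touches v = true → v ∈ l ∧ v ∈ x.verts := by
  rcases List.mem_append.1 hT with hT | hT
  · obtain ⟨v, hv, rfl⟩ := List.mem_map.1 hT
    obtain ⟨h1, h2, h3, h4⟩ := Table.ofVertex_spec (verts := x.verts) (v := v) (s := s)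
      (h.vertex_length (x.vertexSets.map fun l => decide (v ∈ l))) (h.vertex_counters _)
    obtain ⟨i, hi⟩ := x.2.cover ⟨v, x.mem_verts.1 hv⟩
    refine ⟨h1, h2, h3, _, x.mem_bag.2 ⟨i, rfl⟩, fun u hu => ?_⟩
    obtain ⟨h5, rfl⟩ := h4 u hu
    exact ⟨mem_sort_map.2 hi, h5⟩
  · obtain ⟨e, he, rfl⟩ := List.mem_map.1 hT
    obtain ⟨h1, h2, h3, h4⟩ := Table.ofEdge_spec (verts := x.verts) (e := e.1) (s := s)
      (h.edge_length (x.edgeSets.map fun l => decide (e.2 ∈ l))) (h.edge_counters _)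
    have he' : e.1 ∈ x.edges := List.fst_mem_of_mem_zipIdx he
    obtain ⟨j, hj⟩ := List.mem_ofFn.1 he'
    obtain ⟨i, hi1, hi2⟩ := x.2.edge j
    refine ⟨h1, h2, h3, _, x.mem_bag.2 ⟨i, rfl⟩, fun u hu => ?_⟩
    obtain ⟨h5, h6⟩ := h4 u hu
    refine ⟨?_, h5⟩
    rw [← hj] at h6
    rcases h6 with rfl | rfl
    · exact mem_sort_map.2 hi1
    · exact mem_sort_map.2 hi2

theorem inv (h : BddChoices vl el s L) : Table.Inv x.bags x.verts s L (x.tables vl el) (x.verts, x.tables vl el) :=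
  ⟨List.Sublist.refl _, fun _ hT => (x.tables_spec h hT).1,
    fun _ hT => (x.tables_spec h hT).2.1,
    fun _ hT => (x.tables_spec h hT).2.2.2, le_rfl, le_rfl⟩

theorem pt_finalTable (h : BddChoices vl el s L) [Finite Q] [Enc Q] [PT.EqTest Q] (hK : K = Nat.card Q) (acc : Q → Bool) :
    PT fun x : Input dir a b r K => x.finalTable vl el acc s := by
  have ht : PT fun x : Input dir a b r K => x.tables vl el :=
    PT.factors pt_verts pt_edges pt_vertexSets pt_edgeSets (a := a) (b := b)
      (fun x => List.length_ofFn) (fun x => List.length_ofFn) vl el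
  refine PT.prod_run pt_bags pt_verts ht acc h.two_le (fun x => x.inv h)
    (fun x U hU h => x.simplicial_ne_nil hU h) (ht.1.mono fun x => ?_)
    ⟨fun x => sz x + 1, PolyLe.size.add (.const 1), fun x l hl => ?_⟩
  · refine le_trans ?_ (length_le_sz _)
    refine (List.sum_le_card_nsmul _ 1 fun w hw => ?_).trans (by simp)
    obtain ⟨T, hT, rfl⟩ := List.mem_map.1 hw
    exact (x.tables_spec h hT).2.2.1.weight_le
  · have h1 := x.card_bag_le hl
    change _ ≤ sz x + 1
    rw [sz_eq, ← hK]
    rcases Nat.eq_zero_or_pos K with h0 | h0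
    · rcases Nat.eq_zero_or_pos l.toFinset.card with h2 | h2
      · rw [h2, pow_zero]; omega
      · rw [h0, zero_pow (by omega)]; omega
    · have := Nat.pow_le_pow_right h0 h1
      omega

/-- The final table counts the choices accepted at all vertices. -/
theorem evalKeys_finalTable (hb : BddChoices vl el s L) (acc : Q → Bool) (h : (ℕ → ℕ) → ℕ) :
    evalKeys (fun k => h k.2) (x.finalTable vl el acc s).sem =
      evalKeys (Table.acceptedValue acc h x.verts) ((x.tables vl el).map Table.sem).prod := by
  have hi := x.inv hb
  have hlen := Table.length_run (fun U hU h => x.simplicial_ne_nil hU h) hb.two_le acc x.verts hi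
  have hnil := List.length_eq_zero_iff.1 (Nat.le_zero.1 (hlen.trans (Nat.sub_self _).le))
  have := Table.evalKeys_run hb.two_le acc h x.verts hi
  dsimp only at this
  rw [hnil] at this
  rw [finalTable, Table.sem_prod (hi.run hb.two_le acc x.verts).good, ← this]
  congr 2

end Algorithm

end Input

/-! ### The value computed by the algorithm -/

section Expansion

variable {Q : Type} [AddCommMonoid Q]

theorem prod_sum_single {ι α : Type} [Fintype ι] [DecidableEq ι] (A : ι → Finset α)
    (F : ι → α → (ℕ → Q) × (ℕ → ℕ)) :
    ∏ i, ∑ c ∈ A i, (AddMonoidAlgebra.single (F i c) 1 : AddMonoidAlgebra ℕ _) =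
      ∑ f ∈ Fintype.piFinset A, AddMonoidAlgebra.single (∑ i, F i (f i)) 1 := by
  have h : ∀ (s : Finset ι) (f : ι → α), ∏ i ∈ s, (AddMonoidAlgebra.single (F i (f i)) 1 :
      AddMonoidAlgebra ℕ _) = AddMonoidAlgebra.single (∑ i ∈ s, F i (f i)) 1 := by
    intro s f
    induction s using Finset.induction_on with
    | empty => simp [AddMonoidAlgebra.one_def]
    | insert i s hi ih =>
      rw [Finset.prod_insert hi, Finset.sum_insert hi, ih, AddMonoidAlgebra.single_mul_single,
        one_mul]
  rw [Finset.prod_univ_sum]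
  exact Finset.sum_congr rfl fun f _ => h _ f

/-- Evaluation of a product of sums: a sum over all systems of choices. -/
theorem evalKeys_prod_mul_prod {ι κ α β : Type} [Fintype ι] [DecidableEq ι] [Fintype κ]
    [DecidableEq κ] (A : ι → Finset α) (B : κ → Finset β) (F : ι → α → (ℕ → Q) × (ℕ → ℕ))
    (F' : κ → β → (ℕ → Q) × (ℕ → ℕ)) (H : (ℕ → Q) × (ℕ → ℕ) → ℕ) :
    evalKeys H ((∏ i, ∑ c ∈ A i, (AddMonoidAlgebra.single (F i c) 1 : AddMonoidAlgebra ℕ _)) *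
      ∏ i, ∑ c ∈ B i, (AddMonoidAlgebra.single (F' i c) 1 : AddMonoidAlgebra ℕ _)) =
      ∑ f ∈ Fintype.piFinset A ×ˢ Fintype.piFinset B,
        H (∑ i, F i (f.1 i) + ∑ i, F' i (f.2 i)) := by
  rw [prod_sum_single, prod_sum_single, Finset.sum_mul_sum, Finset.sum_product]
  simp only [map_sum, AddMonoidAlgebra.single_mul_single, evalKeys_single, one_mul]

namespace Table

variable [DecidableEq Q] (verts : List ℕ) (s : ℕ)

theorem sem_ofVertex {α : Type} (v : ℕ) (A : Finset α) (st : α → Q) (g : α → ℕ → ℕ) :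
    (ofVertex verts v (A.toList.map fun c => (st c, (List.range s).map (g c)))).sem =
      ∑ c ∈ A, AddMonoidAlgebra.single
        (keyOf verts s (fun u => if u = v then st c else 0) (g c)).dec 1 := by
  rw [ofVertex, sem_collect, sem, List.map_map, List.map_map, Finset.sum_map_toList]
  rfl

theorem sem_ofEdge {α : Type} (e : ℕ × ℕ) (A : Finset α) (st : α → Q × Q) (g : α → ℕ → ℕ) :
    (ofEdge verts e (A.toList.map fun c => (st c, (List.range s).map (g c)))).sem =
      ∑ c ∈ A, AddMonoidAlgebra.single (keyOf verts s
        (fun u => if u = e.1 then (st c).1 else if u = e.2 then (st c).2 else 0) (g c)).dec 1 := by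
  rw [ofEdge, sem_collect, sem, List.map_map, List.map_map, Finset.sum_map_toList]
  rfl

open Classical in
theorem sum_filter (T : Table Q) (P : (ℕ → ℕ) → Prop) :
    ((T.filter fun e => decide (P fun i => e.1.2.getD i 0)).map Prod.snd).sum =
      evalKeys (fun k => if P k.2 then 1 else 0) T.sem := by
  rw [evalKeys_sem]
  induction T with
  | nil => rfl
  | cons e T ih =>
    rw [List.map_cons, List.sum_cons, ← ih]
    by_cases he : P e.1.dec.2
    · rw [List.filter_cons_of_pos (by rw [decide_eq_true_iff]; exact he), if_pos he, mul_one, List.map_cons,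
        List.sum_cons]
    · rw [List.filter_cons_of_neg (by rw [decide_eq_true_iff]; exact he), if_neg he, mul_zero,
        zero_add]

end Table

end Expansion

theorem List.prod_map_eq_prod_fin {M : Type} [CommMonoid M] {n : ℕ} {l : List ℕ} (hl : l.Nodup)
    (hm : ∀ v, v ∈ l ↔ v < n) (f : ℕ → M) : (l.map f).prod = ∏ v : Fin n, f v := by
  rw [← List.prod_toFinset f hl, Fin.prod_univ_eq_prod_range f n]
  refine Finset.prod_congr (Finset.ext fun v => ?_) fun _ _ => rfl
  simp [hm]

theorem List.prod_map_zipIdx_ofFn {M α : Type} [CommMonoid M] {n : ℕ} (g : Fin n → α)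
    (f : α × ℕ → M) : (((List.ofFn g).zipIdx).map f).prod = ∏ e : Fin n, f (g e, e) := by
  have : (List.ofFn g).zipIdx = List.ofFn fun e => (g e, (e : ℕ)) :=
    List.ext_getElem (by simp) (by simp)
  rw [this, List.map_ofFn, List.prod_ofFn]
  rfl

theorem List.getD_map_ofFn_mem {k n : ℕ} (S : Fin k → Finset (Fin n)) (v : Fin n) (i : Fin k) :
    ((List.ofFn fun i => ((S i).sort (· ≤ ·)).map Fin.val).map fun l =>
      decide ((v : ℕ) ∈ l)).getD i false = decide (v ∈ S i) := by
  rw [List.map_ofFn, List.getD_eq_getElem _ _ (by simp), List.getElem_ofFn]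
  exact decide_eq_decide.2 Input.mem_sort_map

/-! ### The tables of a verifier -/

namespace Counter

variable {a b p q : ℕ}

/-- The position of a counter in the lists of counters. -/
noncomputable def index (i : Counter a b p q) : ℕ := Fintype.equivFin (Counter a b p q) i

/-- The values of the counters, ordered by position. -/
noncomputable def spread (t : Counter a b p q → ℕ) (j : ℕ) : ℕ :=
  if h : j < Fintype.card (Counter a b p q) then t ((Fintype.equivFin _).symm ⟨j, h⟩) else 0

theorem index_lt (i : Counter a b p q) : i.index < Fintype.card (Counter a b p q) :=
  Fin.is_lt _

theorem spread_index (t : Counter a b p q → ℕ) (i : Counter a b p q) :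
    spread t i.index = t i := by
  rw [spread, dif_pos i.index_lt]
  exact congrArg t ((Fintype.equivFin _).symm_apply_apply i)

theorem spread_le {t : Counter a b p q → ℕ} {n : ℕ} (h : ∀ i, t i ≤ n) (j : ℕ) :
    spread t j ≤ n := by
  unfold spread
  split
  exacts [h _, Nat.zero_le _]

end Counter

namespace Verifier

variable {dir : Bool} {a b p q r K : ℕ} (Γ : Verifier (Fin a ⊕ Fin p) (Fin b ⊕ Fin q))

/-- The labels of a vertex that is contained in the fixed sets listed by `l`. -/
noncomputable def labels (l : List Bool) : Finset Γ.Label :=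
  (Set.toFinite {c : Γ.Label | ∀ i : Fin a, c.1 (.inl i) = l.getD i false}).toFinset

/-- The labels of an edge that is contained in the fixed sets listed by `l`. -/
noncomputable def edgeLabelSet (l : List Bool) : Finset Γ.EdgeLabel :=
  (Set.toFinite {c : Γ.EdgeLabel | ∀ j : Fin b, c.2.2 (.inl j) = l.getD j false}).toFinset

/-- The choices of a vertex: states with counters. -/
noncomputable def vertexChoices (l : List Bool) : List (Γ.State × List ℕ) :=
  (Γ.labels l).toList.map fun c => (Γ.vertexState c,
    (List.range (Fintype.card (Counter a b p q))).map (Counter.spread (Γ.vertexCount c)))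

/-- The choices of an edge: pairs of states of its endpoints with counters. -/
noncomputable def edgeChoices (l : List Bool) : List ((Γ.State × Γ.State) × List ℕ) :=
  (Γ.edgeLabelSet l).toList.map fun c => ((Γ.fstState c, Γ.sndState c),
    (List.range (Fintype.card (Counter a b p q))).map (Counter.spread (Γ.edgeCount c)))

theorem bddChoices : Input.BddChoices Γ.vertexChoices Γ.edgeChoices
    (Fintype.card (Counter a b p q)) (Nat.card Γ.Label + Nat.card Γ.EdgeLabel + 2) where
  two_le := by omega
  vertex_length l := by
    have h : (Γ.labels l).card ≤ Nat.card Γ.Label := by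
      rw [← Set.ncard_coe_finset]; exact Set.ncard_le_card _
    simp only [vertexChoices, List.length_map, Finset.length_toList]
    omega
  edge_length l := by
    have h : (Γ.edgeLabelSet l).card ≤ Nat.card Γ.EdgeLabel := by
      rw [← Set.ncard_coe_finset]; exact Set.ncard_le_card _
    simp only [edgeChoices, List.length_map, Finset.length_toList]
    omega
  vertex_counters l c hc := by
    obtain ⟨c, -, rfl⟩ := List.mem_map.1 hc
    refine ⟨_, rfl, Counter.spread_le fun i => ?_⟩
    rcases i with (_ | i) | i
    exacts [le_rfl, Bool.toNat_le _, Nat.zero_le _]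
  edge_counters l c hc := by
    obtain ⟨c, -, rfl⟩ := List.mem_map.1 hc
    refine ⟨_, rfl, Counter.spread_le fun i => ?_⟩
    rcases i with i | (_ | i)
    exacts [Nat.zero_le _, le_rfl, Bool.toNat_le _]

variable [DecidableEq Γ.State] (x : Input dir a b r K)

/-- The product of the initial tables, as a product of sums over labels. -/
theorem prod_sem_tables :
    ((x.tables Γ.vertexChoices Γ.edgeChoices).map Table.sem).prod =
      (∏ v : Fin x.1.G.n, ∑ c ∈ Γ.labels (x.vertexSets.map fun l => decide ((v : ℕ) ∈ l)),
        AddMonoidAlgebra.single (keyOf x.verts (Fintype.card (Counter a b p q))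
          (fun u => if u = v then Γ.vertexState c else 0)
          (Counter.spread (Γ.vertexCount c))).dec 1) *
      ∏ e : Fin x.1.G.m, ∑ c ∈ Γ.edgeLabelSet (x.edgeSets.map fun l => decide ((e : ℕ) ∈ l)),
        AddMonoidAlgebra.single (keyOf x.verts (Fintype.card (Counter a b p q))
          (fun u => if u = (x.1.G.ends e).1 then Γ.fstState c else
            if u = (x.1.G.ends e).2 then Γ.sndState c else 0)
          (Counter.spread (Γ.edgeCount c))).dec 1 := by
  rw [Input.tables, Table.factors, List.map_append, List.prod_append, List.map_map, List.map_map]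
  congr 1
  · rw [List.prod_map_eq_prod_fin x.nodup_verts (fun v => x.mem_verts)]
    exact Finset.prod_congr rfl fun v _ => Table.sem_ofVertex _ _ _ _ _ _
  · rw [Input.edges, List.prod_map_zipIdx_ofFn]
    exact Finset.prod_congr rfl fun e _ => Table.sem_ofEdge _ _ _ _ _ _

theorem mem_labels_iff_fits (c : (Fin x.1.G.n → Γ.Label) × (Fin x.1.G.m → Γ.EdgeLabel)) :
    c ∈ (Fintype.piFinset fun v : Fin x.1.G.n =>
        Γ.labels (x.vertexSets.map fun l => decide ((v : ℕ) ∈ l))) ×ˢ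
      (Fintype.piFinset fun e : Fin x.1.G.m =>
        Γ.edgeLabelSet (x.edgeSets.map fun l => decide ((e : ℕ) ∈ l))) ↔ Fits Γ x.1 c := by
  rw [Finset.mem_product, Fintype.mem_piFinset, Fintype.mem_piFinset]
  simp only [labels, edgeLabelSet, Set.Finite.mem_toFinset, Set.mem_ofPred_eq, Input.vertexSets,
    Input.edgeSets, List.getD_map_ofFn_mem]
  rfl

/-- The key of a choice of labels for all vertices and edges. -/
noncomputable def totalKey (c : (Fin x.1.G.n → Γ.Label) × (Fin x.1.G.m → Γ.EdgeLabel)) :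
    (ℕ → Γ.State) × (ℕ → ℕ) :=
  ∑ v : Fin x.1.G.n, (keyOf x.verts (Fintype.card (Counter a b p q))
      (fun u => if u = (v : ℕ) then Γ.vertexState (c.1 v) else 0)
      (Counter.spread (Γ.vertexCount (c.1 v)))).dec +
    ∑ e : Fin x.1.G.m, (keyOf x.verts (Fintype.card (Counter a b p q))
      (fun u => if u = ((x.1.G.ends e).1 : ℕ) then Γ.fstState (c.2 e) else
        if u = ((x.1.G.ends e).2 : ℕ) then Γ.sndState (c.2 e) else 0)
      (Counter.spread (Γ.edgeCount (c.2 e)))).dec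

theorem totalKey_fst (c : (Fin x.1.G.n → Γ.Label) × (Fin x.1.G.m → Γ.EdgeLabel))
    (v : Fin x.1.G.n) : (Γ.totalKey x c).1 v = totalState Γ x.1.G c.1 c.2 v := by
  have hv : (v : ℕ) ∈ x.verts := x.mem_verts.2 v.2
  simp only [totalKey, totalState, dec_keyOf, Prod.fst_add, Prod.fst_sum, Pi.add_apply,
    Finset.sum_apply, if_pos hv, Fin.ext_iff]

theorem totalKey_snd (c : (Fin x.1.G.n → Γ.Label) × (Fin x.1.G.m → Γ.EdgeLabel))
    (i : Counter a b p q) : (Γ.totalKey x c).2 i.index = totalCount Γ x.1.G c i := by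
  simp only [totalKey, totalCount, dec_keyOf, Prod.snd_add, Prod.snd_sum, Pi.add_apply,
    Finset.sum_apply, if_pos i.index_lt, Counter.spread_index]

theorem getD_params (i : Fin r) : x.params.getD i 0 = x.1.k i := by
  rw [Input.params, List.getD_eq_getElem _ _ (by simp), List.getElem_ofFn]

open Classical in
/-- The number of solutions read off from the final table. -/
theorem sum_finalTable {φ : ECMLFormula dir a b r p q} (hΓ : Γ.Verifies φ.modal) :
    (((x.finalTable Γ.vertexChoices Γ.edgeChoices (fun s => decide (Γ.Accepts s))
      (Fintype.card (Counter a b p q))).filter fun e => decide (φ.arith.HoldsAt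
        (fun i => x.params.getD i 0) (fun i => e.1.2.getD i.index 0))).map Prod.snd).sum =
      φ.numSolutions x.1 := by
  refine (Table.sum_filter _ fun t => φ.arith.HoldsAt (fun i => x.params.getD i 0)
    fun i => t i.index).trans ?_
  simp only [getD_params]
  rw [x.evalKeys_finalTable Γ.bddChoices _
    (fun t => if φ.arith.HoldsAt x.1.k (fun i => t i.index) then 1 else 0), prod_sem_tables,
    evalKeys_prod_mul_prod, numSolutions_eq hΓ]
  have h2 : ∀ c : (Fin x.1.G.n → Γ.Label) × (Fin x.1.G.m → Γ.EdgeLabel),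
      Table.acceptedValue (fun s => decide (Γ.Accepts s))
        (fun t => if φ.arith.HoldsAt x.1.k (fun i => t i.index) then 1 else 0) x.verts
        (Γ.totalKey x c) =
      if (∀ v, Γ.Accepts (totalState Γ x.1.G c.1 c.2 v)) ∧
        φ.arith.HoldsAt x.1.k (totalCount Γ x.1.G c) then 1 else 0 := by
    intro c
    have h3 : (∀ v ∈ x.verts, decide (Γ.Accepts ((Γ.totalKey x c).1 v)) = true) ↔
        ∀ v, Γ.Accepts (totalState Γ x.1.G c.1 c.2 v) := by
      constructor
      · intro h v
        have := h v (x.mem_verts.2 v.2)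
        rwa [totalKey_fst, decide_eq_true_iff] at this
      · intro h v hv
        have := h ⟨v, x.mem_verts.1 hv⟩
        rw [← totalKey_fst] at this
        exact decide_eq_true this
    unfold Table.acceptedValue
    simp only [h3, totalKey_snd]
    rw [ite_and]
  refine (Finset.sum_congr rfl fun c _ => h2 c).trans ?_
  rw [Finset.sum_boole, Nat.cast_id, ← Set.ncard_coe_finset]
  congr 1
  ext c
  rw [Finset.coe_filter, Set.mem_ofPred_eq, Set.mem_ofPred_eq, mem_labels_iff_fits]

end Verifier

/-! ### Running times -/

/-- The elements of a finite type, encoded as numbers. -/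
@[reducible]
noncomputable def Enc.ofFinite (α : Type) [Finite α] : Enc α :=
  ⟨fun x => enc (Finite.equivFin α x : ℕ), fun x => sz (Finite.equivFin α x : ℕ)⟩

theorem PT.EqTest.ofFinite (α : Type) [Finite α] [DecidableEq α] :
    letI := Enc.ofFinite α
    PT.EqTest α := by
  let _ := Enc.ofFinite α
  refine ⟨?_⟩
  have h : PT fun x : α => (Finite.equivFin α x : ℕ) := PT.of_enc_eq (fun _ => rfl) .size
  exact (PT.eq (h.comp PT.id.fst) (h.comp PT.id.snd)).congr fun x => by
    rw [decide_eq_decide, Fin.val_inj, EmbeddingLike.apply_eq_iff_eq]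

/-- The number of solutions can be computed in polynomial time in the size that includes
`K ^ (t + 1)`, where `K` is the number of states. -/
theorem ECMLFormula.pt_numSolutions {dir : Bool} {a b r p q : ℕ}
    (φ : ECMLFormula dir a b r p q) :
    ∃ K, PT fun x : Input dir a b r K => φ.numSolutions x.1 := by
  classical
  obtain ⟨Γ, hΓ⟩ := φ.modal.exists_verifies
  have : Finite (SetSemiring Γ.Label) := inferInstanceAs (Finite (Set Γ.Label))
  let _ := Enc.ofFinite Γ.State
  have := PT.EqTest.ofFinite Γ.State
  refine ⟨Nat.card Γ.State, PT.congr (PT.sum (PT.map (f := fun y => y.2.2) (PT.filter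
    (f := fun y => decide (φ.arith.HoldsAt (fun i => y.1.params.getD i 0)
      (fun i => y.2.1.2.getD i.index 0)))
    (Input.pt_finalTable Γ.bddChoices rfl fun s => decide (Γ.Accepts s)) ?_) PT.id.snd.snd))
    fun x => (Γ.sum_finalTable x hΓ).symm⟩
  exact PT.arithFormula (Input.pt_params.comp PT.id.fst) PT.id.snd.fst.snd Counter.index φ.arith

theorem PT.computableInSingleExponentialTime {dir : Bool} {a b r K : ℕ} {β : Type} [Enc β]
    {f : ECMLInstance dir a b r → β} (hf : PT fun x : Input dir a b r K => f x.1) :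
    ComputableInSingleExponentialTime fun I => enc (f I) := by
  obtain ⟨-, P, T, ⟨k, hk⟩, hP⟩ := hf
  refine ⟨(4 * (K + 1)) ^ k, (K + 1) ^ k, k, P, fun I D => ?_⟩
  obtain ⟨s, hs, hr⟩ := hP ⟨I, D⟩
  refine ⟨s, hs.trans ((hk _).trans ?_), hr⟩
  have hN : 0 < D.N := Fin.pos_iff_nonempty.2 D.isTree.connected.nonempty
  have h1 : 1 ≤ inputSize I D := by rw [inputSize]; omega
  have h2 : 1 ≤ (K + 1) ^ (D.width + 1) := Nat.one_le_pow _ _ (by omega)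
  have h3 : K ^ (D.width + 1) ≤ (K + 1) ^ (D.width + 1) := Nat.pow_le_pow_left (by omega) _
  have h4 : inputSize I D + K ^ (D.width + 1) + 2 ≤
      4 * ((K + 1) ^ (D.width + 1) * inputSize I D) := by
    have h5 := Nat.mul_le_mul h2 (le_refl (inputSize I D))
    have h6 := Nat.mul_le_mul (le_refl ((K + 1) ^ (D.width + 1))) h1
    omega
  refine (Nat.pow_le_pow_left h4 k).trans (le_of_eq ?_)
  rw [pow_right_comm (K + 1) k, ← mul_pow, ← mul_pow]
  ring

open Classical in
theorem theorem1 {dir : Bool} {a b r : ℕ} (K : Set (ECMLInstance dir a b r))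
    (hK : ExpressibleInECML K) :
    ComputableInSingleExponentialTime (fun I => TreeVal.ofBool (decide (I ∈ K))) ∧
    ∀ (p q : ℕ) (φ : ECMLFormula dir a b r p q), φ.Defines K →
      ComputableInSingleExponentialTime (fun I => TreeVal.ofNat (φ.numSolutions I)) := by
  constructor
  · obtain ⟨p, q, φ, hφ⟩ := hK
    obtain ⟨k, hk⟩ := φ.pt_numSolutions
    have h : PT fun x : Input dir a b r k => decide (x.1 ∈ K) := by
      refine (PT.eq hk (PT.const 0)).not.congr fun x => ?_
      rw [Bool.eq_iff_iff, decide_eq_true_iff, Bool.not_eq_true', decide_eq_false_iff_not, hφ,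
        ECMLFormula.numSolutions, Set.ncard_eq_zero (Set.toFinite _), ← ne_eq,
        ← Set.nonempty_iff_ne_empty]
      exact ⟨fun ⟨X, Y, h⟩ => ⟨(X, Y), h⟩, fun ⟨S, h⟩ => ⟨S.1, S.2, h⟩⟩
    exact h.computableInSingleExponentialTime (f := fun I => decide (I ∈ K))
  · intro p q φ _
    obtain ⟨k, hk⟩ := φ.pt_numSolutions
    exact hk.computableInSingleExponentialTime (f := φ.numSolutions)
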